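/- For every $n$, let $M_n$ be a random matrix from the Gaussian Unitary Ensemble $\mathrm{GUE}_n$, that is, an $n\times n$ random Hermitian matrix whose entries on and above the diagonal are mutually independent, whose diagonal entries are $N(0,1)$-distributed, and whose entries above the diagonal have independent real and imaginary parts that are $N(0,\tfrac12)$-distributed. Then \[ \frac{\log|\det M_n|-\frac12\log n!+\frac14\log n}{\sqrt{\frac12\log n}} \] converges in distribution to the standard normal law $N(0,1)$ as $n\to\infty$. -/

import Mathlib

open MeasureTheory ProbabilityTheory Filter Topology
open scoped NNReal

/-- The random matrix `M`, defined on the probability space `(Ω, P)`, is distributed according to the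
Gaussian Unitary Ensemble of order `n`, in the normalization in which the diagonal entries are
standard normal: `M` is (almost surely) Hermitian, its entries on and above the diagonal are
mutually independent, the diagonal entries are `N(0, 1)`, and the real and imaginary parts of each
entry above the diagonal are independent and `N(0, 1/2)`. -/
structure IsGUE {Ω : Type*} [MeasurableSpace Ω] {n : ℕ}
    (M : Ω → Matrix (Fin n) (Fin n) ℂ) (P : Measure Ω) : Prop where
  isHermitian : ∀ᵐ ω ∂P, (M ω).IsHermitian
  indep_entries :
    iIndepFun (fun (p : {p : Fin n × Fin n // p.1 ≤ p.2}) (ω : Ω) => M ω p.1.1 p.1.2) P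
  diag_law : ∀ i, HasLaw (fun ω => (M ω i i).re) (gaussianReal 0 1) P
  re_law : ∀ i j, i < j → HasLaw (fun ω => (M ω i j).re) (gaussianReal 0 (1 / 2)) P
  im_law : ∀ i j, i < j → HasLaw (fun ω => (M ω i j).im) (gaussianReal 0 (1 / 2)) P
  indep_re_im : ∀ i j, i < j → IndepFun (fun ω => (M ω i j).re) (fun ω => (M ω i j).im) P

-- Let `N` be the minor of `M` left after removing the first row and column. Then `det M` is `a *
-- det N` minus a quadratic form in the adjugate of `N`, evaluated on the rest of the first row,
-- which is independent of `N`. By unitary invariance (`IsGUE.map_unitary_conj`) this form may be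
-- replaced, in law, by `g` times a principal minor of `N`, where `g` is the squared norm of that
-- vector. Hence (`IsGUE.map_det_pair`) consecutive determinants obey, in law, `D' = a D - g D₋`
-- with `(a, g)` independent of `(D, D₋)`.
--
-- Divided by square roots of factorials, two consecutive determinants form a point of the plane
-- (`detPoint`), and one step turns this point by a right angle, up to a relative perturbation of
-- order `n ^ (-1/2)`. The natural test functions are the characters `|z| ^ (i t) * (z / |z|) ^ (2
-- k)`. A second order expansion shows that one step multiplies their mean by `(-1) ^ k * (1 + drift
-- / n)` and adds `1 / n` times means of index `k ± 1`, up to `O(n ^ (-3/2))`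
-- (`IsGUE.exists_recursion`). The means of index `k ± 1` change sign at each step relative to those
-- of index `k`, so their effect averages out (`exists_norm_sub_exp_mul_le`). Up to sign, the mean
-- therefore behaves like a multiple of `n ^ drift`, with `drift = -(t² / 4 + k²) - i t / 4`.
--
-- For `t = 0` and `k ≠ 0` the mean tends to zero: the angle becomes uniform modulo `π`. For `k = 0`
-- and `t = τ / √(log n / 2)` it gives the limit `exp (-τ² / 2)` for the characteristic function of
-- the logarithm of the modulus, centred at `-(log n) / 4`. A Fejér kernel estimate shows that the
-- point is rarely close to the imaginary axis, so the logarithms of its modulus and of its first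
-- coordinate, the normalized determinant, differ by a bounded amount with probability close to one.
-- This is negligible after division by `√(log n / 2)`, and Lévy's theorem concludes.

-- The law of the GUE and its unitary invariance

/-- Expansion of a determinant along the first row and the first column. -/
lemma Matrix.det_eq_sub_sum_adjugate {R : Type*} [CommRing R] {n : ℕ}
    (A : Matrix (Fin (n + 2)) (Fin (n + 2)) R) :
    A.det = A 0 0 * (A.submatrix Fin.succ Fin.succ).det -
      ∑ j, ∑ i, A 0 j.succ * (A.submatrix Fin.succ Fin.succ).adjugate j i * A i.succ 0 := by
  rw [Matrix.det_succ_row_zero, Fin.sum_univ_succ, sub_eq_add_neg, ← Finset.sum_neg_distrib]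
  congr 1
  · simp [Fin.succAbove_zero]
  refine Finset.sum_congr rfl fun j _ => ?_
  rw [Matrix.det_succ_column_zero, Finset.mul_sum, ← Finset.sum_neg_distrib]
  refine Finset.sum_congr rfl fun i _ => ?_
  rw [Matrix.adjugate_fin_succ_eq_det_submatrix]
  have h : ((A.submatrix Fin.succ (Fin.succ j).succAbove).submatrix i.succAbove Fin.succ) =
      (A.submatrix Fin.succ Fin.succ).submatrix i.succAbove j.succAbove := by
    ext k l
    simp [Fin.succ_succAbove_succ]
  rw [h]
  simp only [Matrix.submatrix_apply, Fin.succ_succAbove_zero, Fin.val_succ, pow_succ, pow_add]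
  ring

/-- A finite measure on complex square matrices is determined by its characteristic function. -/
lemma ext_of_integral_exp_trace {n : ℕ} {μ ν : Measure (Fin n → Fin n → ℂ)} [IsFiniteMeasure μ]
    [IsFiniteMeasure ν]
    (h : ∀ H : Matrix (Fin n) (Fin n) ℂ,
      ∫ x, Complex.exp (((H.conjTranspose * Matrix.of x).trace.re : ℝ) * Complex.I) ∂μ =
        ∫ x, Complex.exp (((H.conjTranspose * Matrix.of x).trace.re : ℝ) * Complex.I) ∂ν) :
    μ = ν := by
  refine Measure.ext_of_charFunDual ?_
  ext L
  rw [charFunDual_apply, charFunDual_apply]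
  -- `L` is only real-linear, so it is encoded by its values on the matrix units (real parts) and on
  -- `I` times the matrix units (imaginary parts).
  have key : ∀ x : Fin n → Fin n → ℂ, L x = ((Matrix.conjTranspose (Matrix.of fun i j =>
      (⟨L (Pi.single i (Pi.single j 1) : Fin n → Fin n → ℂ),
        L (Pi.single i (Pi.single j Complex.I) : Fin n → Fin n → ℂ)⟩ : ℂ)) *
        Matrix.of x).trace).re := by
    intro x
    have hx : x = ∑ j, ∑ i, ((x i j).re • (Pi.single i (Pi.single j 1) : Fin n → Fin n → ℂ) +
        (x i j).im • (Pi.single i (Pi.single j Complex.I) : Fin n → Fin n → ℂ)) := by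
      ext k l
      simp only [Finset.sum_apply, Pi.add_apply, Pi.smul_apply, Pi.single_apply]
      rw [Finset.sum_eq_single l, Finset.sum_eq_single k]
      · simp
      · intro i _ hi
        simp [Ne.symm hi]
      · simp
      · intro j _ hj
        refine Finset.sum_eq_zero fun i _ => ?_
        by_cases hik : k = i
        · subst hik
          simp [Ne.symm hj]
        · simp [hik]
      · simp
    conv_lhs => rw [hx]
    simp only [map_sum, map_add, map_smul, Matrix.trace, Matrix.diag, Matrix.mul_apply,
      Matrix.conjTranspose_apply, Matrix.of_apply, Complex.re_sum, Complex.mul_re, smul_eq_mul]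
    refine Finset.sum_congr rfl fun j _ => Finset.sum_congr rfl fun i _ => ?_
    simp only [RCLike.star_def, Complex.conj_re, Complex.conj_im]
    ring
  refine (integral_congr_ae (ae_of_all _ fun x =>
    congrArg (fun r : ℝ => Complex.exp (r * Complex.I)) (key x))).trans ((h _).trans
      (integral_congr_ae (ae_of_all _ fun x =>
        congrArg (fun r : ℝ => Complex.exp (r * Complex.I)) (key x).symm)))

/-- Hermitian symmetry leaves only the entries with `i ≤ j` free; this regroups sums over all
entries along the index set of the independent ones. -/
lemma Finset.sum_sum_eq_sum_subtype_le {n : ℕ} (a : Fin n → Fin n → ℝ) :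
    ∑ i, ∑ j, a i j = ∑ p : {p : Fin n × Fin n // p.1 ≤ p.2},
      (if p.1.1 = p.1.2 then a p.1.1 p.1.2 else a p.1.1 p.1.2 + a p.1.2 p.1.1) := by
  rw [← Finset.sum_subtype (p := fun p : Fin n × Fin n => p.1 ≤ p.2)
    (Finset.univ.filter fun p : Fin n × Fin n => p.1 ≤ p.2) (by simp)
    (fun p : Fin n × Fin n => if p.1 = p.2 then a p.1 p.2 else a p.1 p.2 + a p.2 p.1),
    ← Finset.sum_product' (f := a), Finset.univ_product_univ,
    ← Finset.sum_filter_add_sum_filter_not _ (fun p : Fin n × Fin n => p.1 ≤ p.2)]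
  have h1 : ∀ p : Fin n × Fin n, (if p.1 = p.2 then a p.1 p.2 else a p.1 p.2 + a p.2 p.1) =
      a p.1 p.2 + (if p.1 = p.2 then 0 else a p.2 p.1) := by
    intro p
    split_ifs <;> simp
  simp_rw [h1, Finset.sum_add_distrib]
  congr 1
  rw [Finset.sum_ite, Finset.sum_const_zero, zero_add, Finset.filter_filter]
  refine Finset.sum_bij (fun p _ => p.swap) ?_ ?_ ?_ ?_
  · intro p hp
    simp only [Finset.mem_filter, Finset.mem_univ, true_and, not_le, Prod.fst_swap,
      Prod.snd_swap] at hp ⊢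
    exact ⟨hp.le, hp.ne⟩
  · intro p _ q _ h
    exact Prod.swap_injective h
  · intro p hp
    simp only [Finset.mem_filter, Finset.mem_univ, true_and] at hp
    exact ⟨p.swap, by simpa using lt_of_le_of_ne hp.1 hp.2, by simp⟩
  · intro p _
    rfl

namespace IsGUE

variable {Ω : Type*} [MeasurableSpace Ω] {n : ℕ} {M : Ω → Matrix (Fin n) (Fin n) ℂ} {P : Measure Ω}

lemma aemeasurable_of_le (h : IsGUE M P) {i j : Fin n} (hij : i ≤ j) :
    AEMeasurable (fun ω => M ω i j) P := by
  rcases hij.eq_or_lt with rfl | hlt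
  · have h1 : AEMeasurable (fun ω => (((M ω i i).re : ℝ) : ℂ)) P :=
      Complex.measurable_ofReal.comp_aemeasurable (h.diag_law i).aemeasurable
    refine h1.congr ?_
    filter_upwards [h.isHermitian] with ω hω
    exact hω.coe_re_apply_self i
  · have h1 : AEMeasurable (fun ω => (((M ω i j).re : ℝ) : ℂ) + ((M ω i j).im : ℝ) * Complex.I) P :=
      (Complex.measurable_ofReal.comp_aemeasurable (h.re_law i j hlt).aemeasurable).add
        ((Complex.measurable_ofReal.comp_aemeasurable (h.im_law i j hlt).aemeasurable).mul_const _)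
    simpa only [Complex.re_add_im] using h1

lemma aemeasurable_apply (h : IsGUE M P) (i j : Fin n) :
    AEMeasurable (fun ω => M ω i j) P := by
  rcases le_total i j with hij | hij
  · exact h.aemeasurable_of_le hij
  · have h1 : AEMeasurable (fun ω => star (M ω j i)) P :=
      (Complex.continuous_conj.measurable.comp_aemeasurable (h.aemeasurable_of_le hij))
    refine h1.congr ?_
    filter_upwards [h.isHermitian] with ω hω
    exact hω.apply i j

lemma aemeasurable (h : IsGUE M P) :
    AEMeasurable (fun ω => Matrix.of.symm (M ω)) P :=
  aemeasurable_pi_lambda _ fun i => aemeasurable_pi_lambda _ fun j => h.aemeasurable_apply i j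

/-- The characteristic function of an entry of a matrix of the Gaussian Unitary Ensemble. -/
lemma integral_exp_entry (h : IsGUE M P) {i j : Fin n} (hij : i ≤ j) (k : ℂ)
    (hk : i = j → k.im = 0) :
    ∫ ω, Complex.exp (((star k * M ω i j).re : ℝ) * Complex.I) ∂P =
      Complex.exp (-(‖k‖ ^ 2 / (if i = j then 2 else 4) : ℝ)) := by
  have gauss : ∀ (X : Ω → ℝ) (v : ℝ≥0) (c : ℝ), HasLaw X (gaussianReal 0 v) P →
      ∫ ω, Complex.exp (((c * X ω : ℝ) : ℂ) * Complex.I) ∂P = Complex.exp (-(v * c ^ 2 / 2 : ℝ)) := by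
    intro X v c hX
    have h1 := charFun_gaussianReal (μ := 0) (v := v) c
    rw [← hX.map_eq, charFun_apply_real, integral_map hX.aemeasurable (by fun_prop)] at h1
    simp only [Complex.ofReal_mul]
    rw [h1]
    congr 1
    push_cast
    ring
  rcases hij.eq_or_lt with rfl | hlt
  · have h1 : ∀ᵐ ω ∂P, Complex.exp (((star k * M ω i i).re : ℝ) * Complex.I) =
        Complex.exp (((k.re * (M ω i i).re : ℝ) : ℂ) * Complex.I) := by
      filter_upwards [h.isHermitian] with ω hω
      simp [Complex.mul_re, hk rfl]
    rw [integral_congr_ae h1, gauss _ _ _ (h.diag_law i), Complex.sq_norm, Complex.normSq_apply,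
      hk rfl]
    simp [pow_two]
  · have h1 : ∀ ω, Complex.exp (((star k * M ω i j).re : ℝ) * Complex.I) =
        Complex.exp (((k.re * (M ω i j).re : ℝ) : ℂ) * Complex.I) *
          Complex.exp (((k.im * (M ω i j).im : ℝ) : ℂ) * Complex.I) := by
      intro ω
      rw [← Complex.exp_add]
      congr 1
      simp [Complex.mul_re]
      ring
    simp_rw [h1]
    have hind := (h.indep_re_im i j hlt).comp
      (φ := fun x : ℝ => Complex.exp (((k.re * x : ℝ) : ℂ) * Complex.I))
      (ψ := fun x : ℝ => Complex.exp (((k.im * x : ℝ) : ℂ) * Complex.I)) (by fun_prop) (by fun_prop)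
    have hm1 := (h.re_law i j hlt).aemeasurable
    have hm2 := (h.im_law i j hlt).aemeasurable
    have hc : ∀ c : ℝ, Measurable fun x : ℝ => Complex.exp (((c * x : ℝ) : ℂ) * Complex.I) := by
      fun_prop
    have h2 := hind.integral_fun_mul_eq_mul_integral
      ((hc _).comp_aemeasurable hm1).aestronglyMeasurable
      ((hc _).comp_aemeasurable hm2).aestronglyMeasurable
    simp only [Function.comp_def] at h2
    rw [h2, gauss _ _ _ (h.re_law i j hlt), gauss _ _ _ (h.im_law i j hlt), ← Complex.exp_add,
      Complex.sq_norm, Complex.normSq_apply, if_neg hlt.ne]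
    congr 1
    push_cast
    ring

/-- The characteristic function of the Gaussian Unitary Ensemble. -/
lemma integral_exp_trace (h : IsGUE M P) (H : Matrix (Fin n) (Fin n) ℂ) :
    ∫ ω, Complex.exp (((H.conjTranspose * M ω).trace.re : ℝ) * Complex.I) ∂P =
      Complex.exp (-((((H + H.conjTranspose) * (H + H.conjTranspose)).trace.re / 8 : ℝ))) := by
  -- The coefficient facing the free entry `p`: off the diagonal two transposed terms combine, and
  -- on it only the real part of `H` counts because `M ω i i` is real.
  set k : {p : Fin n × Fin n // p.1 ≤ p.2} → ℂ := fun p =>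
    if p.1.1 = p.1.2 then ((H p.1.1 p.1.1).re : ℂ) else H p.1.1 p.1.2 + star (H p.1.2 p.1.1) with hk
  have h1 : ∀ᵐ ω ∂P, Complex.exp (((H.conjTranspose * M ω).trace.re : ℝ) * Complex.I) =
      ∏ p : {p : Fin n × Fin n // p.1 ≤ p.2},
        Complex.exp (((star (k p) * M ω p.1.1 p.1.2).re : ℝ) * Complex.I) := by
    filter_upwards [h.isHermitian] with ω hω
    rw [← Complex.exp_sum, ← Finset.sum_mul, ← Complex.ofReal_sum]
    congr 3
    simp only [Matrix.trace, Matrix.diag, Matrix.mul_apply, Matrix.conjTranspose_apply,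
      Complex.re_sum]
    rw [Finset.sum_comm, Finset.sum_sum_eq_sum_subtype_le]
    refine Finset.sum_congr rfl fun p _ => ?_
    have him : (M ω p.1.1 p.1.1).im = 0 := by
      have := congrArg Complex.im (hω.apply p.1.1 p.1.1)
      simp at this
      linarith
    have hs := hω.apply p.1.2 p.1.1
    simp only [hk]
    split_ifs with hp
    · rw [← hp]
      simp [Complex.mul_re, him]
    · rw [← hs]
      simp [Complex.mul_re]
      ring
  rw [integral_congr_ae h1]
  have h2 := h.indep_entries.integral_fun_prod_comp
    (f := fun p z => Complex.exp (((star (k p) * z).re : ℝ) * Complex.I))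
    (fun p => h.aemeasurable_apply _ _)
    (fun p => (by fun_prop : Continuous fun z : ℂ =>
      Complex.exp (((star (k p) * z).re : ℝ) * Complex.I)).aestronglyMeasurable)
  rw [h2]
  have h3 : ∀ p : {p : Fin n × Fin n // p.1 ≤ p.2}, p.1.1 = p.1.2 → (k p).im = 0 := by
    intro p hp
    simp [hk, hp]
  rw [Finset.prod_congr rfl fun p _ => h.integral_exp_entry p.2 (k p) (h3 p), ← Complex.exp_sum]
  congr 1
  rw [Finset.sum_neg_distrib, ← Complex.ofReal_sum]
  congr 2
  have h4 : ((H + H.conjTranspose) * (H + H.conjTranspose)).trace.re / 8 =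
      ∑ i, ∑ j, ‖H i j + star (H j i)‖ ^ 2 / 8 := by
    simp only [Matrix.trace, Matrix.diag, Matrix.mul_apply, Matrix.add_apply,
      Matrix.conjTranspose_apply, Complex.re_sum, Finset.sum_div]
    refine Finset.sum_congr rfl fun i _ => Finset.sum_congr rfl fun j _ => ?_
    rw [Complex.sq_norm, Complex.normSq_apply]
    simp [Complex.mul_re]
    ring
  rw [h4, Finset.sum_sum_eq_sum_subtype_le]
  refine Finset.sum_congr rfl fun p _ => ?_
  simp only [hk]
  split_ifs with hp
  · rw [← hp, Complex.sq_norm, Complex.normSq_apply, Complex.sq_norm, Complex.normSq_apply]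
    simp
    ring
  · simp only [Complex.sq_norm, Complex.normSq_apply]
    simp
    ring

/-- The characteristic function determines the law and depends on `H` only through the trace of `(H
+ Hᴴ)²`. Uniqueness in law and unitary invariance are both instances. -/
lemma map_eq_of_integral_exp_trace {Ω' : Type*} [MeasurableSpace Ω'] {P' : Measure Ω'}
    [IsProbabilityMeasure P] [IsProbabilityMeasure P'] {N : Ω' → Matrix (Fin n) (Fin n) ℂ}
    (h : IsGUE M P) (hN : AEMeasurable (fun ω => Matrix.of.symm (N ω)) P')
    (hc : ∀ H : Matrix (Fin n) (Fin n) ℂ,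
      ∫ ω, Complex.exp (((H.conjTranspose * N ω).trace.re : ℝ) * Complex.I) ∂P' =
      Complex.exp (-((((H + H.conjTranspose) * (H + H.conjTranspose)).trace.re / 8 : ℝ)))) :
    P.map (fun ω => Matrix.of.symm (M ω)) = P'.map (fun ω => Matrix.of.symm (N ω)) := by
  have := Measure.isProbabilityMeasure_map h.aemeasurable
  have := Measure.isProbabilityMeasure_map hN
  refine ext_of_integral_exp_trace fun H => ?_
  have hcont : Continuous fun x : Fin n → Fin n → ℂ =>
      Complex.exp (((H.conjTranspose * Matrix.of x).trace.re : ℝ) * Complex.I) := by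
    simp only [Matrix.trace, Matrix.diag, Matrix.mul_apply, Matrix.of_apply]
    fun_prop
  rw [integral_map h.aemeasurable hcont.aestronglyMeasurable,
    integral_map hN hcont.aestronglyMeasurable]
  exact (h.integral_exp_trace H).trans (hc H).symm

lemma map_eq {Ω' : Type*} [MeasurableSpace Ω'] {P' : Measure Ω'}
    [IsProbabilityMeasure P] [IsProbabilityMeasure P'] {N : Ω' → Matrix (Fin n) (Fin n) ℂ}
    (h : IsGUE M P) (hN : IsGUE N P') :
    P.map (fun ω => Matrix.of.symm (M ω)) = P'.map (fun ω => Matrix.of.symm (N ω)) :=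
  h.map_eq_of_integral_exp_trace hN.aemeasurable hN.integral_exp_trace

/-- The Gaussian Unitary Ensemble is invariant under unitary conjugation. -/
lemma map_unitary_conj [IsProbabilityMeasure P] (h : IsGUE M P) {U : Matrix (Fin n) (Fin n) ℂ}
    (hU : U.conjTranspose * U = 1) :
    P.map (fun ω => Matrix.of.symm (M ω)) =
      P.map (fun ω => Matrix.of.symm (U * M ω * U.conjTranspose)) := by
  refine h.map_eq_of_integral_exp_trace ?_ fun H => ?_
  · have hcont : Continuous fun x : Fin n → Fin n → ℂ =>
        Matrix.of.symm (U * Matrix.of x * U.conjTranspose) := by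
      refine continuous_pi fun i => continuous_pi fun j => ?_
      simp only [Matrix.of_symm_apply, Matrix.mul_apply, Matrix.of_apply]
      fun_prop
    exact hcont.measurable.comp_aemeasurable h.aemeasurable
  · have hU' : U * U.conjTranspose = 1 := mul_eq_one_comm.mp hU
    have h1 := h.integral_exp_trace (U.conjTranspose * H * U)
    have h2 : ∀ A : Matrix (Fin n) (Fin n) ℂ,
        ((U.conjTranspose * H * U).conjTranspose * A).trace =
          (H.conjTranspose * (U * A * U.conjTranspose)).trace := by
      intro A
      rw [Matrix.conjTranspose_mul, Matrix.conjTranspose_mul, Matrix.conjTranspose_conjTranspose,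
        Matrix.mul_assoc, Matrix.trace_mul_comm]
      simp only [Matrix.mul_assoc]
    have h3 : (U.conjTranspose * H * U + (U.conjTranspose * H * U).conjTranspose) =
        U.conjTranspose * (H + H.conjTranspose) * U := by
      simp only [Matrix.conjTranspose_mul, Matrix.conjTranspose_conjTranspose, Matrix.mul_add,
        Matrix.add_mul, Matrix.mul_assoc]
    simp only [h2] at h1
    rw [h1, h3]
    congr 4
    have h4 : U.conjTranspose * (H + H.conjTranspose) * U *
        (U.conjTranspose * (H + H.conjTranspose) * U) =
        U.conjTranspose * ((H + H.conjTranspose) * (U * U.conjTranspose) *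
          (H + H.conjTranspose)) * U := by
      simp only [Matrix.mul_assoc]
    rw [h4, hU', Matrix.mul_one, Matrix.trace_mul_comm, ← Matrix.mul_assoc, hU', Matrix.one_mul]

end IsGUE

-- The recursion in law for consecutive determinants

/-- The matrix entries are only almost everywhere measurable, so the product law is computed through
measurable representatives. -/
lemma AEMeasurable.map_prodMap {α β γ δ : Type*} [MeasurableSpace α] [MeasurableSpace β]
    [MeasurableSpace γ] [MeasurableSpace δ] {μ : Measure α} {ν : Measure β} [SFinite μ] [SFinite ν]
    {f : α → γ} {g : β → δ} (hf : AEMeasurable f μ) (hg : AEMeasurable g ν) :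
    (μ.prod ν).map (Prod.map f g) = (μ.map f).prod (ν.map g) := by
  have hae : Prod.map f g =ᵐ[μ.prod ν] Prod.map (hf.mk f) (hg.mk g) := by
    filter_upwards [Measure.quasiMeasurePreserving_fst.ae hf.ae_eq_mk,
      Measure.quasiMeasurePreserving_snd.ae hg.ae_eq_mk] with p hp1 hp2
    exact Prod.ext hp1 hp2
  rw [Measure.map_congr hae, Measure.map_congr hf.ae_eq_mk, Measure.map_congr hg.ae_eq_mk,
    Measure.map_prod_map _ _ hf.measurable_mk hg.measurable_mk]

lemma AEMeasurable.prodMap {α β γ δ : Type*} [MeasurableSpace α] [MeasurableSpace β]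
    [MeasurableSpace γ] [MeasurableSpace δ] {μ : Measure α} {ν : Measure β} [SFinite μ] [SFinite ν]
    {f : α → γ} {g : β → δ} (hf : AEMeasurable f μ) (hg : AEMeasurable g ν) :
    AEMeasurable (Prod.map f g) (μ.prod ν) :=
  (hf.comp_quasiMeasurePreserving Measure.quasiMeasurePreserving_fst).prodMk
    (hg.comp_quasiMeasurePreserving Measure.quasiMeasurePreserving_snd)

/-- The adjugate of a unitary `V` is `det V • Vᴴ`, and the two determinant factors multiply to one.
Multiplicativity of the adjugate makes invertibility of `N` unnecessary. -/
lemma Matrix.adjugate_unitary_conj {n : ℕ} {V : Matrix (Fin n) (Fin n) ℂ}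
    (hV : V.conjTranspose * V = 1) (N : Matrix (Fin n) (Fin n) ℂ) :
    (V.conjTranspose * N * V).adjugate = V.conjTranspose * N.adjugate * V := by
  have hV' : V * V.conjTranspose = 1 := mul_eq_one_comm.mp hV
  have h1 : V.adjugate = V.det • V.conjTranspose := by
    calc V.adjugate = V.adjugate * (V * V.conjTranspose) := by rw [hV', Matrix.mul_one]
      _ = _ := by rw [← Matrix.mul_assoc, Matrix.adjugate_mul, Matrix.smul_mul, Matrix.one_mul]
  have h2 : V.conjTranspose.adjugate = V.conjTranspose.det • V := by
    calc V.conjTranspose.adjugate = V.conjTranspose.adjugate * (V.conjTranspose * V) := by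
          rw [hV, Matrix.mul_one]
      _ = _ := by rw [← Matrix.mul_assoc, Matrix.adjugate_mul, Matrix.smul_mul, Matrix.one_mul]
  rw [Matrix.adjugate_mul_distrib, Matrix.adjugate_mul_distrib, h1, h2]
  simp only [Matrix.smul_mul, Matrix.mul_smul, smul_smul]
  rw [← Matrix.det_mul, hV, Matrix.det_one, one_smul, Matrix.mul_assoc]

/-- A unitary matrix whose first column is proportional to a given vector. -/
lemma exists_unitary_column {n : ℕ} (w : Fin (n + 1) → ℂ) :
    ∃ V : Matrix (Fin (n + 1)) (Fin (n + 1)) ℂ, V.conjTranspose * V = 1 ∧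
      ∀ i, w i = (√(∑ j, ‖w j‖ ^ 2) : ℝ) * V i 0 := by
  set x : EuclideanSpace ℂ (Fin (n + 1)) := WithLp.toLp 2 w with hx
  have hnorm : ‖x‖ = √(∑ j, ‖w j‖ ^ 2) := by simp [hx, EuclideanSpace.norm_eq]
  rcases eq_or_ne x 0 with h0 | h0
  · refine ⟨1, by simp, fun i => ?_⟩
    have hw : w i = 0 := by
      have := congrArg (fun y : EuclideanSpace ℂ (Fin (n + 1)) => y i) h0
      simpa [hx] using this
    rw [← hnorm, h0, hw]
    simp
  -- The normalized vector, placed at index `0`, is completed to an orthonormal basis whose members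
  -- become the columns of `V`.
  · obtain ⟨b, hb⟩ := Orthonormal.exists_orthonormalBasis_extension_of_card_eq (𝕜 := ℂ)
      (E := EuclideanSpace ℂ (Fin (n + 1))) (ι := Fin (n + 1)) (by simp)
      (v := fun _ => ((‖x‖⁻¹ : ℝ) : ℂ) • x) (s := {0}) (by
        rw [orthonormal_iff_ite]
        rintro ⟨i, hi⟩ ⟨j, hj⟩
        simp only [Set.mem_singleton_iff] at hi hj
        subst hi hj
        have : (‖x‖ : ℂ) ≠ 0 := by exact_mod_cast norm_ne_zero_iff.mpr h0
        simp [inner_self_eq_norm_sq_to_K, norm_smul, h0])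
    refine ⟨Matrix.of fun i j => b j i, ?_, fun i => ?_⟩
    · ext i j
      have h1 := orthonormal_iff_ite.mp b.orthonormal i j
      rw [Matrix.mul_apply, Matrix.one_apply, ← h1, PiLp.inner_apply]
      refine Finset.sum_congr rfl fun k _ => ?_
      simp [mul_comm]
    · have : (‖x‖ : ℂ) ≠ 0 := by exact_mod_cast norm_ne_zero_iff.mpr h0
      rw [← hnorm, Matrix.of_apply, hb 0 rfl]
      simp [hx]
      rw [← hx, mul_inv_cancel_left₀ this]

/-- A quadratic form in the adjugate of `N` is, up to the norm of the vector, a principal minor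
of a unitary conjugate of `N`. -/
lemma exists_unitary_adjugate {n : ℕ} (v : Fin (n + 1) → ℂ) :
    ∃ U : Matrix (Fin (n + 1)) (Fin (n + 1)) ℂ, U.conjTranspose * U = 1 ∧
      ∀ N : Matrix (Fin (n + 1)) (Fin (n + 1)) ℂ,
        ∑ j, ∑ i, v j * N.adjugate j i * star (v i) = ((∑ j, ‖v j‖ ^ 2 : ℝ) : ℂ) *
          ((U * N * U.conjTranspose).submatrix Fin.succ Fin.succ).det := by
  -- With the first column of `V` along the conjugate of `v`, the quadratic form is a multiple of
  -- the `(0, 0)` entry of the adjugate of `Vᴴ N V`, which is a principal minor.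
  obtain ⟨V, hV, hw⟩ := exists_unitary_column fun i => star (v i)
  refine ⟨V.conjTranspose, ?_, fun N => ?_⟩
  · rw [Matrix.conjTranspose_conjTranspose]
    exact mul_eq_one_comm.mp hV
  have h1 : ((V.conjTranspose * N * V).submatrix Fin.succ Fin.succ).det =
      (V.conjTranspose * N * V).adjugate 0 0 := by
    simp [Matrix.adjugate_fin_succ_eq_det_submatrix, Fin.succAbove_zero]
  have hs : (√(∑ j, ‖star (v j)‖ ^ 2) : ℝ) ^ 2 = ∑ j, ‖v j‖ ^ 2 := by
    rw [Real.sq_sqrt (Finset.sum_nonneg fun _ _ => by positivity)]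
    simp
  rw [Matrix.conjTranspose_conjTranspose, h1, Matrix.adjugate_unitary_conj hV, ← hs]
  simp only [Matrix.mul_apply, Matrix.conjTranspose_apply, Finset.sum_mul, Finset.mul_sum]
  rw [Finset.sum_comm]
  refine Finset.sum_congr rfl fun i _ => Finset.sum_congr rfl fun j _ => ?_
  have hv : v j = (√(∑ j, ‖star (v j)‖ ^ 2) : ℝ) * star (V j 0) := by
    have := congrArg star (hw j)
    simpa [mul_comm] using this
  rw [hw i]
  nth_rw 1 [hv]
  push_cast
  ring

namespace IsGUE

variable {Ω : Type*} [MeasurableSpace Ω] {P : Measure Ω}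

lemma submatrix_succ {n : ℕ} {M : Ω → Matrix (Fin (n + 1)) (Fin (n + 1)) ℂ} (h : IsGUE M P) :
    IsGUE (fun ω => (M ω).submatrix Fin.succ Fin.succ) P where
  isHermitian := h.isHermitian.mono fun ω hω => hω.submatrix _
  indep_entries := h.indep_entries.precomp
    (g := fun p : {p : Fin n × Fin n // p.1 ≤ p.2} =>
      (⟨(p.1.1.succ, p.1.2.succ), Fin.succ_le_succ_iff.mpr p.2⟩ :
        {p : Fin (n + 1) × Fin (n + 1) // p.1 ≤ p.2}))
    (fun p q hpq => by
      simp only [Subtype.mk.injEq, Prod.mk.injEq, Fin.succ_inj] at hpq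
      exact Subtype.ext (Prod.ext hpq.1 hpq.2))
  diag_law i := h.diag_law i.succ
  re_law i j hij := h.re_law _ _ (Fin.succ_lt_succ_iff.mpr hij)
  im_law i j hij := h.im_law _ _ (Fin.succ_lt_succ_iff.mpr hij)
  indep_re_im i j hij := h.indep_re_im _ _ (Fin.succ_lt_succ_iff.mpr hij)

/-- The first row of a matrix of the Gaussian Unitary Ensemble is independent of the complementary
principal submatrix. -/
lemma indepFun_row_submatrix {n : ℕ} {M : Ω → Matrix (Fin (n + 1)) (Fin (n + 1)) ℂ}
    (h : IsGUE M P) :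
    IndepFun (fun ω => M ω 0) (fun ω => Matrix.of.symm ((M ω).submatrix Fin.succ Fin.succ)) P := by
  classical
  let ι := {p : Fin (n + 1) × Fin (n + 1) // p.1 ≤ p.2}
  let S : Finset ι := Finset.univ.filter fun p => p.1.1 = 0
  let T : Finset ι := Finset.univ.filter fun p => p.1.1 ≠ 0
  have hST : Disjoint S T := Finset.disjoint_filter_filter_not _ _ _
  have h1 := h.indep_entries.indepFun_finset₀ S T hST fun p => h.aemeasurable_apply _ _
  let φ : (S → ℂ) → Fin (n + 1) → ℂ := fun x j => x ⟨⟨(0, j), Fin.zero_le j⟩, by simp [S]⟩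
  -- The lower triangle of the submatrix is rebuilt by conjugation, so the whole submatrix is a
  -- function of the entries indexed by `T`.
  let ψ : (T → ℂ) → Fin n → Fin n → ℂ := fun x i j =>
    if hij : i ≤ j then x ⟨⟨(i.succ, j.succ), Fin.succ_le_succ_iff.mpr hij⟩, by simp [T]⟩
    else star (x ⟨⟨(j.succ, i.succ), Fin.succ_le_succ_iff.mpr (le_of_not_ge hij)⟩, by simp [T]⟩)
  have hφ : Measurable φ := measurable_pi_lambda _ fun j => measurable_pi_apply _
  have hψ : Measurable ψ := by
    refine measurable_pi_lambda _ fun i => measurable_pi_lambda _ fun j => ?_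
    by_cases hij : i ≤ j
    · simp only [ψ, hij, dite_true]
      exact measurable_pi_apply _
    · simp only [ψ, hij, dite_false]
      exact Complex.continuous_conj.measurable.comp (measurable_pi_apply _)
  refine (h1.comp hφ hψ).congr (ae_of_all _ fun ω => rfl) ?_
  filter_upwards [h.isHermitian] with ω hω
  ext i j
  simp only [ψ, Function.comp_apply, Matrix.of_symm_apply, Matrix.submatrix_apply]
  split_ifs with hij
  · rfl
  · exact hω.apply _ _

lemma re_det_eq {n : ℕ} {A : Matrix (Fin (n + 2)) (Fin (n + 2)) ℂ} (hA : A.IsHermitian) :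
    A.det.re = (A 0 0).re * (A.submatrix Fin.succ Fin.succ).det.re -
      (∑ j : Fin (n + 1), ∑ i : Fin (n + 1), A 0 j.succ *
        (A.submatrix Fin.succ Fin.succ).adjugate j i * star (A 0 i.succ)).re := by
  have h0 : (A 0 0).im = 0 := by
    have := congrArg Complex.im (hA.apply 0 0)
    simp at this
    linarith
  rw [A.det_eq_sub_sum_adjugate]
  have h1 : ∀ i : Fin (n + 1), A i.succ 0 = star (A 0 i.succ) := fun i => (hA.apply _ _).symm
  simp_rw [h1]
  simp [Complex.mul_re, h0]

/-- The law of the pair formed by the determinant of a matrix of the Gaussian Unitary Ensemble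
and its first principal minor, in terms of the same pair in one dimension less. -/
lemma map_det_pair {n : ℕ} {M : Ω → Matrix (Fin (n + 2)) (Fin (n + 2)) ℂ} [IsProbabilityMeasure P]
    (h : IsGUE M P) :
    P.map (fun ω => ((M ω).det.re, ((M ω).submatrix Fin.succ Fin.succ).det.re)) =
      (P.prod P).map (fun p =>
        ((M p.1 0 0).re * ((M p.2).submatrix Fin.succ Fin.succ).det.re -
          (∑ j : Fin (n + 1), ‖M p.1 0 j.succ‖ ^ 2) *
          (((M p.2).submatrix Fin.succ Fin.succ).submatrix Fin.succ Fin.succ).det.re,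
          ((M p.2).submatrix Fin.succ Fin.succ).det.re)) := by
  set R : Ω → (Fin (n + 2) → ℂ) := fun ω => M ω 0 with hR
  set N : Ω → (Fin (n + 1) → Fin (n + 1) → ℂ) := fun ω =>
    Matrix.of.symm ((M ω).submatrix Fin.succ Fin.succ) with hN
  have hRm : AEMeasurable R P := aemeasurable_pi_lambda _ fun j => h.aemeasurable_apply 0 j
  have hNm : AEMeasurable N P := h.submatrix_succ.aemeasurable
  let Φ₁ : (Fin (n + 2) → ℂ) → (Fin (n + 1) → Fin (n + 1) → ℂ) → ℝ × ℝ := fun r x =>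
    ((r 0).re * (Matrix.of x).det.re - (∑ j : Fin (n + 1), ∑ i : Fin (n + 1), r j.succ *
        (Matrix.of x).adjugate j i * star (r i.succ)).re, (Matrix.of x).det.re)
  let Φ₂ : (Fin (n + 2) → ℂ) → (Fin (n + 1) → Fin (n + 1) → ℂ) → ℝ × ℝ := fun r x =>
    ((r 0).re * (Matrix.of x).det.re - (∑ j : Fin (n + 1), ‖r j.succ‖ ^ 2) *
      ((Matrix.of x).submatrix Fin.succ Fin.succ).det.re, (Matrix.of x).det.re)
  have hdet : Continuous fun x : Fin (n + 1) → Fin (n + 1) → ℂ => (Matrix.of x).det :=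
    Continuous.matrix_det (A := fun x => Matrix.of x) continuous_id
  have hsub : Continuous fun x : Fin (n + 1) → Fin (n + 1) → ℂ =>
      ((Matrix.of x).submatrix Fin.succ Fin.succ).det :=
    Continuous.matrix_det (A := fun x => (Matrix.of x).submatrix Fin.succ Fin.succ)
      (continuous_matrix fun i j => by simp only [Matrix.submatrix_apply, Matrix.of_apply]; fun_prop)
  have hadj : ∀ i j, Continuous fun x : Fin (n + 1) → Fin (n + 1) → ℂ =>
      (Matrix.of x).adjugate i j := fun i j =>
    (Continuous.matrix_adjugate (A := fun x : Fin (n + 1) → Fin (n + 1) → ℂ => Matrix.of x)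
      continuous_id).matrix_elem i j
  have hΦ₁ : Measurable (Function.uncurry Φ₁) := by
    refine Continuous.measurable ?_
    simp only [Function.uncurry_def, Φ₁]
    have := fun i j => (hadj i j).comp
      (continuous_snd (X := Fin (n + 2) → ℂ) (Y := Fin (n + 1) → Fin (n + 1) → ℂ))
    have := hdet.comp (continuous_snd (X := Fin (n + 2) → ℂ) (Y := Fin (n + 1) → Fin (n + 1) → ℂ))
    simp only [Function.comp_def] at *
    fun_prop
  have hΦ₂ : Measurable (Function.uncurry Φ₂) := by
    refine Continuous.measurable ?_
    simp only [Function.uncurry_def, Φ₂]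
    have := hsub.comp (continuous_snd (X := Fin (n + 2) → ℂ) (Y := Fin (n + 1) → Fin (n + 1) → ℂ))
    have := hdet.comp (continuous_snd (X := Fin (n + 2) → ℂ) (Y := Fin (n + 1) → Fin (n + 1) → ℂ))
    simp only [Function.comp_def] at *
    fun_prop
  have hind : P.map (fun ω => (R ω, N ω)) = (P.map R).prod (P.map N) :=
    (indepFun_iff_map_prod_eq_prod_map_map hRm hNm).mp h.indepFun_row_submatrix
  have hl : P.map (fun ω => ((M ω).det.re, ((M ω).submatrix Fin.succ Fin.succ).det.re)) =
      ((P.map R).prod (P.map N)).map (Function.uncurry Φ₁) := by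
    rw [← hind, AEMeasurable.map_map_of_aemeasurable hΦ₁.aemeasurable (hRm.prodMk hNm)]
    refine Measure.map_congr ?_
    filter_upwards [h.isHermitian] with ω hω
    rw [re_det_eq hω]
    rfl
  have hr : (P.prod P).map (fun p => Φ₂ (R p.1) (N p.2)) =
      ((P.map R).prod (P.map N)).map (Function.uncurry Φ₂) := by
    have h1 := hRm.map_prodMap hNm
    rw [← h1, AEMeasurable.map_map_of_aemeasurable hΦ₂.aemeasurable
      (hRm.prodMap hNm)]
    rfl
  refine hl.trans (Eq.trans ?_ hr.symm)
  have : IsProbabilityMeasure (P.map R) := Measure.isProbabilityMeasure_map hRm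
  have : IsProbabilityMeasure (P.map N) := Measure.isProbabilityMeasure_map hNm
  ext s hs
  rw [Measure.map_apply hΦ₁ hs, Measure.map_apply hΦ₂ hs, Measure.prod_apply (hΦ₁ hs),
    Measure.prod_apply (hΦ₂ hs)]
  refine lintegral_congr fun r => ?_
  -- With the row `r` frozen, `U` depends on `r` alone and is a fixed unitary matrix, so conjugation
  -- by it preserves both the law of `N` and the determinant in the second coordinate.
  obtain ⟨U, hU, hUq⟩ := exists_unitary_adjugate fun j : Fin (n + 1) => r j.succ
  let κ : (Fin (n + 1) → Fin (n + 1) → ℂ) → (Fin (n + 1) → Fin (n + 1) → ℂ) := fun x =>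
    Matrix.of.symm (U * Matrix.of x * U.conjTranspose)
  have hκ : Measurable κ := by
    refine Continuous.measurable (continuous_pi fun i => continuous_pi fun j => ?_)
    simp only [κ, Matrix.of_symm_apply, Matrix.mul_apply, Matrix.of_apply]
    fun_prop
  have hΦ : ∀ x, Φ₁ r x = Φ₂ r (κ x) := by
    intro x
    have hd : (U * Matrix.of x * U.conjTranspose).det = (Matrix.of x).det := by
      rw [Matrix.det_mul_comm, ← Matrix.mul_assoc, hU, Matrix.one_mul]
    simp only [Φ₁, Φ₂, κ, hUq, Equiv.apply_symm_apply, hd, Complex.re_ofReal_mul]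
  have hκN : (P.map N).map κ = P.map N := by
    rw [AEMeasurable.map_map_of_aemeasurable hκ.aemeasurable hNm]
    exact (h.submatrix_succ.map_unitary_conj hU).symm
  calc P.map N (Prod.mk r ⁻¹' (Function.uncurry Φ₁ ⁻¹' s))
      = P.map N (κ ⁻¹' (Prod.mk r ⁻¹' (Function.uncurry Φ₂ ⁻¹' s))) := by
        congr 1
        ext x
        simp [hΦ]
    _ = _ := by
        rw [← Measure.map_apply hκ (measurable_prodMk_left (hΦ₂ hs)), hκN]

end IsGUE

-- Moments of the first row, and nonvanishing of the determinant

/-- `f` is integrable with integral `I`. -/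
def HasMean {Ω E : Type*} [MeasurableSpace Ω] [NormedAddCommGroup E] [NormedSpace ℝ E]
    (P : Measure Ω) (f : Ω → E) (I : E) : Prop :=
  Integrable f P ∧ ∫ ω, f ω ∂P = I

namespace HasMean

variable {Ω E : Type*} [MeasurableSpace Ω] [NormedAddCommGroup E] [NormedSpace ℝ E]
  {P : Measure Ω} {f g : Ω → E} {I J : E}

lemma add (hf : HasMean P f I) (hg : HasMean P g J) : HasMean P (fun ω => f ω + g ω) (I + J) :=
  ⟨hf.1.add hg.1, by rw [integral_add hf.1 hg.1, hf.2, hg.2]⟩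

lemma sub (hf : HasMean P f I) (hg : HasMean P g J) : HasMean P (fun ω => f ω - g ω) (I - J) :=
  ⟨hf.1.sub hg.1, by rw [integral_sub hf.1 hg.1, hf.2, hg.2]⟩

lemma const [CompleteSpace E] [IsProbabilityMeasure P] (c : E) : HasMean P (fun _ => c) c :=
  ⟨integrable_const c, by simp⟩

lemma const_mul {f : Ω → ℝ} {I : ℝ} (hf : HasMean P f I) (c : ℝ) :
    HasMean P (fun ω => c * f ω) (c * I) :=
  ⟨hf.1.const_mul c, by rw [integral_const_mul, hf.2]⟩

lemma congr_fun (hf : HasMean P f I) (h : ∀ ω, g ω = f ω) : HasMean P g I := by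
  rwa [show g = f from funext h]

lemma le_of_le {f g : Ω → ℝ} {I J : ℝ} (hf : HasMean P f I) (hg : HasMean P g J)
    (h : ∀ ω, f ω ≤ g ω) : I ≤ J := by
  rw [← hf.2, ← hg.2]
  exact integral_mono hf.1 hg.1 h

end HasMean

lemma integral_sq_gaussianReal (v : ℝ≥0) : ∫ x, x ^ 2 ∂gaussianReal 0 v = v := by
  have h := variance_of_integral_eq_zero (μ := gaussianReal 0 v) (X := fun x : ℝ => x)
    (by fun_prop) (by simp)
  rw [← h]
  simp

/-- The value is the fourth derivative at zero of the moment generating function; all derivatives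
are a polynomial times `exp (v t² / 2)`, and `hp` is the rule for the polynomial. -/
lemma integral_pow_four_gaussianReal (v : ℝ≥0) : ∫ x, x ^ 4 ∂gaussianReal 0 v = 3 * (v : ℝ) ^ 2 := by
  have h1 := iteratedDeriv_mgf_zero (X := fun x : ℝ => x) (μ := gaussianReal 0 v) (by
    have := integrableExpSet_id_gaussianReal (μ := 0) (v := v)
    change integrableExpSet (fun x : ℝ => x) _ = _ at this
    simp [this]) 4
  have h2 : mgf (fun x : ℝ => x) (gaussianReal 0 v) = fun t => Real.exp (v * t ^ 2 / 2) := by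
    have := mgf_fun_id_gaussianReal (μ := 0) (v := v)
    rw [this]
    simp
  have hp : ∀ (p p' : ℝ → ℝ), (∀ t, HasDerivAt p (p' t) t) →
      deriv (fun t => p t * Real.exp (v * t ^ 2 / 2)) =
        fun t => (p' t + v * t * p t) * Real.exp (v * t ^ 2 / 2) := by
    intro p p' hpp
    ext t
    have h3 : HasDerivAt (fun t : ℝ => (v : ℝ) * t ^ 2 / 2) (v * t) t := by
      have := ((hasDerivAt_pow 2 t).const_mul (v : ℝ)).div_const 2
      exact this.congr_deriv (by push_cast; ring)
    have := ((hpp t).mul h3.exp).deriv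
    simp only [Pi.mul_def] at this
    rw [this]
    ring
  have d0 := hp (fun _ => 1) (fun _ => 0) (fun t => hasDerivAt_const _ _)
  have d1 := hp (fun t => v * t) (fun _ => v) (fun t => by
    simpa using (hasDerivAt_id t).const_mul (v : ℝ))
  have d2 := hp (fun t => v + v ^ 2 * t ^ 2) (fun t => 2 * v ^ 2 * t) (fun t => by
    have := ((hasDerivAt_pow 2 t).const_mul ((v : ℝ) ^ 2)).const_add (v : ℝ)
    exact this.congr_deriv (by push_cast; ring))
  have d3 := hp (fun t => 3 * v ^ 2 * t + v ^ 3 * t ^ 3) (fun t => 3 * v ^ 2 + 3 * v ^ 3 * t ^ 2)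
    (fun t => by
      have := ((hasDerivAt_id t).const_mul (3 * (v : ℝ) ^ 2)).add
        ((hasDerivAt_pow 3 t).const_mul ((v : ℝ) ^ 3))
      exact this.congr_deriv (by push_cast; ring))
  rw [← show _ = ∫ x, x ^ 4 ∂gaussianReal 0 v from h1, h2]
  simp only [iteratedDeriv_succ, iteratedDeriv_zero]
  have e0 : (fun t : ℝ => Real.exp (v * t ^ 2 / 2)) = fun t => 1 * Real.exp (v * t ^ 2 / 2) := by
    simp
  have e1 : (fun t : ℝ => (0 + (v : ℝ) * t * 1) * Real.exp (v * t ^ 2 / 2)) =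
      fun t => (v * t) * Real.exp (v * t ^ 2 / 2) := by
    ext t; ring
  have e2 : (fun t : ℝ => ((v : ℝ) + (v : ℝ) * t * (v * t)) * Real.exp (v * t ^ 2 / 2)) =
      fun t => (v + v ^ 2 * t ^ 2) * Real.exp (v * t ^ 2 / 2) := by
    ext t; ring
  have e3 : (fun t : ℝ => (2 * (v : ℝ) ^ 2 * t + (v : ℝ) * t * (v + v ^ 2 * t ^ 2)) *
      Real.exp (v * t ^ 2 / 2)) =
      fun t => (3 * v ^ 2 * t + v ^ 3 * t ^ 3) * Real.exp (v * t ^ 2 / 2) := by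
    ext t; ring
  rw [e0, d0, e1, d1, e2, d2, e3, d3]
  simp

lemma integrable_pow_gaussianReal (v : ℝ≥0) (k : ℕ) :
    Integrable (fun x : ℝ => x ^ k) (gaussianReal 0 v) := by
  have h := (memLp_id_gaussianReal' (μ := 0) (v := v) k (by simp)).integrable_norm_pow'
  refine h.mono (by fun_prop) (ae_of_all _ fun x => ?_)
  simp

section FourthMoment

variable {Ω : Type*} [MeasurableSpace Ω] {P : Measure Ω} [IsProbabilityMeasure P]

lemma integrable_pow_of_integrable_pow_four {X : Ω → ℝ} (hX : AEMeasurable X P)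
    (h4 : Integrable (fun ω => X ω ^ 4) P) {k : ℕ} (hk : k ≤ 4) :
    Integrable (fun ω => X ω ^ k) P := by
  refine ((integrable_const (1 : ℝ)).add h4).mono (hX.pow_const k).aestronglyMeasurable
    (ae_of_all _ fun ω => ?_)
  simp only [Pi.add_apply, norm_pow, Real.norm_eq_abs]
  have h0 : (0 : ℝ) ≤ X ω ^ 4 := by positivity
  rw [abs_of_nonneg (by linarith : (0 : ℝ) ≤ 1 + X ω ^ 4)]
  rcases le_total |X ω| 1 with h | h
  · exact (pow_le_one₀ (abs_nonneg _) h).trans (by linarith)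
  · calc |X ω| ^ k ≤ |X ω| ^ 4 := pow_le_pow_right₀ h hk
      _ = X ω ^ 4 := by rw [← abs_pow, abs_of_nonneg h0]
      _ ≤ _ := by linarith

/-- Moments of order at most four of a sum of independent centred variables. -/
lemma iIndepFun.moments_sum {ι : Type*} {ξ : ι → Ω → ℝ} (hind : iIndepFun ξ P)
    (hm : ∀ i, AEMeasurable (ξ i) P) {C : ℝ} (h4 : ∀ i, Integrable (fun ω => ξ i ω ^ 4) P)
    (h1 : ∀ i, ∫ ω, ξ i ω ∂P = 0) (h2 : ∀ i, ∫ ω, ξ i ω ^ 2 ∂P = 1)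
    (hC : ∀ i, ∫ ω, ξ i ω ^ 4 ∂P ≤ C) (s : Finset ι) :
    Integrable (fun ω => (∑ i ∈ s, ξ i ω) ^ 4) P ∧ ∫ ω, (∑ i ∈ s, ξ i ω) ∂P = 0 ∧
      ∫ ω, (∑ i ∈ s, ξ i ω) ^ 2 ∂P = s.card ∧
      ∫ ω, (∑ i ∈ s, ξ i ω) ^ 4 ∂P ≤ (C + 3) * (s.card : ℝ) ^ 2 := by
  classical
  induction s using Finset.induction_on with
  | empty => simp
  | insert i s hi ih =>
    obtain ⟨ih4, ih1, ih2, ihC⟩ := ih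
    set S : Ω → ℝ := fun ω => ∑ i ∈ s, ξ i ω with hS
    have hSm : AEMeasurable S P := Finset.aemeasurable_fun_sum s fun i _ => hm i
    have hSX : IndepFun S (ξ i) P := by
      have := hind.indepFun_finsetSum_of_notMem₀ hm hi
      convert this using 1
      ext ω
      simp [hS]
    have hpow : ∀ a b : ℕ, IndepFun (fun ω => S ω ^ a) (fun ω => ξ i ω ^ b) P := fun a b =>
      hSX.comp (φ := fun x => x ^ a) (ψ := fun x => x ^ b) (by fun_prop) (by fun_prop)
    have hSi : ∀ k ≤ 4, Integrable (fun ω => S ω ^ k) P := fun k hk =>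
      integrable_pow_of_integrable_pow_four hSm ih4 hk
    have hXi : ∀ k ≤ 4, Integrable (fun ω => ξ i ω ^ k) P := fun k hk =>
      integrable_pow_of_integrable_pow_four (hm i) (h4 i) hk
    have hint : ∀ a b : ℕ, a ≤ 4 → b ≤ 4 → Integrable (fun ω => S ω ^ a * ξ i ω ^ b) P :=
      fun a b ha hb => (hpow a b).integrable_mul (hSi a ha) (hXi b hb)
    have hval : ∀ a b : ℕ, ∫ ω, S ω ^ a * ξ i ω ^ b ∂P =
        (∫ ω, S ω ^ a ∂P) * ∫ ω, ξ i ω ^ b ∂P := fun a b =>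
      (hpow a b).integral_fun_mul_eq_mul_integral (hSm.pow_const a).aestronglyMeasurable
        ((hm i).pow_const b).aestronglyMeasurable
    have hmean : ∀ a b : ℕ, a ≤ 4 → b ≤ 4 → HasMean P (fun ω => S ω ^ a * ξ i ω ^ b)
        ((∫ ω, S ω ^ a ∂P) * ∫ ω, ξ i ω ^ b ∂P) := fun a b ha hb => ⟨hint a b ha hb, hval a b⟩
    have m1 : HasMean P (fun ω => S ω + ξ i ω) (0 + 0) :=
      HasMean.add ⟨by simpa using hSi 1 (by norm_num), ih1⟩
        ⟨by simpa using hXi 1 (by norm_num), h1 i⟩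
    have m2 := ((hmean 2 0 (by norm_num) (by norm_num)).add
      ((hmean 1 1 (by norm_num) (by norm_num)).const_mul 2)).add
      (hmean 0 2 (by norm_num) (by norm_num))
    have m4 := ((((hmean 4 0 (by norm_num) (by norm_num)).add
      ((hmean 3 1 (by norm_num) (by norm_num)).const_mul 4)).add
      ((hmean 2 2 (by norm_num) (by norm_num)).const_mul 6)).add
      ((hmean 1 3 (by norm_num) (by norm_num)).const_mul 4)).add
      (hmean 0 4 (by norm_num) (by norm_num))
    replace m2 := m2.congr_fun (g := fun ω => (S ω + ξ i ω) ^ 2) fun ω => by ring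
    replace m4 := m4.congr_fun (g := fun ω => (S ω + ξ i ω) ^ 4) fun ω => by ring
    have hsum : ∀ ω, ∑ j ∈ insert i s, ξ j ω = S ω + ξ i ω := fun ω => by
      rw [Finset.sum_insert hi, add_comm]
    simp_rw [hsum]
    have hone : ∫ _, (1 : ℝ) ∂P = 1 := by simp
    refine ⟨m4.1, m1.2.trans (add_zero 0), m2.2.trans ?_, m4.2.trans_le ?_⟩
    · simp only [pow_one, pow_zero, h1, h2, hone, Finset.card_insert_of_notMem hi]
      rw [ih2]
      push_cast
      ring
    · simp only [pow_one, pow_zero, h1, h2, hone, Finset.card_insert_of_notMem hi]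
      rw [ih2, ih1]
      -- Centring kills the cross terms with odd exponents. What remains is at most `(C + 3) s² + 6
      -- s + C`, which is below `(C + 3) (s + 1)²` as `C ≥ 0`.
      have hC0 : 0 ≤ C := le_trans (integral_nonneg fun ω => by positivity) (hC i)
      have := hC i
      have hs0 : (0 : ℝ) ≤ s.card := Nat.cast_nonneg _
      push_cast
      nlinarith [mul_nonneg hC0 hs0]

end FourthMoment

/-- The moments of the pair formed by the diagonal entry `a` and the squared norm `g` of the
remaining `m` entries of the first row of a matrix of the Gaussian Unitary Ensemble. -/
structure HasRowMoments {Ω : Type*} [MeasurableSpace Ω] (P : Measure Ω) (a g : Ω → ℝ) (m : ℕ)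
    (K : ℝ) : Prop where
  aemeasurable_fst : AEMeasurable a P
  aemeasurable_snd : AEMeasurable g P
  integrable_fst : Integrable (fun ω => a ω ^ 4) P
  integrable_snd : Integrable (fun ω => (g ω - m) ^ 4) P
  integral_fst : ∫ ω, a ω ∂P = 0
  integral_fst_sq : ∫ ω, a ω ^ 2 ∂P = 1
  integral_fst_pow_four : ∫ ω, a ω ^ 4 ∂P ≤ K
  integral_snd : ∫ ω, (g ω - m) ∂P = 0
  integral_snd_sq : ∫ ω, (g ω - m) ^ 2 ∂P = m
  integral_snd_pow_four : ∫ ω, (g ω - m) ^ 4 ∂P ≤ K * m ^ 2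
  integral_mul : ∫ ω, a ω * (g ω - m) ∂P = 0

namespace IsGUE

variable {Ω : Type*} [MeasurableSpace Ω] {P : Measure Ω}

lemma aemeasurable_det_pair {n : ℕ} {M : Ω → Matrix (Fin (n + 1)) (Fin (n + 1)) ℂ}
    (h : IsGUE M P) :
    AEMeasurable (fun ω => ((M ω).det.re, ((M ω).submatrix Fin.succ Fin.succ).det.re)) P := by
  have hdet : ∀ m : ℕ, Measurable fun x : Fin m → Fin m → ℂ => (Matrix.of x).det.re := by
    intro m
    have hc : Continuous fun x : Fin m → Fin m → ℂ => (Matrix.of x).det :=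
      Continuous.matrix_det (A := fun x => Matrix.of x) continuous_id
    exact (Complex.continuous_re.comp hc).measurable
  exact ((hdet _).comp_aemeasurable h.aemeasurable).prodMk
    ((hdet _).comp_aemeasurable h.submatrix_succ.aemeasurable)

lemma aemeasurable_row_pair {n : ℕ} {M : Ω → Matrix (Fin (n + 1)) (Fin (n + 1)) ℂ}
    (h : IsGUE M P) :
    AEMeasurable (fun ω => ((M ω 0 0).re, ∑ j : Fin n, ‖M ω 0 j.succ‖ ^ 2)) P :=
  (h.diag_law 0).aemeasurable.prodMk
    (Finset.aemeasurable_fun_sum _ fun j _ => (h.aemeasurable_apply 0 j.succ).norm.pow_const 2)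

lemma iIndepFun_row {n : ℕ} {M : Ω → Matrix (Fin (n + 1)) (Fin (n + 1)) ℂ} (h : IsGUE M P) :
    iIndepFun (fun j ω => M ω 0 j) P :=
  h.indep_entries.precomp
    (g := fun j : Fin (n + 1) => (⟨(0, j), Fin.zero_le j⟩ :
      {p : Fin (n + 1) × Fin (n + 1) // p.1 ≤ p.2}))
    (fun i j hij => by simpa using hij)

lemma indepFun_diag_row {n : ℕ} {M : Ω → Matrix (Fin (n + 1)) (Fin (n + 1)) ℂ} (h : IsGUE M P) :
    IndepFun (fun ω => (M ω 0 0).re) (fun ω => ∑ j : Fin n, ‖M ω 0 j.succ‖ ^ 2) P := by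
  classical
  have h1 := h.iIndepFun_row.indepFun_finset₀ {0} (Finset.univ.erase 0) (by simp)
    fun j => h.aemeasurable_apply _ _
  let φ : (({0} : Finset (Fin (n + 1))) → ℂ) → ℝ := fun x => (x ⟨0, by simp⟩).re
  let ψ : ((Finset.univ.erase (0 : Fin (n + 1)) : Finset (Fin (n + 1))) → ℂ) → ℝ := fun x =>
    ∑ j : Fin n, ‖x ⟨j.succ, by simp⟩‖ ^ 2
  exact h1.comp (φ := φ) (ψ := ψ) (by fun_prop) (by fun_prop)

/-- A bound for the fourth central moment of the squared norm of an entry. -/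
lemma exists_entry_pow_four_le : ∃ C : ℝ, ∀ {Ω : Type*} [MeasurableSpace Ω] (P : Measure Ω)
    [IsProbabilityMeasure P] (X Y : Ω → ℝ), HasLaw X (gaussianReal 0 (1 / 2)) P →
    HasLaw Y (gaussianReal 0 (1 / 2)) P →
    Integrable (fun ω => (X ω ^ 2 + Y ω ^ 2 - 1) ^ 4) P ∧
      ∫ ω, (X ω ^ 2 + Y ω ^ 2 - 1) ^ 4 ∂P ≤ C := by
  -- By convexity the fourth power is at most `27 (X⁸ + Y⁸ + 1)`, and both eighth moments are the
  -- same Gaussian one.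
  refine ⟨54 * (∫ x, x ^ 8 ∂gaussianReal 0 (1 / 2)) + 27, fun P _ X Y hX hY => ?_⟩
  have hpow : ∀ {Z}, HasLaw Z (gaussianReal 0 (1 / 2)) P → Integrable (fun ω => Z ω ^ 8) P ∧
      ∫ ω, Z ω ^ 8 ∂P = ∫ x, x ^ 8 ∂gaussianReal 0 (1 / 2) := by
    intro Z hZ
    have hi := integrable_pow_gaussianReal (1 / 2) 8
    refine ⟨?_, hZ.integral_comp hi.aestronglyMeasurable⟩
    rw [← hZ.map_eq] at hi
    exact hi.comp_aemeasurable hZ.aemeasurable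
  obtain ⟨hX8, hXv⟩ := hpow hX
  obtain ⟨hY8, hYv⟩ := hpow hY
  have hdom := ((HasMean.const_mul ⟨hX8, hXv⟩ 27).add (HasMean.const_mul ⟨hY8, hYv⟩ 27)).add
    (HasMean.const (P := P) (27 : ℝ))
  have hle : ∀ ω, (X ω ^ 2 + Y ω ^ 2 - 1) ^ 4 ≤ 27 * X ω ^ 8 + 27 * Y ω ^ 8 + 27 := by
    intro ω
    have h1 : (X ω ^ 2 + Y ω ^ 2 - 1) ^ 2 ≤ 3 * (X ω ^ 4 + Y ω ^ 4 + 1) := by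
      nlinarith [sq_nonneg (X ω ^ 2 - Y ω ^ 2), sq_nonneg (X ω ^ 2 + 1), sq_nonneg (Y ω ^ 2 + 1)]
    have h2 : (X ω ^ 4 + Y ω ^ 4 + 1) ^ 2 ≤ 3 * (X ω ^ 8 + Y ω ^ 8 + 1) := by
      nlinarith [sq_nonneg (X ω ^ 4 - Y ω ^ 4), sq_nonneg (X ω ^ 4 - 1), sq_nonneg (Y ω ^ 4 - 1)]
    calc (X ω ^ 2 + Y ω ^ 2 - 1) ^ 4 = ((X ω ^ 2 + Y ω ^ 2 - 1) ^ 2) ^ 2 := by ring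
      _ ≤ (3 * (X ω ^ 4 + Y ω ^ 4 + 1)) ^ 2 := by gcongr
      _ = 9 * (X ω ^ 4 + Y ω ^ 4 + 1) ^ 2 := by ring
      _ ≤ _ := by linarith
  have hm : AEStronglyMeasurable (fun ω => (X ω ^ 2 + Y ω ^ 2 - 1) ^ 4) P := by
    have := hX.aemeasurable
    have := hY.aemeasurable
    exact AEMeasurable.aestronglyMeasurable (by fun_prop)
  have hi : Integrable (fun ω => (X ω ^ 2 + Y ω ^ 2 - 1) ^ 4) P := by
    refine hdom.1.mono hm (ae_of_all _ fun ω => ?_)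
    have h0 : (0 : ℝ) ≤ (X ω ^ 2 + Y ω ^ 2 - 1) ^ 4 := by positivity
    simp only [Real.norm_eq_abs]
    rw [abs_of_nonneg h0]
    exact (hle ω).trans (le_abs_self _)
  refine ⟨hi, (integral_mono hi hdom.1 hle).trans (le_of_eq (hdom.2.trans ?_))⟩
  ring

/-- The variables `‖M 0 j‖² - 1` are independent, centred and of variance one, so
`iIndepFun.moments_sum` applies to their sum. The point is that `K` does not depend on the order of
the matrix. -/
lemma exists_hasRowMoments : ∃ K : ℝ, ∀ {Ω : Type*} [MeasurableSpace Ω] (P : Measure Ω)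
    [IsProbabilityMeasure P] {n : ℕ} (M : Ω → Matrix (Fin (n + 1)) (Fin (n + 1)) ℂ), IsGUE M P →
    HasRowMoments P (fun ω => (M ω 0 0).re) (fun ω => ∑ j : Fin n, ‖M ω 0 j.succ‖ ^ 2) n K := by
  obtain ⟨C, hC⟩ := exists_entry_pow_four_le
  -- `3` is the fourth moment of the standard normal entry, `C + 3` the constant for the sum of
  -- squares.
  refine ⟨max 3 (C + 3), fun {Ω} _ P _ n M h => ?_⟩
  have hgi : ∀ {Z : Ω → ℝ} {v : ℝ≥0} (k : ℕ), HasLaw Z (gaussianReal 0 v) P →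
      Integrable (fun ω => Z ω ^ k) P := by
    intro Z v k hZ
    have hi := integrable_pow_gaussianReal v k
    rw [← hZ.map_eq] at hi
    exact hi.comp_aemeasurable hZ.aemeasurable
  have hgv : ∀ {Z : Ω → ℝ} {v : ℝ≥0} (k : ℕ), HasLaw Z (gaussianReal 0 v) P →
      ∫ ω, Z ω ^ k ∂P = ∫ x, x ^ k ∂gaussianReal 0 v := fun k hZ =>
    hZ.integral_comp (integrable_pow_gaussianReal _ k).aestronglyMeasurable
  set ξ : Fin n → Ω → ℝ := fun j ω => ‖M ω 0 j.succ‖ ^ 2 - 1 with hξ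
  have hre := fun j : Fin n => h.re_law 0 j.succ (Fin.succ_pos j)
  have him := fun j : Fin n => h.im_law 0 j.succ (Fin.succ_pos j)
  have hξe : ∀ j, ξ j = fun ω => (M ω 0 j.succ).re ^ 2 + (M ω 0 j.succ).im ^ 2 - 1 := by
    intro j
    ext ω
    simp only [hξ, Complex.sq_norm, Complex.normSq_apply]
    ring
  have hξm : ∀ j, AEMeasurable (ξ j) P := fun j =>
    ((h.aemeasurable_apply 0 j.succ).norm.pow_const 2).sub_const 1
  have hξind : iIndepFun ξ P := by
    have h1 := h.iIndepFun_row.precomp (g := Fin.succ) (Fin.succ_injective n)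
    exact h1.comp (fun _ z => ‖z‖ ^ 2 - 1) (fun _ => by fun_prop)
  have hgm : ∀ {Z : Ω → ℝ} {v : ℝ≥0} (k : ℕ), HasLaw Z (gaussianReal 0 v) P →
      HasMean P (fun ω => Z ω ^ k) (∫ x, x ^ k ∂gaussianReal 0 v) := fun k hZ =>
    ⟨hgi k hZ, hgv k hZ⟩
  have hξ1 : ∀ j, ∫ ω, ξ j ω ∂P = 0 := by
    intro j
    have h1 := ((hgm 2 (hre j)).add (hgm 2 (him j))).sub (HasMean.const 1)
    rw [hξe, h1.2, integral_sq_gaussianReal]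
    simp
    norm_num
  have hξ2 : ∀ j, ∫ ω, ξ j ω ^ 2 ∂P = 1 := by
    intro j
    have hc : IndepFun (fun ω => (M ω 0 j.succ).re ^ 2) (fun ω => (M ω 0 j.succ).im ^ 2) P :=
      (h.indep_re_im 0 j.succ (Fin.succ_pos j)).comp (φ := fun x => x ^ 2) (ψ := fun x => x ^ 2)
        (by fun_prop) (by fun_prop)
    have hcm : HasMean P (fun ω => (M ω 0 j.succ).re ^ 2 * (M ω 0 j.succ).im ^ 2) _ :=
      ⟨hc.integrable_mul (hgi 2 (hre j)) (hgi 2 (him j)),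
        hc.integral_fun_mul_eq_mul_integral (hgi 2 (hre j)).aestronglyMeasurable
          (hgi 2 (him j)).aestronglyMeasurable⟩
    have h1 := (((((hgm 4 (hre j)).add (hgm 4 (him j))).add (HasMean.const 1)).add
      (hcm.const_mul 2)).sub ((hgm 2 (hre j)).const_mul 2)).sub ((hgm 2 (him j)).const_mul 2)
    replace h1 := h1.congr_fun (g := fun ω => ξ j ω ^ 2) fun ω => by
      rw [hξe]
      ring
    rw [h1.2, hgv 2 (hre j), hgv 2 (him j), integral_sq_gaussianReal,
      integral_pow_four_gaussianReal]
    simp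
    norm_num
  have hξC : ∀ j, Integrable (fun ω => ξ j ω ^ 4) P ∧ ∫ ω, ξ j ω ^ 4 ∂P ≤ C := by
    intro j
    rw [hξe]
    exact hC P _ _ (hre j) (him j)
  obtain ⟨s4, s1, s2, sC⟩ := iIndepFun.moments_sum hξind hξm (fun j => (hξC j).1) hξ1 hξ2
    (fun j => (hξC j).2) Finset.univ
  have hg : ∀ ω, ∑ j, ξ j ω = ∑ j : Fin n, ‖M ω 0 j.succ‖ ^ 2 - n := by
    intro ω
    simp [hξ]
  simp only [hg, Finset.card_univ, Fintype.card_fin] at s4 s1 s2 sC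
  have hgam : AEMeasurable (fun ω => ∑ j : Fin n, ‖M ω 0 j.succ‖ ^ 2) P :=
    Finset.aemeasurable_fun_sum _ fun j _ => (h.aemeasurable_apply 0 j.succ).norm.pow_const 2
  have ha1 : ∫ ω, (M ω 0 0).re ∂P = 0 := by
    have := hgv 1 (h.diag_law 0)
    simpa using this
  exact
  { aemeasurable_fst := (h.diag_law 0).aemeasurable
    aemeasurable_snd := hgam
    integrable_fst := hgi 4 (h.diag_law 0)
    integrable_snd := s4
    integral_fst := ha1
    integral_fst_sq := by rw [hgv 2 (h.diag_law 0), integral_sq_gaussianReal]; simp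
    integral_fst_pow_four := by
      rw [hgv 4 (h.diag_law 0), integral_pow_four_gaussianReal]; simp
    integral_snd := s1
    integral_snd_sq := s2
    integral_snd_pow_four := sC.trans (by gcongr; exact le_max_right _ _)
    integral_mul := by
      have hind : IndepFun (fun ω => (M ω 0 0).re)
          (fun ω => ∑ j : Fin n, ‖M ω 0 j.succ‖ ^ 2 - n) P :=
        h.indepFun_diag_row.comp (φ := id) (ψ := fun x : ℝ => x - n) measurable_id (by fun_prop)
      rw [hind.integral_fun_mul_eq_mul_integral (h.diag_law 0).aemeasurable.aestronglyMeasurable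
        (hgam.sub_const _).aestronglyMeasurable, ha1, zero_mul] }

/-- The first entry `(a, g)` of the recursion for the determinants, and the determinants in lower
dimension, enter the law of the determinants as independent variables. -/
lemma map_det_pair_eq_map_prod [IsProbabilityMeasure P] {n : ℕ}
    {M : Ω → Matrix (Fin (n + 2)) (Fin (n + 2)) ℂ} (h : IsGUE M P) :
    P.map (fun ω => ((M ω).det.re, ((M ω).submatrix Fin.succ Fin.succ).det.re)) =
      ((P.map fun ω => ((M ω 0 0).re, ∑ j : Fin (n + 1), ‖M ω 0 j.succ‖ ^ 2)).prod
        (P.map fun ω => (((M ω).submatrix Fin.succ Fin.succ).det.re,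
          (((M ω).submatrix Fin.succ Fin.succ).submatrix Fin.succ Fin.succ).det.re))).map
        (fun p : (ℝ × ℝ) × (ℝ × ℝ) => (p.1.1 * p.2.1 - p.1.2 * p.2.2, p.2.1)) := by
  rw [h.map_det_pair, ← AEMeasurable.map_prodMap h.aemeasurable_row_pair
    h.submatrix_succ.aemeasurable_det_pair,
    AEMeasurable.map_map_of_aemeasurable (Measurable.aemeasurable (by fun_prop))
      (h.aemeasurable_row_pair.prodMap h.submatrix_succ.aemeasurable_det_pair)]
  rfl

/-- The determinant of a matrix of the Gaussian Unitary Ensemble is almost surely nonzero. -/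
lemma ae_re_det_ne_zero [IsProbabilityMeasure P] : ∀ {n : ℕ}
    {M : Ω → Matrix (Fin n) (Fin n) ℂ}, IsGUE M P → ∀ᵐ ω ∂P, (M ω).det.re ≠ 0 := by
  have hna : NullSingletonClass (gaussianReal 0 1) := nullSingletonClass_gaussianReal one_ne_zero
  intro n
  induction n with
  | zero => intro M _; simp
  | succ n ih =>
    intro M h
    cases n with
    | zero =>
      have h1 : ∀ᵐ ω ∂P, (M ω 0 0).re ∈ ({0} : Set ℝ)ᶜ := by
        refine ae_of_ae_map (p := fun x => x ∈ ({0} : Set ℝ)ᶜ) (h.diag_law 0).aemeasurable ?_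
        rw [(h.diag_law 0).map_eq]
        exact compl_mem_ae_iff.mpr (measure_singleton 0)
      filter_upwards [h1] with ω hω
      simpa [Matrix.det_fin_one] using hω
    | succ n =>
      have hs : MeasurableSet {x : ℝ × ℝ | x.1 ≠ 0} := by measurability
      have hpair : ∀ᵐ x ∂P.map (fun ω => ((M ω).det.re,
          ((M ω).submatrix Fin.succ Fin.succ).det.re)), x.1 ≠ 0 := by
        rw [h.map_det_pair_eq_map_prod, ae_map_iff (Measurable.aemeasurable (by fun_prop)) hs,
          (indepFun_iff_map_prod_eq_prod_map_map (h.diag_law 0).aemeasurable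
            h.aemeasurable_row_pair.snd).mp h.indepFun_diag_row, (h.diag_law 0).map_eq]
        have := Measure.isProbabilityMeasure_map h.submatrix_succ.aemeasurable_det_pair
        have := Measure.isProbabilityMeasure_map h.aemeasurable_row_pair.snd
        have hs' : MeasurableSet {p : (ℝ × ℝ) × (ℝ × ℝ) | p.1.1 * p.2.1 - p.1.2 * p.2.2 = 0} :=
          measurableSet_eq_fun (by fun_prop) (by fun_prop)
        rw [ae_iff]
        simp only [ne_eq, not_not]
        have hτ : ∀ᵐ x ∂P.map (fun ω => (((M ω).submatrix Fin.succ Fin.succ).det.re,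
            (((M ω).submatrix Fin.succ Fin.succ).submatrix Fin.succ Fin.succ).det.re)),
            x.1 ≠ 0 := by
          rw [ae_map_iff h.submatrix_succ.aemeasurable_det_pair hs]
          exact ih h.submatrix_succ
        -- Once the smaller determinants `x`, with `x.1 ≠ 0`, and then `g` are fixed, the
        -- determinant vanishes for a single value of the diagonal entry, and the Gaussian law has
        -- no atoms.
        rw [Measure.prod_apply_symm hs', lintegral_eq_zero_iff (measurable_measure_prodMk_right hs')]
        filter_upwards [hτ] with x hx
        have hs'' := measurable_prodMk_right (y := x) hs'
        rw [Measure.prod_apply_symm hs'', Pi.zero_apply,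
          lintegral_eq_zero_iff (measurable_measure_prodMk_right hs'')]
        refine ae_of_all _ fun g => ?_
        refine measure_mono_null (t := {g * x.2 / x.1}) (fun a ha => ?_) (measure_singleton _)
        simp only [Set.mem_preimage, Set.mem_ofPred_eq] at ha
        rw [Set.mem_singleton_iff, eq_div_iff hx]
        linarith
      exact ae_of_ae_map h.aemeasurable_det_pair hpair

end IsGUE

-- Multiplicative characters of the plane and their expansion

/-- The character `z ↦ |z| ^ (i t) * (z / |z|) ^ (2 k)` of the multiplicative group `ℂˣ`, extended
by zero. -/
noncomputable def polarChar (t : ℝ) (k : ℤ) (z : ℂ) : ℂ :=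
  if z = 0 then 0 else Complex.exp ((t * Real.log ‖z‖ : ℝ) * Complex.I) * (z / ‖z‖) ^ (2 * k)

namespace polarChar

@[simp]
lemma apply_zero (t : ℝ) (k : ℤ) : polarChar t k 0 = 0 := by simp [polarChar]

/-- Multiplicativity is the reason for these test functions: a step multiplies the point by a
right-angle rotation and a factor close to one, and the two effects separate. -/
lemma mul_apply (t : ℝ) (k : ℤ) (z w : ℂ) :
    polarChar t k (z * w) = polarChar t k z * polarChar t k w := by
  rcases eq_or_ne z 0 with rfl | hz
  · simp
  rcases eq_or_ne w 0 with rfl | hw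
  · simp
  have h1 : ‖z‖ ≠ 0 := norm_ne_zero_iff.mpr hz
  have h2 : ‖w‖ ≠ 0 := norm_ne_zero_iff.mpr hw
  simp only [polarChar, norm_mul, Real.log_mul h1 h2, hz, hw, mul_eq_zero, or_self, if_false]
  rw [Complex.ofReal_mul ‖z‖, mul_div_mul_comm, mul_zpow, mul_add, Complex.ofReal_add, add_mul,
    Complex.exp_add]
  ring

lemma add_index (t : ℝ) (k l : ℤ) (z : ℂ) :
    polarChar t (k + l) z = polarChar t k z * polarChar 0 l z := by
  rcases eq_or_ne z 0 with rfl | hz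
  · simp
  have h1 : z / ‖z‖ ≠ 0 := div_ne_zero hz (by exact_mod_cast norm_ne_zero_iff.mpr hz)
  simp only [polarChar, mul_add, zpow_add₀ h1, hz, if_false]
  simp
  ring

lemma norm_eq_one (t : ℝ) (k : ℤ) {z : ℂ} (hz : z ≠ 0) : ‖polarChar t k z‖ = 1 := by
  rw [polarChar, if_neg hz, norm_mul, Complex.norm_exp_ofReal_mul_I, one_mul, norm_zpow, norm_div]
  simp [div_self (norm_ne_zero_iff.mpr hz)]

lemma norm_le_one (t : ℝ) (k : ℤ) (z : ℂ) : ‖polarChar t k z‖ ≤ 1 := by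
  rcases eq_or_ne z 0 with rfl | hz
  · simp
  · exact (norm_eq_one t k hz).le

lemma apply_I (t : ℝ) (k : ℤ) : polarChar t k Complex.I = (-1) ^ k := by
  simp [polarChar, zpow_mul]

lemma measurable (t : ℝ) (k : ℤ) : Measurable (polarChar t k) := by
  unfold polarChar
  have h : Measurable fun z : ℂ => z / ‖z‖ := by fun_prop
  have h2 : Measurable fun z : ℂ => (z / ‖z‖) ^ (2 * k) := by
    cases 2 * k with
    | ofNat n => simpa using h.pow_const n
    | negSucc n =>
      simp only [zpow_negSucc]
      exact (h.pow_const (n + 1)).inv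
  exact Measurable.ite (measurableSet_singleton 0) measurable_const (by fun_prop)

lemma eq_exp_log (t : ℝ) (k : ℤ) {z : ℂ} (hz : z ≠ 0) :
    polarChar t k z =
      Complex.exp ((t * (Complex.log z).re + 2 * k * (Complex.log z).im : ℝ) * Complex.I) := by
  have h1 : z / ‖z‖ = Complex.exp (z.arg * Complex.I) := by
    have : (‖z‖ : ℂ) ≠ 0 := by exact_mod_cast norm_ne_zero_iff.mpr hz
    rw [div_eq_iff this, mul_comm, Complex.norm_mul_exp_arg_mul_I]
  rw [polarChar, if_neg hz, h1, ← Complex.exp_int_mul, ← Complex.exp_add, Complex.log_re, Complex.log_im]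
  congr 1
  push_cast
  ring

/-- The second order Taylor polynomial of `polarChar t k` at `1`. -/
noncomputable def taylor (t : ℝ) (k : ℤ) (ε : ℂ) : ℂ :=
  1 + (t * (ε - ε ^ 2 / 2).re + 2 * k * (ε - ε ^ 2 / 2).im : ℝ) * Complex.I -
    ((t * ε.re + 2 * k * ε.im) ^ 2 / 2 : ℝ)

/-- Near `0` one expands the logarithm and then the exponential. For `‖ε‖ > 1 / 2` the character is
bounded and the polynomial is at most quadratic, so a cubic bound is free. The estimate is global
because the noise is unbounded. -/
lemma exists_norm_sub_taylor_le (k : ℤ) : ∃ C : ℝ, 0 ≤ C ∧ ∀ t : ℝ, |t| ≤ 1 → ∀ ε : ℂ,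
    ‖polarChar t k (1 + ε) - taylor t k ε‖ ≤ C * ‖ε‖ ^ 3 := by
  set K : ℝ := 1 + 2 * |(k : ℝ)| with hK
  have hK1 : 1 ≤ K := by simp [hK]
  -- The first three terms bound the exponential, linear and quadratic errors for small `ε`; `16 + 5
  -- * K` is added for large `ε`.
  refine ⟨8 * K ^ 3 * Real.exp K + K + 2 * K ^ 2 + 16 + 5 * K, by positivity, fun t ht ε => ?_⟩
  set l : ℂ → ℝ := fun w => t * w.re + 2 * k * w.im with hl
  have hlb : ∀ w, |l w| ≤ K * ‖w‖ := by
    intro w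
    calc |l w| ≤ |t * w.re| + |2 * k * w.im| := abs_add_le _ _
      _ = |t| * |w.re| + 2 * |(k : ℝ)| * |w.im| := by simp [abs_mul]
      _ ≤ 1 * ‖w‖ + 2 * |(k : ℝ)| * ‖w‖ := by
        gcongr
        exacts [Complex.abs_re_le_norm w, Complex.abs_im_le_norm w]
      _ = K * ‖w‖ := by rw [hK]; ring
  have hladd : ∀ v w, l (v + w) = l v + l w := by
    intro v w
    simp [hl]
    ring
  have hlsub : ∀ v w, l (v - w) = l v - l w := by
    intro v w
    simp [hl]
    ring
  have htay : taylor t k ε = 1 + (l (ε - ε ^ 2 / 2) : ℝ) * Complex.I - (l ε ^ 2 / 2 : ℝ) := rfl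
  have hε0 := norm_nonneg ε
  rcases le_or_gt ‖ε‖ (1 / 2) with hε | hε
  · have hne : 1 + ε ≠ 0 := by
      intro h0
      have : ε = -1 := by linear_combination h0
      rw [this] at hε
      norm_num at hε
    set ℓ := Complex.log (1 + ε) with hℓ
    have h1 : ‖ℓ - (ε - ε ^ 2 / 2)‖ ≤ ‖ε‖ ^ 3 := by
      have := Complex.norm_log_sub_logTaylor_le 2 (z := ε) (by linarith)
      have e : Complex.logTaylor (2 + 1) ε = ε - ε ^ 2 / 2 := by
        simp [Complex.logTaylor, Finset.sum_range_succ]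
        ring
      rw [e] at this
      refine this.trans ?_
      have h2 : (1 - ‖ε‖)⁻¹ ≤ 2 := by
        rw [inv_le_comm₀ (by linarith) (by norm_num)]
        linarith
      have h3 : 0 ≤ ‖ε‖ ^ 3 := by positivity
      have h4 := mul_le_mul_of_nonneg_left h2 h3
      norm_num at h4 ⊢
      linarith
    have h2 : ‖ℓ - ε‖ ≤ ‖ε‖ ^ 2 := by
      calc ‖ℓ - ε‖ = ‖(ℓ - (ε - ε ^ 2 / 2)) - ε ^ 2 / 2‖ := by ring_nf
        _ ≤ ‖ε‖ ^ 3 + ‖ε‖ ^ 2 / 2 := by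
          refine (norm_sub_le _ _).trans (add_le_add h1 ?_)
          simp
        _ ≤ ‖ε‖ ^ 2 := by nlinarith [sq_nonneg ‖ε‖]
    have h3 : ‖ℓ‖ ≤ 2 * ‖ε‖ := by
      calc ‖ℓ‖ = ‖(ℓ - ε) + ε‖ := by ring_nf
        _ ≤ ‖ε‖ ^ 2 + ‖ε‖ := (norm_add_le _ _).trans (by gcongr)
        _ ≤ _ := by nlinarith
    have hL : ‖((l ℓ : ℝ) : ℂ) * Complex.I‖ ≤ 2 * K * ‖ε‖ := by
      simp only [norm_mul, Complex.norm_real, Complex.norm_I, mul_one, Real.norm_eq_abs]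
      calc |l ℓ| ≤ K * ‖ℓ‖ := hlb _
        _ ≤ K * (2 * ‖ε‖) := by gcongr
        _ = _ := by ring
    have hexp := Complex.norm_exp_sub_sum_le_norm_mul_exp (((l ℓ : ℝ) : ℂ) * Complex.I) 3
    have e1 : ∑ m ∈ Finset.range 3, (((l ℓ : ℝ) : ℂ) * Complex.I) ^ m / (m.factorial : ℂ) =
        1 + (l ℓ : ℝ) * Complex.I - (l ℓ ^ 2 / 2 : ℝ) := by
      simp [Finset.sum_range_succ, mul_pow]
      ring
    rw [e1] at hexp
    have hexp' : ‖((l ℓ : ℝ) : ℂ) * Complex.I‖ ^ 3 * Real.exp ‖((l ℓ : ℝ) : ℂ) * Complex.I‖ ≤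
        8 * K ^ 3 * Real.exp K * ‖ε‖ ^ 3 := by
      calc _ ≤ (2 * K * ‖ε‖) ^ 3 * Real.exp K := by
            gcongr
            exact hL.trans (by nlinarith)
        _ = _ := by ring
    have hlin : ‖((l ℓ : ℝ) : ℂ) * Complex.I - (l (ε - ε ^ 2 / 2) : ℝ) * Complex.I‖ ≤
        K * ‖ε‖ ^ 3 := by
      rw [← sub_mul, ← Complex.ofReal_sub, ← hlsub]
      simp only [norm_mul, Complex.norm_real, Complex.norm_I, mul_one, Real.norm_eq_abs]
      exact (hlb _).trans (by gcongr)
    have hquad : ‖((l ℓ ^ 2 / 2 : ℝ) : ℂ) - (l ε ^ 2 / 2 : ℝ)‖ ≤ 2 * K ^ 2 * ‖ε‖ ^ 3 := by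
      rw [← Complex.ofReal_sub, Complex.norm_real, Real.norm_eq_abs]
      have e2 : l ℓ ^ 2 / 2 - l ε ^ 2 / 2 = l (ℓ - ε) * l (ℓ + ε) / 2 := by
        rw [hlsub, hladd]
        ring
      rw [e2, abs_div, abs_mul, abs_two]
      have h5 : ‖ℓ + ε‖ ≤ 3 * ‖ε‖ := (norm_add_le _ _).trans (by linarith)
      calc |l (ℓ - ε)| * |l (ℓ + ε)| / 2 ≤ (K * ‖ε‖ ^ 2) * (K * (3 * ‖ε‖)) / 2 := by
            gcongr
            · exact (hlb _).trans (by gcongr)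
            · exact (hlb _).trans (by gcongr)
        _ ≤ _ := by
          have : 0 ≤ K ^ 2 * ‖ε‖ ^ 3 := by positivity
          nlinarith
    rw [eq_exp_log t k hne, htay]
    have hfin : 0 ≤ (16 + 5 * K) * ‖ε‖ ^ 3 := by positivity
    calc ‖Complex.exp ((l ℓ : ℝ) * Complex.I) -
          (1 + (l (ε - ε ^ 2 / 2) : ℝ) * Complex.I - (l ε ^ 2 / 2 : ℝ))‖
        = ‖(Complex.exp ((l ℓ : ℝ) * Complex.I) -
            (1 + (l ℓ : ℝ) * Complex.I - (l ℓ ^ 2 / 2 : ℝ))) +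
          (((l ℓ : ℝ) : ℂ) * Complex.I - (l (ε - ε ^ 2 / 2) : ℝ) * Complex.I) -
          (((l ℓ ^ 2 / 2 : ℝ) : ℂ) - (l ε ^ 2 / 2 : ℝ))‖ := by ring_nf
      _ ≤ 8 * K ^ 3 * Real.exp K * ‖ε‖ ^ 3 + K * ‖ε‖ ^ 3 + 2 * K ^ 2 * ‖ε‖ ^ 3 :=
        (norm_sub_le _ _).trans (add_le_add ((norm_add_le _ _).trans
          (add_le_add (hexp.trans hexp') hlin)) hquad)
      _ ≤ _ := by linarith
  · have h1 : 1 ≤ 8 * ‖ε‖ ^ 3 := by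
      have : (1 / 2 : ℝ) ^ 3 ≤ ‖ε‖ ^ 3 := by gcongr
      linarith
    have h2 : ‖ε‖ ^ 2 ≤ 2 * ‖ε‖ ^ 3 := by nlinarith [sq_nonneg ‖ε‖]
    have h3 : ‖ε‖ ≤ 4 * ‖ε‖ ^ 3 := by nlinarith
    have h4 : ‖ε - ε ^ 2 / 2‖ ≤ 5 * ‖ε‖ ^ 3 := by
      refine (norm_sub_le _ _).trans ?_
      simp only [norm_div, norm_pow, RCLike.norm_ofNat]
      linarith
    have h5 : l ε ^ 2 / 2 ≤ K ^ 2 * ‖ε‖ ^ 3 := by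
      have : l ε ^ 2 ≤ (K * ‖ε‖) ^ 2 := sq_le_sq' (by linarith [neg_abs_le (l ε), hlb ε])
        ((le_abs_self _).trans (hlb ε))
      nlinarith [sq_nonneg K]
    rw [htay]
    have h6 : 0 ≤ 8 * K ^ 3 * Real.exp K * ‖ε‖ ^ 3 := by positivity
    have h7 : 0 ≤ K * ‖ε‖ ^ 3 := by positivity
    have h8 : 0 ≤ K ^ 2 * ‖ε‖ ^ 3 := by positivity
    calc _ ≤ ‖polarChar t k (1 + ε)‖ + (‖(1 : ℂ)‖ + ‖((l (ε - ε ^ 2 / 2) : ℝ) : ℂ) * Complex.I‖ +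
          ‖((l ε ^ 2 / 2 : ℝ) : ℂ)‖) :=
        (norm_sub_le _ _).trans (add_le_add le_rfl ((norm_sub_le _ _).trans
          (add_le_add (norm_add_le _ _) le_rfl)))
      _ ≤ 1 + (1 + K * (5 * ‖ε‖ ^ 3) + K ^ 2 * ‖ε‖ ^ 3) := by
        gcongr
        · exact norm_le_one _ _ _
        · simp
        · simp only [norm_mul, Complex.norm_real, Complex.norm_I, mul_one, Real.norm_eq_abs]
          exact (hlb _).trans (by gcongr)
        · rw [Complex.norm_real, Real.norm_eq_abs, abs_of_nonneg (by positivity)]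
          exact h5
      _ ≤ _ := by linarith

end polarChar

namespace polarChar

/-- The coefficient of `1 / n` in the mean multiplicative increment of `polarChar t k`. -/
noncomputable def drift (t : ℝ) (k : ℤ) : ℂ :=
  -(t ^ 2 / 4 + k ^ 2 : ℝ) - (t / 4 : ℝ) * Complex.I

/-- The coefficients of the oscillating part of the mean multiplicative increment. -/
noncomputable def oscPos (t : ℝ) (k : ℤ) : ℂ :=
  (t ^ 2 / 8 - k ^ 2 / 2 - 3 * k / 4 : ℝ) + (3 * t / 8 + k * t / 2 : ℝ) * Complex.I

noncomputable def oscNeg (t : ℝ) (k : ℤ) : ℂ :=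
  (t ^ 2 / 8 - k ^ 2 / 2 + 3 * k / 4 : ℝ) + (3 * t / 8 - k * t / 2 : ℝ) * Complex.I

/-- By `add_index`, multiplication by this function turns `polarChar t k` into a combination of the
characters of index `k ± 1`, so the recursion stays inside the family. -/
noncomputable def osc (t : ℝ) (k : ℤ) (z : ℂ) : ℂ :=
  oscPos t k * polarChar 0 1 z + oscNeg t k * polarChar 0 (-1) z

/-- The right-hand side is the coefficient of `1 / N` in the mean of the Taylor polynomial, for a
noise of mean `-Y / (2 N)` and second moment `1 / N`. Sorting it into a constant and the harmonics
`z ^ (±2)` explains the formulas for `drift` and `osc`. -/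
lemma osc_of_norm_eq_one (t : ℝ) (k : ℤ) {X Y : ℝ} (h : X ^ 2 + Y ^ 2 = 1) :
    drift t k + osc t k ⟨X, Y⟩ =
      -(1 / 2) * Complex.I * (Y * (t * Y + 2 * k * X) : ℝ) +
      (1 / 2) * (Complex.I * (t * (X ^ 2 - Y ^ 2) - 4 * k * X * Y : ℝ) -
        ((t * Y + 2 * k * X) ^ 2 : ℝ)) := by
  have hz : (⟨X, Y⟩ : ℂ) ≠ 0 := by
    intro h0
    have h1 := congrArg Complex.re h0
    have h2 := congrArg Complex.im h0
    simp only [Complex.zero_re, Complex.zero_im] at h1 h2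
    rw [h1, h2] at h
    norm_num at h
  have hn : ‖(⟨X, Y⟩ : ℂ)‖ = 1 := by
    rw [← sq_eq_sq₀ (norm_nonneg _) zero_le_one, Complex.sq_norm, Complex.normSq_mk]
    linarith
  have h1 : polarChar 0 1 ⟨X, Y⟩ = (⟨X ^ 2 - Y ^ 2, 2 * X * Y⟩ : ℂ) := by
    rw [polarChar, if_neg hz, hn]
    simp only [zero_mul, Complex.ofReal_zero, Complex.exp_zero, one_mul, Complex.ofReal_one,
      div_one, mul_one]
    rw [show ((2 : ℤ)) = ((2 : ℕ) : ℤ) by rfl, zpow_natCast]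
    apply Complex.ext <;> simp [pow_two] <;> ring
  have h2 : polarChar 0 (-1) ⟨X, Y⟩ = (⟨X ^ 2 - Y ^ 2, -(2 * X * Y)⟩ : ℂ) := by
    have h3 := mul_apply 0 1 (⟨X, Y⟩ : ℂ) (⟨X, Y⟩ : ℂ)
    have h4 : polarChar 0 (-1) ⟨X, Y⟩ * polarChar 0 1 ⟨X, Y⟩ = 1 := by
      rw [← add_index]
      simp [polarChar, hz]
    have h5 : (⟨X ^ 2 - Y ^ 2, -(2 * X * Y)⟩ : ℂ) * polarChar 0 1 ⟨X, Y⟩ = 1 := by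
      rw [h1]
      apply Complex.ext
      · simp only [Complex.mul_re, Complex.one_re]
        have : (X ^ 2 + Y ^ 2) ^ 2 = 1 := by rw [h]; norm_num
        nlinarith
      · simp only [Complex.mul_im, Complex.one_im]
        ring
    exact mul_right_cancel₀ (right_ne_zero_of_mul_eq_one h4) (h4.trans h5.symm)
  rw [osc, h1, h2, drift, oscPos, oscNeg]
  apply Complex.ext
  · simp [pow_two]
    linear_combination (t ^ 2 / 4 + k ^ 2) * h
  · simp [pow_two]
    linear_combination (t / 4) * h

end polarChar

-- One step of the normalized recursion

lemma HasMean.aemeasurable {Ω : Type*} [MeasurableSpace Ω] {P : Measure Ω} {f : Ω → ℝ} {I : ℝ}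
    (h : HasMean P f I) : AEMeasurable f P := h.1.aemeasurable

lemma sub_sub_pow_four_le (x y z : ℝ) :
    (x - y - z) ^ 4 ≤ 27 * x ^ 4 + 27 * y ^ 4 + 27 * z ^ 4 := by
  have h1 : (x - y - z) ^ 2 ≤ 3 * (x ^ 2 + y ^ 2 + z ^ 2) := by
    nlinarith [sq_nonneg (x + y), sq_nonneg (x + z), sq_nonneg (y - z)]
  have h2 : (x ^ 2 + y ^ 2 + z ^ 2) ^ 2 ≤ 3 * (x ^ 4 + y ^ 4 + z ^ 4) := by
    nlinarith [sq_nonneg (x ^ 2 - y ^ 2), sq_nonneg (x ^ 2 - z ^ 2), sq_nonneg (y ^ 2 - z ^ 2)]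
  calc (x - y - z) ^ 4 = ((x - y - z) ^ 2) ^ 2 := by ring
    _ ≤ (3 * (x ^ 2 + y ^ 2 + z ^ 2)) ^ 2 := by gcongr
    _ = 9 * (x ^ 2 + y ^ 2 + z ^ 2) ^ 2 := by ring
    _ ≤ _ := by linarith

/-- Interpolation of the third absolute moment between the second and the fourth moment. -/
lemma integral_abs_pow_three_le {Ω : Type*} [MeasurableSpace Ω] {P : Measure Ω} {δ : Ω → ℝ}
    {N v L : ℝ} (hN0 : 0 < N) (hδm : AEMeasurable δ P) (m2 : HasMean P (fun ω => δ ω ^ 2) v)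
    (hv : v ≤ 2 / N) (hδ4i : Integrable (fun ω => δ ω ^ 4) P)
    (hδ4v : ∫ ω, δ ω ^ 4 ∂P ≤ L / N ^ 2) :
    Integrable (fun ω => |δ ω| ^ 3) P ∧ ∫ ω, |δ ω| ^ 3 ∂P ≤ (L + 2) / (N * √N) := by
  have hsN := Real.sqrt_pos.mpr hN0
  have hsN2 := Real.sq_sqrt hN0.le
  -- The weights suit a `δ` of order `1 / √N`: both terms then have mean of order `1 / (N √N)`.
  have h3 : ∀ ω, |δ ω| ^ 3 ≤ (1 / √N) * δ ω ^ 2 + √N * δ ω ^ 4 := by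
    intro ω
    have e2 : δ ω ^ 2 = |δ ω| ^ 2 := (sq_abs _).symm
    have e4 : δ ω ^ 4 = |δ ω| ^ 4 := by
      rw [← abs_pow, abs_of_nonneg (by positivity : 0 ≤ δ ω ^ 4)]
    rw [e2, e4]
    have h0 : 0 ≤ |δ ω| := abs_nonneg _
    have e : (1 / √N) * |δ ω| ^ 2 + √N * |δ ω| ^ 4 - |δ ω| ^ 3 =
        |δ ω| ^ 2 / √N * ((√N * |δ ω| - 1 / 2) ^ 2 + 3 / 4) := by
      field_simp
      ring
    have : 0 ≤ |δ ω| ^ 2 / √N * ((√N * |δ ω| - 1 / 2) ^ 2 + 3 / 4) := by positivity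
    linarith
  have hdom3 := (m2.const_mul (1 / √N)).add (HasMean.const_mul ⟨hδ4i, rfl⟩ √N)
  have h3i : Integrable (fun ω => |δ ω| ^ 3) P := by
    refine hdom3.1.mono (hδm.norm.pow_const 3).aestronglyMeasurable (ae_of_all _ fun ω => ?_)
    have h0 : (0 : ℝ) ≤ |δ ω| ^ 3 := by positivity
    rw [Real.norm_eq_abs, Real.norm_eq_abs, abs_of_nonneg h0]
    exact (h3 ω).trans (le_abs_self _)
  refine ⟨h3i, (HasMean.le_of_le ⟨h3i, rfl⟩ hdom3 h3).trans ?_⟩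
  have e1 : 1 / √N * v ≤ 1 / √N * (2 / N) := by gcongr
  have e2 : √N * ∫ ω, δ ω ^ 4 ∂P ≤ √N * (L / N ^ 2) := by gcongr
  have e3 : 1 / √N * (2 / N) + √N * (L / N ^ 2) = (L + 2) / (N * √N) := by
    have : √N * (L / N ^ 2) = L / (N * √N) := by
      rw [mul_div_assoc', div_eq_div_iff (by positivity) (by positivity)]
      calc √N * L * (N * √N) = L * N * √N ^ 2 := by ring
        _ = _ := by rw [hsN2]; ring
    rw [this]
    field_simp
    ring
  exact (add_le_add e1 e2).trans e3.le

namespace HasRowMoments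

variable {Ω : Type*} [MeasurableSpace Ω] {P : Measure Ω} [IsProbabilityMeasure P] {a g : Ω → ℝ}
  {m : ℕ} {K : ℝ}

/-- Moments of the tangential noise in the recursion for the determinants. -/
lemma moments_noise (h : HasRowMoments P a g m K) (hm : 1 ≤ m) {X Y : ℝ} (hXY : X ^ 2 + Y ^ 2 = 1) :
    ∃ η : ℝ, 0 ≤ η ∧ η ≤ 1 / (m + 1 : ℝ) ∧ |η - 1 / (2 * (m + 1 : ℝ))| ≤ 1 / (m + 1 : ℝ) ^ 2 ∧
      HasMean P (fun ω => g ω * Y / √((m + 1) * m) - a ω * X / √(m + 1) - Y) (-η * Y) ∧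
      HasMean P (fun ω => (g ω * Y / √((m + 1) * m) - a ω * X / √(m + 1) - Y) ^ 2)
        (1 / (m + 1) + η ^ 2 * Y ^ 2) ∧
      Integrable (fun ω => (g ω * Y / √((m + 1) * m) - a ω * X / √(m + 1) - Y) ^ 4) P ∧
      ∫ ω, (g ω * Y / √((m + 1) * m) - a ω * X / √(m + 1) - Y) ^ 4 ∂P ≤
        (54 * K + 27) / (m + 1) ^ 2 := by
  set N : ℝ := m + 1 with hN
  have hm0 : (1 : ℝ) ≤ m := by exact_mod_cast hm
  have hN0 : 0 < N := by positivity
  have hN2 : 2 ≤ N := by linarith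
  have hsN := Real.sqrt_pos.mpr hN0
  have hsm := Real.sqrt_pos.mpr (by linarith : (0 : ℝ) < m)
  have hsN2 := Real.sq_sqrt hN0.le
  have hsm2 := Real.sq_sqrt (by linarith : (0 : ℝ) ≤ m)
  -- As `g` has mean `m`, the term `g Y / √(N m)` has mean `√(m / N) Y`. Thus `η` is the deficit of
  -- this factor, and `hηeq` shows that it is close to `1 / (2 N)`.
  set η : ℝ := 1 - √m / √N with hη
  have hη0 : 0 ≤ η := by
    rw [hη, sub_nonneg, div_le_one hsN]
    exact Real.sqrt_le_sqrt (by linarith)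
  have hη1 : η ≤ 1 := by
    rw [hη]
    have : 0 ≤ √m / √N := by positivity
    linarith
  have hηeq : 2 * η - η ^ 2 = 1 / N := by
    have : (√m / √N) ^ 2 = m / N := by rw [div_pow, hsN2, hsm2]
    have h2 : (m : ℝ) / N = 1 - 1 / N := by
      field_simp
      linarith
    have h3 : η ^ 2 = 1 - 2 * (√m / √N) + (√m / √N) ^ 2 := by rw [hη]; ring
    rw [h3, this, h2, hη]
    ring
  have hηN : η ≤ 1 / N := by nlinarith
  have hη2 : η ^ 2 ≤ 1 / N ^ 2 := by
    calc η ^ 2 ≤ (1 / N) ^ 2 := by gcongr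
      _ = _ := by rw [div_pow, one_pow]
  have hηabs : |η - 1 / (2 * N)| ≤ 1 / N ^ 2 := by
    have e : η - 1 / (2 * N) = η ^ 2 / 2 := by
      have : 1 / (2 * N) = (1 / N) / 2 := by field_simp
      rw [this, ← hηeq]
      ring
    rw [e, abs_of_nonneg (by positivity)]
    nlinarith [sq_nonneg η]
  set b : Ω → ℝ := fun ω => (g ω - m) / √(N * m) with hb
  have hsNm : √(N * m) = √N * √m := Real.sqrt_mul hN0.le _
  have hsNm2 : √(N * m) ^ 2 = N * m := Real.sq_sqrt (by positivity)
  have hsNm0 : 0 < √(N * m) := Real.sqrt_pos.mpr (by positivity)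
  have hδ : ∀ ω, g ω * Y / √(N * m) - a ω * X / √N - Y = Y * b ω - η * Y - (X / √N) * a ω := by
    intro ω
    have : (m : ℝ) / √(N * m) = √m / √N := by
      rw [hsNm]
      nth_rw 1 [← hsm2]
      field_simp
    have h1 : b ω = g ω / √(N * m) - √m / √N := by
      rw [← this]
      exact sub_div _ _ _
    rw [h1, hη]
    ring
  have hbm : AEMeasurable b P := (h.aemeasurable_snd.sub_const _).div_const _
  have hb4 : Integrable (fun ω => b ω ^ 4) P := by
    have := h.integrable_snd.div_const (√(N * m) ^ 4)
    simpa only [hb, div_pow] using this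
  have hb1 : HasMean P b 0 := by
    refine ⟨by simpa using integrable_pow_of_integrable_pow_four hbm hb4 (k := 1) (by norm_num), ?_⟩
    simp only [hb]
    rw [integral_div, h.integral_snd, zero_div]
  have hb2 : HasMean P (fun ω => b ω ^ 2) (1 / N) := by
    refine ⟨integrable_pow_of_integrable_pow_four hbm hb4 (by norm_num), ?_⟩
    simp only [hb, div_pow]
    rw [integral_div, h.integral_snd_sq, hsNm2]
    field_simp
  have hb4' : ∫ ω, b ω ^ 4 ∂P ≤ K / N ^ 2 := by
    simp only [hb, div_pow]
    rw [integral_div, div_le_div_iff₀ (by positivity) (by positivity)]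
    calc (∫ ω, (g ω - m) ^ 4 ∂P) * N ^ 2 ≤ (K * m ^ 2) * N ^ 2 := by
          gcongr
          exact h.integral_snd_pow_four
      _ = K * (√(N * m) ^ 2) ^ 2 := by rw [hsNm2]; ring
      _ = _ := by ring
  have ha1 : HasMean P a 0 := ⟨by
    simpa using integrable_pow_of_integrable_pow_four h.aemeasurable_fst h.integrable_fst (k := 1)
      (by norm_num), h.integral_fst⟩
  have ha2 : HasMean P (fun ω => a ω ^ 2) 1 := ⟨
    integrable_pow_of_integrable_pow_four h.aemeasurable_fst h.integrable_fst (by norm_num),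
      h.integral_fst_sq⟩
  have hab : HasMean P (fun ω => a ω * b ω) 0 := by
    constructor
    · refine (ha2.1.add hb2.1).mono (h.aemeasurable_fst.mul hbm).aestronglyMeasurable
        (ae_of_all _ fun ω => ?_)
      simp only [Pi.add_apply, Real.norm_eq_abs]
      rw [abs_of_nonneg (by positivity : 0 ≤ a ω ^ 2 + b ω ^ 2), abs_le]
      constructor <;> nlinarith [sq_nonneg (a ω - b ω), sq_nonneg (a ω + b ω)]
    · simp only [hb, ← mul_div_assoc]
      rw [integral_div, h.integral_mul, zero_div]
  have hK0 : 0 ≤ K := le_trans (integral_nonneg fun ω => by positivity) h.integral_fst_pow_four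
  have hX1 : X ^ 2 ≤ 1 := by nlinarith [sq_nonneg Y]
  have hY1 : Y ^ 2 ≤ 1 := by nlinarith [sq_nonneg X]
  have m1 : HasMean P (fun ω => g ω * Y / √(N * m) - a ω * X / √N - Y) (-η * Y) := by
    have := ((hb1.const_mul Y).sub (HasMean.const (η * Y))).sub (ha1.const_mul (X / √N))
    convert this.congr_fun hδ using 1
    ring
  -- The two sources of noise are uncorrelated, with variances `Y² / N` and `X² / N`; since `X² + Y²
  -- = 1`, the total does not depend on the angle.
  have m2 : HasMean P (fun ω => (g ω * Y / √(N * m) - a ω * X / √N - Y) ^ 2)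
      (1 / N + η ^ 2 * Y ^ 2) := by
    have := (((((hb2.const_mul (Y ^ 2)).add (HasMean.const (η ^ 2 * Y ^ 2))).add
      (ha2.const_mul (X ^ 2 / N))).sub (hb1.const_mul (2 * η * Y ^ 2))).sub
      (hab.const_mul (2 * Y * (X / √N)))).add (ha1.const_mul (2 * η * Y * (X / √N)))
    convert this.congr_fun (g := fun ω => (g ω * Y / √(N * m) - a ω * X / √N - Y) ^ 2) ?_ using 1
    · have : X ^ 2 = 1 - Y ^ 2 := by linarith
      rw [this]
      ring
    · intro ω
      rw [hδ]
      have : X ^ 2 / N = (X / √N) ^ 2 := by rw [div_pow, hsN2]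
      rw [this]
      ring
  refine ⟨η, hη0, hηN, hηabs, m1, m2, ?_⟩
  obtain ⟨δ, hδdef⟩ : ∃ δ : Ω → ℝ, δ = fun ω => g ω * Y / √(N * m) - a ω * X / √N - Y := ⟨_, rfl⟩
  have hδ' : ∀ ω, δ ω = Y * b ω - η * Y - (X / √N) * a ω := fun ω => by rw [hδdef]; exact hδ ω
  have hδm : AEMeasurable δ P := by rw [hδdef]; exact m1.aemeasurable
  have hδ4 : ∀ ω, δ ω ^ 4 ≤ 27 * b ω ^ 4 + 27 * η ^ 4 + 27 / N ^ 2 * a ω ^ 4 := by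
    intro ω
    have hX4 : X ^ 4 ≤ 1 := by nlinarith [sq_nonneg X]
    have hY4 : Y ^ 4 ≤ 1 := by nlinarith [sq_nonneg Y]
    rw [hδ']
    refine (sub_sub_pow_four_le _ _ _).trans ?_
    have e2 : (X / √N * a ω) ^ 4 = X ^ 4 * (a ω ^ 4 / N ^ 2) := by
      rw [mul_pow, div_pow, show √N ^ 4 = (√N ^ 2) ^ 2 by ring, hsN2]
      ring
    have e3 : X ^ 4 * (a ω ^ 4 / N ^ 2) ≤ 1 * (a ω ^ 4 / N ^ 2) := by gcongr
    have e4 : Y ^ 4 * b ω ^ 4 ≤ 1 * b ω ^ 4 := by gcongr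
    have e5 : Y ^ 4 * η ^ 4 ≤ 1 * η ^ 4 := by gcongr
    have e6 : 27 / N ^ 2 * a ω ^ 4 = 27 * (a ω ^ 4 / N ^ 2) := by ring
    rw [e2, e6, mul_pow, mul_pow]
    linarith
  have hb4m : HasMean P (fun ω => b ω ^ 4) _ := ⟨hb4, rfl⟩
  have ha4m : HasMean P (fun ω => a ω ^ 4) _ := ⟨h.integrable_fst, rfl⟩
  have hdom := ((hb4m.const_mul 27).add (HasMean.const (27 * η ^ 4))).add
    (ha4m.const_mul (27 / N ^ 2))
  have hδ4i : Integrable (fun ω => δ ω ^ 4) P := by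
    refine hdom.1.mono (hδm.pow_const 4).aestronglyMeasurable (ae_of_all _ fun ω => ?_)
    have h0 : (0 : ℝ) ≤ δ ω ^ 4 := by positivity
    rw [Real.norm_eq_abs, Real.norm_eq_abs, abs_of_nonneg h0]
    exact (hδ4 ω).trans (le_abs_self _)
  have hη4 : η ^ 4 ≤ 1 / N ^ 2 := by
    calc η ^ 4 = η ^ 2 * η ^ 2 := by ring
      _ ≤ 1 / N ^ 2 * 1 := by
        gcongr
        nlinarith
      _ = _ := mul_one _
  have hδ4v : ∫ ω, δ ω ^ 4 ∂P ≤ (54 * K + 27) / N ^ 2 := by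
    refine (HasMean.le_of_le ⟨hδ4i, rfl⟩ hdom hδ4).trans ?_
    have h1 : 27 / N ^ 2 * ∫ ω, a ω ^ 4 ∂P ≤ 27 / N ^ 2 * K := by
      gcongr
      exact h.integral_fst_pow_four
    have h2 : (54 * K + 27) / N ^ 2 = 27 * (K / N ^ 2) + 27 * (1 / N ^ 2) + 27 / N ^ 2 * K := by
      ring
    rw [h2]
    linarith
  rw [hδdef] at hδ4i hδ4v
  exact ⟨hδ4i, hδ4v⟩

end HasRowMoments

lemma HasMean.ofReal_mul {Ω : Type*} [MeasurableSpace Ω] {P : Measure Ω} {f : Ω → ℝ} {I : ℝ}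
    (h : HasMean P f I) (c : ℂ) : HasMean P (fun ω => (f ω : ℂ) * c) (I * c) :=
  ⟨h.1.ofReal.mul_const c, by
    rw [integral_mul_const, ← h.2]
    congr 1
    exact integral_ofReal⟩

namespace polarChar

/-- Along this direction the Taylor polynomial is quadratic in the real variable `δ`, so its mean
involves only the first two moments of the noise. -/
lemma taylor_eq (t : ℝ) (k : ℤ) (δ X Y : ℝ) :
    taylor t k (Complex.I * δ * ⟨X, -Y⟩) =
      1 + δ * (Complex.I * (t * Y + 2 * k * X : ℝ)) +
        (δ ^ 2 : ℝ) * ((1 / 2) * (Complex.I * (t * (X ^ 2 - Y ^ 2) - 4 * k * X * Y : ℝ) -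
        ((t * Y + 2 * k * X) ^ 2 : ℝ))) := by
  have e1 : (Complex.I * δ * ⟨X, -Y⟩ : ℂ) = ⟨δ * Y, δ * X⟩ := by
    apply Complex.ext <;> simp
  have e2 : ((⟨δ * Y, δ * X⟩ : ℂ) - ⟨δ * Y, δ * X⟩ ^ 2 / 2) =
      ⟨δ * Y - δ ^ 2 * (Y ^ 2 - X ^ 2) / 2, δ * X - δ ^ 2 * X * Y⟩ := by
    apply Complex.ext
    · simp [pow_two]
      ring
    · simp [pow_two]
      ring
  rw [taylor, e1, e2]
  apply Complex.ext
  · simp [pow_two]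
    ring
  · simp [pow_two]
    ring

/-- From a unit point `Z` a step leads to `I * Z * (1 + I * δ * W)`, with `W` the conjugate of `Z`.
The factor `I` gives the sign `(-1) ^ k`, the first two moments of `δ` give the drift and the
oscillation, and the third absolute moment bounds the remainder. -/
lemma exists_step_of_norm_eq_one (k : ℤ) (K : ℝ) : ∃ C : ℝ, 0 ≤ C ∧ ∀ t : ℝ, |t| ≤ 1 →
    ∀ {Ω : Type*} [MeasurableSpace Ω] (P : Measure Ω) [IsProbabilityMeasure P] (a g : Ω → ℝ) (m : ℕ),
    1 ≤ m → HasRowMoments P a g m K → ∀ X Y : ℝ, X ^ 2 + Y ^ 2 = 1 →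
    ‖(∫ ω, polarChar t k ⟨a ω * X / √(m + 1) - g ω * Y / √((m + 1) * m), X⟩ ∂P) -
      (-1) ^ k * (polarChar t k ⟨X, Y⟩ * (1 + (drift t k + osc t k ⟨X, Y⟩) / (m + 1)))‖ ≤
      C / ((m + 1) * √(m + 1)) := by
  obtain ⟨C₀, hC₀, hC⟩ := exists_norm_sub_taylor_le k
  set κ : ℝ := 1 + 2 * |(k : ℝ)| with hκ
  have hκ0 : 0 ≤ κ := by positivity
  refine ⟨C₀ * |54 * K + 27 + 2| + (κ + (1 / 2) * (2 * κ + κ ^ 2)), by positivity, ?_⟩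
  intro t ht Ω _ P _ a g m hm h X Y hXY
  obtain ⟨η, hη0, hηN, hηabs, m1, m2, i4, v4⟩ := h.moments_noise hm hXY
  have hN0 : (0 : ℝ) < m + 1 := by positivity
  obtain ⟨δ, hδ⟩ : ∃ δ : Ω → ℝ, δ = fun ω =>
    g ω * Y / √((m + 1) * m) - a ω * X / √(m + 1) - Y := ⟨_, rfl⟩
  have hm1 : HasMean P δ (-η * Y) := by rw [hδ]; exact m1
  have hm2 : HasMean P (fun ω => δ ω ^ 2) (1 / (m + 1) + η ^ 2 * Y ^ 2) := by rw [hδ]; exact m2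
  have hi4 : Integrable (fun ω => δ ω ^ 4) P := by rw [hδ]; exact i4
  have hv4 : ∫ ω, δ ω ^ 4 ∂P ≤ (54 * K + 27) / (m + 1) ^ 2 := by rw [hδ]; exact v4
  have hX1 : X ^ 2 ≤ 1 := by nlinarith [sq_nonneg Y]
  have hY1 : Y ^ 2 ≤ 1 := by nlinarith [sq_nonneg X]
  have hXa : |X| ≤ 1 := by rwa [← sq_le_one_iff_abs_le_one]
  have hYa : |Y| ≤ 1 := by rwa [← sq_le_one_iff_abs_le_one]
  have hN1 : 1 / (m + 1 : ℝ) ≤ 1 := by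
    rw [div_le_one hN0]
    linarith [(Nat.cast_nonneg m : (0 : ℝ) ≤ m)]
  have hη2 : η ^ 2 ≤ 1 / (m + 1 : ℝ) ^ 2 := by
    calc η ^ 2 ≤ (1 / (m + 1 : ℝ)) ^ 2 := by gcongr
      _ = _ := by rw [div_pow, one_pow]
  have hηY : η ^ 2 * Y ^ 2 ≤ 1 / (m + 1 : ℝ) ^ 2 := by
    calc η ^ 2 * Y ^ 2 ≤ 1 / (m + 1 : ℝ) ^ 2 * 1 := by gcongr
      _ = _ := mul_one _
  have hsq : 1 / (m + 1 : ℝ) ^ 2 ≤ 1 / ((m + 1) * √(m + 1)) := by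
    rw [pow_two]
    gcongr
    rw [Real.sqrt_le_left (by positivity)]
    nlinarith [(Nat.cast_nonneg m : (0 : ℝ) ≤ m)]
  have hv : 1 / (m + 1 : ℝ) + η ^ 2 * Y ^ 2 ≤ 2 / (m + 1) := by
    have : 1 / (m + 1 : ℝ) ^ 2 ≤ 1 / (m + 1 : ℝ) := by
      rw [← one_div_pow, pow_two]
      exact mul_le_of_le_one_left (by positivity) hN1
    have e : 2 / (m + 1 : ℝ) = 1 / (m + 1) + 1 / (m + 1) := by ring
    linarith
  obtain ⟨i3, v3⟩ := integral_abs_pow_three_le hN0 hm1.aemeasurable hm2 hv hi4 hv4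
  set Z : ℂ := ⟨X, Y⟩ with hZ
  set W : ℂ := ⟨X, -Y⟩ with hW
  have hZW : Z * W = 1 := by
    apply Complex.ext
    · simp [hZ, hW]
      linarith
    · simp [hZ, hW]
      ring
  have hnW : ‖W‖ = 1 := by
    rw [← sq_eq_sq₀ (norm_nonneg _) zero_le_one, Complex.sq_norm, hW, Complex.normSq_mk]
    linarith
  have hnZ : ‖polarChar t k Z‖ ≤ 1 := norm_le_one _ _ _
  set c₁ : ℂ := Complex.I * (t * Y + 2 * k * X : ℝ) with hc₁
  set c₂ : ℂ := (1 / 2) * (Complex.I * (t * (X ^ 2 - Y ^ 2) - 4 * k * X * Y : ℝ) -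
        ((t * Y + 2 * k * X) ^ 2 : ℝ)) with hc₂
  have hl : |t * Y + 2 * k * X| ≤ κ := by
    calc |t * Y + 2 * k * X| ≤ |t * Y| + |2 * k * X| := abs_add_le _ _
      _ = |t| * |Y| + 2 * |(k : ℝ)| * |X| := by simp [abs_mul]
      _ ≤ 1 * 1 + 2 * |(k : ℝ)| * 1 := by gcongr
      _ = κ := by rw [hκ]; ring
  have hl2 : |t * (X ^ 2 - Y ^ 2) - 4 * k * X * Y| ≤ 2 * κ := by
    have h1 : |X ^ 2 - Y ^ 2| ≤ 1 := by
      rw [abs_le]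
      constructor <;> nlinarith
    calc |t * (X ^ 2 - Y ^ 2) - 4 * k * X * Y| ≤ |t * (X ^ 2 - Y ^ 2)| + |4 * k * X * Y| :=
          abs_sub _ _
      _ = |t| * |X ^ 2 - Y ^ 2| + 4 * |(k : ℝ)| * |X| * |Y| := by simp [abs_mul]
      _ ≤ 1 * 1 + 4 * |(k : ℝ)| * 1 * 1 := by gcongr
      _ ≤ 2 * κ := by rw [hκ]; linarith
  have hc₁n : ‖c₁‖ ≤ κ := by
    rw [hc₁, norm_mul, Complex.norm_I, one_mul, Complex.norm_real]
    exact hl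
  have hc₂n : ‖c₂‖ ≤ (1 / 2) * (2 * κ + κ ^ 2) := by
    rw [hc₂, norm_mul]
    gcongr
    · simp
    · refine (norm_sub_le _ _).trans (add_le_add ?_ ?_)
      · rw [norm_mul, Complex.norm_I, one_mul, Complex.norm_real]
        exact hl2
      · rw [Complex.norm_real, norm_pow]
        gcongr
        exact hl
  -- The second coordinate is carried over exactly, so the noise is a real shift; `Z * W = 1` turns
  -- it into a relative factor.
  have hrep : ∀ ω, (⟨a ω * X / √(m + 1) - g ω * Y / √((m + 1) * m), X⟩ : ℂ) =
      Complex.I * Z * (1 + Complex.I * δ ω * W) := by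
    intro ω
    have e : Complex.I * Z * (1 + Complex.I * δ ω * W) = Complex.I * Z - δ ω * (Z * W) := by
      linear_combination (Z * δ ω * W) * Complex.I_sq
    have e5 : Complex.I * Z - δ ω * 1 = ⟨-Y - δ ω, X⟩ := by
      rw [hZ]
      apply Complex.ext <;> simp
    rw [e, hZW, e5, hδ]
    congr 1
    ring
  have hTm : HasMean P (fun ω => taylor t k (Complex.I * δ ω * W))
      (1 + (-η * Y : ℝ) * c₁ + (1 / (m + 1) + η ^ 2 * Y ^ 2 : ℝ) * c₂) :=
    (((HasMean.const (1 : ℂ)).add (hm1.ofReal_mul c₁)).add (hm2.ofReal_mul c₂)).congr_fun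
      fun ω => taylor_eq t k (δ ω) X Y
  have hGm : AEStronglyMeasurable (fun ω => polarChar t k (1 + Complex.I * δ ω * W)) P := by
    have h1 : AEMeasurable (fun ω => 1 + Complex.I * δ ω * W) P :=
      (((Complex.measurable_ofReal.comp_aemeasurable hm1.aemeasurable).const_mul _).mul_const
        _).const_add _
    exact ((measurable t k).comp_aemeasurable h1).aestronglyMeasurable
  have hGi : Integrable (fun ω => polarChar t k (1 + Complex.I * δ ω * W)) P :=
    (integrable_const (1 : ℝ)).mono' hGm (ae_of_all _ fun ω => norm_le_one _ _ _)
  have hmain : ‖(∫ ω, polarChar t k (1 + Complex.I * δ ω * W) ∂P) -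
      (1 + (-η * Y : ℝ) * c₁ + (1 / (m + 1) + η ^ 2 * Y ^ 2 : ℝ) * c₂)‖ ≤
      C₀ * (|54 * K + 27 + 2| / ((m + 1) * √(m + 1))) := by
    rw [← hTm.2, ← integral_sub hGi hTm.1]
    refine (norm_integral_le_of_norm_le (i3.const_mul C₀) (ae_of_all _ fun ω => ?_)).trans ?_
    · refine (hC t ht _).trans_eq ?_
      rw [norm_mul, norm_mul, hnW, Complex.norm_I, one_mul, mul_one, Complex.norm_real,
        Real.norm_eq_abs]
    · rw [integral_const_mul]
      gcongr
      refine v3.trans ?_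
      gcongr
      exact le_abs_self _
  -- Two replacements of order `1 / (m + 1) ^ 2` remain: `η` by `1 / (2 (m + 1))` in the mean, and
  -- `η² Y²` by zero in the second moment.
  have hdiff : ‖(1 + (-η * Y : ℝ) * c₁ + (1 / (m + 1) + η ^ 2 * Y ^ 2 : ℝ) * c₂) -
      (1 + (drift t k + osc t k Z) / (m + 1))‖ ≤
      (κ + (1 / 2) * (2 * κ + κ ^ 2)) * (1 / (m + 1) ^ 2) := by
    have e : (1 + (-η * Y : ℝ) * c₁ + (1 / (m + 1) + η ^ 2 * Y ^ 2 : ℝ) * c₂) -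
        (1 + (drift t k + osc t k Z) / (m + 1)) =
        (-(η - 1 / (2 * (m + 1))) * Y : ℝ) * c₁ + (η ^ 2 * Y ^ 2 : ℝ) * c₂ := by
      have hNc : (m + 1 : ℂ) ≠ 0 := by exact_mod_cast hN0.ne'
      rw [osc_of_norm_eq_one t k hXY, ← hc₂]
      have : -(1 / 2) * Complex.I * (Y * (t * Y + 2 * k * X) : ℝ) = -(1 / 2) * Y * c₁ := by
        rw [hc₁]
        push_cast
        ring
      rw [this]
      push_cast
      field_simp
      ring
    rw [e]
    calc _ ≤ (1 / (m + 1 : ℝ) ^ 2 * 1) * κ +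
          (1 / (m + 1 : ℝ) ^ 2) * ((1 / 2) * (2 * κ + κ ^ 2)) := by
          refine (norm_add_le _ _).trans (add_le_add ?_ ?_)
          · rw [norm_mul _ c₁, Complex.norm_real, Real.norm_eq_abs, abs_mul, abs_neg]
            gcongr
          · rw [norm_mul _ c₂, Complex.norm_real, Real.norm_eq_abs,
              abs_of_nonneg (by positivity : 0 ≤ η ^ 2 * Y ^ 2)]
            gcongr
      _ = _ := by ring
  have hcalc : (∫ ω, polarChar t k ⟨a ω * X / √(m + 1) - g ω * Y / √((m + 1) * m), X⟩ ∂P) -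
      (-1) ^ k * (polarChar t k Z * (1 + (drift t k + osc t k Z) / (m + 1))) =
      (-1) ^ k * polarChar t k Z * (((∫ ω, polarChar t k (1 + Complex.I * δ ω * W) ∂P) -
      (1 + (-η * Y : ℝ) * c₁ + (1 / (m + 1) + η ^ 2 * Y ^ 2 : ℝ) * c₂)) +
      ((1 + (-η * Y : ℝ) * c₁ + (1 / (m + 1) + η ^ 2 * Y ^ 2 : ℝ) * c₂) -
      (1 + (drift t k + osc t k Z) / (m + 1)))) := by
    simp_rw [hrep, mul_apply, apply_I]
    rw [integral_const_mul]
    ring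
  have hs : ‖(-1 : ℂ) ^ k * polarChar t k Z‖ ≤ 1 := by
    rw [norm_mul, norm_zpow, norm_neg, norm_one, one_zpow, one_mul]
    exact hnZ
  rw [hcalc, norm_mul]
  calc _ ≤ 1 * (C₀ * (|54 * K + 27 + 2| / ((m + 1) * √(m + 1))) +
        (κ + (1 / 2) * (2 * κ + κ ^ 2)) * (1 / (m + 1) ^ 2)) := by
        gcongr
        exact (norm_add_le _ _).trans (add_le_add hmain hdiff)
    _ ≤ 1 * (C₀ * (|54 * K + 27 + 2| / ((m + 1) * √(m + 1))) +
        (κ + (1 / 2) * (2 * κ + κ ^ 2)) * (1 / ((m + 1) * √(m + 1)))) := by gcongr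
    _ = _ := by ring

lemma apply_ofReal_zero (k : ℤ) {r : ℝ} (hr : 0 < r) : polarChar 0 k r = 1 := by
  have : (r : ℂ) ≠ 0 := by exact_mod_cast hr.ne'
  simp [polarChar, abs_of_pos hr, hr.ne']

/-- The mean of `polarChar t k` after one step of the normalized recursion for the determinants. -/
lemma exists_step (k : ℤ) (K : ℝ) : ∃ C : ℝ, 0 ≤ C ∧ ∀ t : ℝ, |t| ≤ 1 →
    ∀ {Ω : Type*} [MeasurableSpace Ω] (P : Measure Ω) [IsProbabilityMeasure P] (a g : Ω → ℝ) (m : ℕ),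
    1 ≤ m → HasRowMoments P a g m K → ∀ X Y : ℝ,
    ‖(∫ ω, polarChar t k ⟨a ω * X / √(m + 1) - g ω * Y / √((m + 1) * m), X⟩ ∂P) -
      (-1) ^ k * (polarChar t k ⟨X, Y⟩ * (1 + (drift t k + osc t k ⟨X, Y⟩) / (m + 1)))‖ ≤
      C / ((m + 1) * √(m + 1)) := by
  obtain ⟨C, hC0, hC⟩ := exists_step_of_norm_eq_one k K
  refine ⟨C, hC0, fun t ht Ω _ P _ a g m hm h X Y => ?_⟩
  rcases eq_or_ne (⟨X, Y⟩ : ℂ) 0 with h0 | h0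
  · have hX : X = 0 := congrArg Complex.re h0
    have hY : Y = 0 := congrArg Complex.im h0
    subst hX hY
    have : (⟨0, 0⟩ : ℂ) = 0 := rfl
    simp [this]
    positivity
  -- The recursion is homogeneous and `osc` is invariant under positive scaling, so the modulus
  -- factors out and the unit case applies.
  · set r := ‖(⟨X, Y⟩ : ℂ)‖ with hr
    have hr0 : 0 < r := norm_pos_iff.mpr h0
    have hr2 : r ^ 2 = X ^ 2 + Y ^ 2 := by
      rw [hr, Complex.sq_norm, Complex.normSq_mk]
      ring
    have hu : (X / r) ^ 2 + (Y / r) ^ 2 = 1 := by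
      rw [div_pow, div_pow, ← add_div, ← hr2, div_self (by positivity)]
    have key := hC t ht P a g m hm h (X / r) (Y / r) hu
    have e1 : (⟨X, Y⟩ : ℂ) = r * ⟨X / r, Y / r⟩ := by
      apply Complex.ext <;> simp <;> field_simp
    have e2 : ∀ ω, (⟨a ω * X / √(m + 1) - g ω * Y / √((m + 1) * m), X⟩ : ℂ) =
        r * ⟨a ω * (X / r) / √(m + 1) - g ω * (Y / r) / √((m + 1) * m), X / r⟩ := by
      intro ω
      apply Complex.ext
      · simp
        field_simp
      · simp
        field_simp
    have e3 : osc t k ⟨X, Y⟩ = osc t k ⟨X / r, Y / r⟩ := by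
      rw [osc, osc, e1, mul_apply, mul_apply, apply_ofReal_zero _ hr0, apply_ofReal_zero _ hr0,
        one_mul, one_mul]
    simp_rw [e2, e3, e1, mul_apply]
    rw [integral_const_mul]
    have e4 : ∀ A G D s : ℂ, G * A - s * (G * D * (1 + (drift t k +
        osc t k ⟨X / r, Y / r⟩) / (m + 1))) = G * (A - s * (D * (1 + (drift t k +
        osc t k ⟨X / r, Y / r⟩) / (m + 1)))) := by
      intro A G D s
      ring
    rw [e4, norm_mul]
    exact (mul_le_of_le_one_left (norm_nonneg _) (norm_le_one _ _ _)).trans key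

end polarChar

-- The recursion for the means of the characters

/-- The normalized determinants of a matrix and of its first principal minor, as a point of the
plane. -/
noncomputable def detPoint {n : ℕ} (A : Matrix (Fin (n + 1)) (Fin (n + 1)) ℂ) : ℂ :=
  ⟨A.det.re / √((n + 1).factorial : ℝ),
    (A.submatrix Fin.succ Fin.succ).det.re / √(n.factorial : ℝ)⟩

namespace IsGUE

variable {Ω : Type*} [MeasurableSpace Ω] {P : Measure Ω}

lemma aemeasurable_detPoint {n : ℕ} {M : Ω → Matrix (Fin (n + 1)) (Fin (n + 1)) ℂ}
    (h : IsGUE M P) : AEMeasurable (fun ω => detPoint (M ω)) P := by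
  have h1 : Measurable fun x : ℝ × ℝ =>
      (⟨x.1 / √((n + 1).factorial : ℝ), x.2 / √(n.factorial : ℝ)⟩ : ℂ) := by
    have : (fun x : ℝ × ℝ => (⟨x.1 / √((n + 1).factorial : ℝ), x.2 / √(n.factorial : ℝ)⟩ : ℂ)) =
        fun x => ((x.1 / √((n + 1).factorial : ℝ) : ℝ) : ℂ) +
          ((x.2 / √(n.factorial : ℝ) : ℝ) : ℂ) * Complex.I := by
      ext x
      rw [Complex.mk_eq_add_mul_I]
    rw [this]
    fun_prop
  exact h1.comp_aemeasurable h.aemeasurable_det_pair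

lemma integrable_polarChar [IsProbabilityMeasure P] {n : ℕ}
    {M : Ω → Matrix (Fin (n + 1)) (Fin (n + 1)) ℂ} (h : IsGUE M P) (t : ℝ) (k : ℤ) :
    Integrable (fun ω => polarChar t k (detPoint (M ω))) P :=
  (integrable_const (1 : ℝ)).mono'
    ((polarChar.measurable t k).comp_aemeasurable h.aemeasurable_detPoint).aestronglyMeasurable
    (ae_of_all _ fun _ => polarChar.norm_le_one _ _ _)

/-- The recursion for the mean of `polarChar t k` of the normalized determinants. -/
lemma exists_recursion (k : ℤ) : ∃ C : ℝ, 0 ≤ C ∧ ∀ t : ℝ, |t| ≤ 1 →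
    ∀ {Ω : Type*} [MeasurableSpace Ω] (P : Measure Ω) [IsProbabilityMeasure P] (n : ℕ)
    (M : Ω → Matrix (Fin (n + 2)) (Fin (n + 2)) ℂ), IsGUE M P →
    ‖(∫ ω, polarChar t k (detPoint (M ω)) ∂P) - (-1) ^ k *
      ((1 + polarChar.drift t k / (n + 2)) *
          (∫ ω, polarChar t k (detPoint ((M ω).submatrix Fin.succ Fin.succ)) ∂P) +
        (polarChar.oscPos t k *
          (∫ ω, polarChar t (k + 1) (detPoint ((M ω).submatrix Fin.succ Fin.succ)) ∂P) +
        polarChar.oscNeg t k *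
          (∫ ω, polarChar t (k - 1) (detPoint ((M ω).submatrix Fin.succ Fin.succ)) ∂P)) /
        (n + 2))‖ ≤ C / ((n + 2) * √(n + 2)) := by
  obtain ⟨K, hK⟩ := exists_hasRowMoments
  obtain ⟨C, hC0, hC⟩ := polarChar.exists_step k K
  refine ⟨C, hC0, fun t ht Ω _ P _ n M h => ?_⟩
  set a : Ω → ℝ := fun ω => (M ω 0 0).re with ha
  set g : Ω → ℝ := fun ω => ∑ j : Fin (n + 1), ‖M ω 0 j.succ‖ ^ 2 with hg
  have hag : AEMeasurable (fun ω => (a ω, g ω)) P := h.aemeasurable_row_pair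
  set D : Ω → ℝ × ℝ := fun ω => (((M ω).submatrix Fin.succ Fin.succ).det.re,
          (((M ω).submatrix Fin.succ Fin.succ).submatrix Fin.succ Fin.succ).det.re) with hD
  have hDm : AEMeasurable D P := h.submatrix_succ.aemeasurable_det_pair
  have hmom : HasRowMoments P a g (n + 1) K := hK P M h
  let f : ℝ × ℝ → ℂ := fun x => polarChar t k
    ((x.1 / √((n + 2).factorial : ℝ) : ℝ) + (x.2 / √((n + 1).factorial : ℝ) : ℝ) * Complex.I)
  have hfm : Measurable f := (polarChar.measurable t k).comp (by fun_prop)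
  have hfb : ∀ x, ‖f x‖ ≤ 1 := fun x => polarChar.norm_le_one _ _ _
  let F : (ℝ × ℝ) × (ℝ × ℝ) → ℝ × ℝ := fun p => (p.1.1 * p.2.1 - p.1.2 * p.2.2, p.2.1)
  have hFm : Measurable F := by fun_prop
  have := Measure.isProbabilityMeasure_map hag
  have := Measure.isProbabilityMeasure_map hDm
  have hfF : Integrable (fun p => f (F p)) ((P.map fun ω => (a ω, g ω)).prod (P.map D)) :=
    (integrable_const (1 : ℝ)).mono' (hfm.comp hFm).aestronglyMeasurable
      (ae_of_all _ fun p => hfb _)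
  -- The row is integrated inside, with the smaller determinants fixed, so that the one-step
  -- estimate can be used for each `ω'`.
  have hL : ∫ ω, polarChar t k (detPoint (M ω)) ∂P =
      ∫ ω', ∫ ω, f (F ((a ω, g ω), D ω')) ∂P ∂P := by
    have e1 : ∫ ω, polarChar t k (detPoint (M ω)) ∂P =
        ∫ x, f x ∂P.map (fun ω => ((M ω).det.re, ((M ω).submatrix Fin.succ Fin.succ).det.re)) := by
      rw [integral_map h.aemeasurable_det_pair hfm.aestronglyMeasurable]
      refine integral_congr_ae (ae_of_all _ fun ω => ?_)
      simp only [f, detPoint, Complex.mk_eq_add_mul_I]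
    have hsm : StronglyMeasurable fun y => ∫ x, f (F (x, y)) ∂P.map (fun ω => (a ω, g ω)) :=
      (hfm.comp hFm).stronglyMeasurable.integral_prod_left'
    rw [e1, h.map_det_pair_eq_map_prod, integral_map hFm.aemeasurable hfm.aestronglyMeasurable,
      integral_prod_symm _ hfF, integral_map hDm hsm.aestronglyMeasurable]
    refine integral_congr_ae (ae_of_all _ fun ω' => ?_)
    exact integral_map hag ((hfm.comp hFm).comp measurable_prodMk_right).aestronglyMeasurable
  have hJm : AEStronglyMeasurable (fun ω' => ∫ ω, f (F ((a ω, g ω), D ω')) ∂P) P := by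
    have h1 := ((hfm.comp hFm).stronglyMeasurable.integral_prod_left'
      (μ := P.map fun ω => (a ω, g ω))).measurable.comp_aemeasurable hDm
    refine (h1.congr (ae_of_all _ fun ω' => ?_)).aestronglyMeasurable
    exact integral_map hag ((hfm.comp hFm).comp measurable_prodMk_right).aestronglyMeasurable
  have hJi : Integrable (fun ω' => ∫ ω, f (F ((a ω, g ω), D ω')) ∂P) P := by
    refine (integrable_const (1 : ℝ)).mono' hJm (ae_of_all _ fun ω' => ?_)
    refine (norm_integral_le_of_norm_le_const (C := 1) (ae_of_all _ fun ω => hfb _)).trans ?_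
    simp
  set N : Ω → Matrix (Fin (n + 1)) (Fin (n + 1)) ℂ := fun ω =>
    (M ω).submatrix Fin.succ Fin.succ with hN
  have hNG : IsGUE N P := h.submatrix_succ
  let S : Ω → ℂ := fun ω' => (-1) ^ k * ((1 + polarChar.drift t k / (n + 2)) *
    polarChar t k (detPoint (N ω')) + (polarChar.oscPos t k * polarChar t (k + 1) (detPoint (N ω')) +
      polarChar.oscNeg t k * polarChar t (k - 1) (detPoint (N ω'))) / (n + 2))
  have i0 := hNG.integrable_polarChar t k
  have i1 := hNG.integrable_polarChar t (k + 1)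
  have i2 := hNG.integrable_polarChar t (k - 1)
  have i3 := (i1.const_mul (polarChar.oscPos t k)).add (i2.const_mul (polarChar.oscNeg t k))
  have i4 := (i0.const_mul (1 + polarChar.drift t k / (n + 2))).add (i3.div_const (n + 2 : ℂ))
  have hSi : Integrable S P := i4.const_mul _
  have hS : ∫ ω, S ω ∂P = (-1) ^ k * ((1 + polarChar.drift t k / (n + 2)) *
          (∫ ω, polarChar t k (detPoint (N ω)) ∂P) +
        (polarChar.oscPos t k * (∫ ω, polarChar t (k + 1) (detPoint (N ω)) ∂P) +
        polarChar.oscNeg t k * (∫ ω, polarChar t (k - 1) (detPoint (N ω)) ∂P)) / (n + 2)) := by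
    have h3 : HasMean P (fun ω => polarChar.oscPos t k * polarChar t (k + 1) (detPoint (N ω)) +
        polarChar.oscNeg t k * polarChar t (k - 1) (detPoint (N ω))) _ :=
      HasMean.add ⟨i1.const_mul _, integral_const_mul _ _⟩ ⟨i2.const_mul _, integral_const_mul _ _⟩
    have h4 := HasMean.add (P := P) (f := fun ω => (1 + polarChar.drift t k / (n + 2)) *
      polarChar t k (detPoint (N ω))) ⟨i0.const_mul _, integral_const_mul _ _⟩
      ⟨h3.1.div_const (n + 2 : ℂ), integral_div _ _⟩
    simp only [S]
    rw [integral_const_mul, h4.2, h3.2]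
  rw [hL, ← hS, ← integral_sub hJi hSi]
  refine (norm_integral_le_of_norm_le_const (C := C / ((n + 2) * √(n + 2)))
    (ae_of_all _ fun ω' => ?_)).trans (by simp)
  have hf0 : (0 : ℝ) < √(n.factorial : ℝ) := Real.sqrt_pos.mpr (by positivity)
  have e1 : √((n + 1).factorial : ℝ) = √(n + 1) * √(n.factorial : ℝ) := by
    rw [Nat.factorial_succ]
    push_cast
    exact Real.sqrt_mul (by positivity) _
  have e2 : √((n + 2).factorial : ℝ) = √(n + 2) * (√(n + 1) * √(n.factorial : ℝ)) := by
    rw [Nat.factorial_succ, ← e1]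
    push_cast
    rw [← Real.sqrt_mul (by positivity)]
    ring_nf
  -- The row has `n + 1` off-diagonal entries, hence `m = n + 1`.
  have key := hC t ht P a g (n + 1) (by omega) hmom ((D ω').1 / √((n + 1).factorial : ℝ))
    ((D ω').2 / √(n.factorial : ℝ))
  have hm : ((n + 1 : ℕ) : ℝ) + 1 = n + 2 := by push_cast; ring
  have hmc : ((n + 1 : ℕ) : ℂ) + 1 = n + 2 := by push_cast; ring
  rw [hm, hmc] at key
  have hpt : detPoint (N ω') = ⟨(D ω').1 / √((n + 1).factorial : ℝ),
    (D ω').2 / √(n.factorial : ℝ)⟩ := rfl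
  rw [← hpt] at key
  have hfe : ∀ ω, f (F ((a ω, g ω), D ω')) = polarChar t k
      ⟨a ω * ((D ω').1 / √((n + 1).factorial : ℝ)) / √(n + 2) -
        g ω * ((D ω').2 / √(n.factorial : ℝ)) / √((n + 2) * (n + 1 : ℕ)),
        (D ω').1 / √((n + 1).factorial : ℝ)⟩ := by
    intro ω
    simp only [f, F]
    rw [← Complex.mk_eq_add_mul_I]
    congr 2
    rw [e1, e2, Real.sqrt_mul (by positivity) ((n + 1 : ℕ) : ℝ)]
    push_cast
    field_simp
  have hSe : S ω' = (-1) ^ k * (polarChar t k (detPoint (N ω')) *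
      (1 + (polarChar.drift t k + polarChar.osc t k (detPoint (N ω'))) / (n + 2))) := by
    simp only [S, polarChar.osc, sub_eq_add_neg k 1, polarChar.add_index t k 1,
      polarChar.add_index t k (-1)]
    ring
  rw [integral_congr_ae (ae_of_all P hfe), hSe]
  exact key

end IsGUE

-- Asymptotics of a perturbed linear recursion

/-- `(n + 2) ^ c / (n + 1) ^ c` is `1 + c / (n + 2)` up to a quadratic error. -/
lemma norm_one_add_div_sub_exp_le {c : ℂ} {B : ℝ} (hc : ‖c‖ ≤ B) (n : ℕ) :
    ‖1 + c / (n + 2) - Complex.exp (c * (Real.log (n + 2) - Real.log (n + 1) : ℝ))‖ ≤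
        (4 * B ^ 2 * Real.exp B + 2 * B) / (n + 2) ^ 2 ∧
      ‖1 - Complex.exp (c * (Real.log (n + 2) - Real.log (n + 1) : ℝ))‖ ≤
        2 * B * Real.exp B / (n + 2) := by
  have hB : 0 ≤ B := (norm_nonneg c).trans hc
  have hn : (0 : ℝ) ≤ n := Nat.cast_nonneg n
  obtain ⟨L, hLdef⟩ : ∃ L, L = Real.log (n + 2) - Real.log (n + 1) := ⟨_, rfl⟩
  rw [← hLdef]
  have hL : L = Real.log ((n + 2) / (n + 1)) := by
    rw [hLdef, Real.log_div (by positivity) (by positivity)]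
  have h1 : 1 / (n + 2 : ℝ) ≤ L := by
    have := Real.one_sub_inv_le_log_of_pos (x := (n + 2) / (n + 1 : ℝ)) (by positivity)
    rw [hL]
    refine le_trans (le_of_eq ?_) this
    field_simp
    ring
  have h2 : L ≤ 1 / (n + 1 : ℝ) := by
    have := Real.log_le_sub_one_of_pos (x := (n + 2) / (n + 1 : ℝ)) (by positivity)
    rw [hL]
    refine this.trans (le_of_eq ?_)
    field_simp
    ring
  have h12 : 1 / (n + 1 : ℝ) ≤ 2 / (n + 2) := by
    rw [div_le_div_iff₀ (by positivity) (by positivity)]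
    linarith
  have h3 : L - 1 / (n + 2) ≤ 2 / (n + 2) ^ 2 := by
    have : 1 / (n + 1 : ℝ) - 1 / (n + 2) = 1 / (n + 1) * (1 / (n + 2)) := by
      field_simp
      ring
    have h4 : 1 / (n + 1 : ℝ) * (1 / (n + 2)) ≤ 2 / (n + 2) * (1 / (n + 2)) := by gcongr
    have h5 : 2 / (n + 2 : ℝ) * (1 / (n + 2)) = 2 / (n + 2) ^ 2 := by
      field_simp
    linarith
  have hL0 : 0 ≤ L := le_trans (by positivity) h1
  have hL1 : L ≤ 1 := h2.trans (by rw [div_le_one (by positivity)]; linarith)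
  have hL2 : L ≤ 2 / (n + 2) := h2.trans h12
  have hx : ‖c * (L : ℂ)‖ ≤ B * L := by
    rw [norm_mul, Complex.norm_real, Real.norm_eq_abs, abs_of_nonneg hL0]
    gcongr
  have hx1 : ‖c * (L : ℂ)‖ ≤ B := hx.trans (mul_le_of_le_one_right hB hL1)
  have hexp2 := Complex.norm_exp_sub_sum_le_norm_mul_exp (c * (L : ℂ)) 2
  have hexp1 := Complex.norm_exp_sub_sum_le_norm_mul_exp (c * (L : ℂ)) 1
  simp only [Finset.sum_range_succ, Finset.sum_range_zero, zero_add, pow_zero, pow_one,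
    Nat.factorial, Nat.cast_one, div_one, mul_one] at hexp1 hexp2
  constructor
  · have e : 1 + c / (n + 2) - Complex.exp (c * (L : ℂ)) =
        -(Complex.exp (c * (L : ℂ)) - (1 + c * L)) - c * ((L - 1 / (n + 2) : ℝ) : ℂ) := by
      push_cast
      ring
    rw [e]
    calc _ ≤ ‖c * (L : ℂ)‖ ^ 2 * Real.exp ‖c * (L : ℂ)‖ + ‖c‖ * |L - 1 / (n + 2)| := by
          refine (norm_sub_le _ _).trans (add_le_add ?_ ?_)
          · rw [norm_neg]
            simpa using hexp2
          · rw [norm_mul, Complex.norm_real, Real.norm_eq_abs]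
      _ ≤ (B * (2 / (n + 2))) ^ 2 * Real.exp B + B * (2 / (n + 2) ^ 2) := by
          gcongr
          · exact hx.trans (by gcongr)
          · rw [abs_of_nonneg (by linarith)]
            exact h3
      _ = _ := by
          field_simp
          ring
  · rw [norm_sub_rev]
    calc _ ≤ ‖c * (L : ℂ)‖ * Real.exp ‖c * (L : ℂ)‖ := hexp1
      _ ≤ (B * (2 / (n + 2))) * Real.exp B := by
          gcongr
          exact hx.trans (by gcongr)
      _ = _ := by ring

/-- This makes the step errors of order `n ^ (-3/2)` telescope to a total of order `1 / √(n₀ + 1)`.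
-/
lemma one_div_mul_sqrt_le (j : ℕ) :
    1 / ((j + 2) * √(j + 2)) ≤ 2 * (1 / √(j + 1 : ℝ) - 1 / √(j + 2)) := by
  have hp : 0 < √(j + 1 : ℝ) := Real.sqrt_pos.mpr (by positivity)
  have hq : 0 < √(j + 2 : ℝ) := Real.sqrt_pos.mpr (by positivity)
  have hp2 : √(j + 1 : ℝ) ^ 2 = j + 1 := Real.sq_sqrt (by positivity)
  have hq2 : √(j + 2 : ℝ) ^ 2 = j + 2 := Real.sq_sqrt (by positivity)
  have hpq : √(j + 1 : ℝ) ≤ √(j + 2) := Real.sqrt_le_sqrt (by linarith)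
  set p := √(j + 1 : ℝ)
  set q := √(j + 2 : ℝ)
  have e : 2 * (1 / p - 1 / q) = 2 / (p * q * (p + q)) := by
    have : (q - p) * (q + p) = 1 := by nlinarith
    field_simp
    nlinarith
  rw [e, ← hq2, div_le_div_iff₀ (by positivity) (by positivity)]
  nlinarith [mul_pos hp hq, mul_pos hq hq, mul_nonneg (mul_pos hq hq).le (sub_nonneg.mpr hpq),
    mul_nonneg (mul_pos hp hq).le (sub_nonneg.mpr hpq)]

/-- A sequence which satisfies `u (n + 1) ≈ ± (1 + c / (n + 2)) u n`, up to a summable error and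
an oscillating perturbation, behaves like `n ^ c`. -/
lemma exists_norm_sub_exp_mul_le (B C : ℝ) : ∃ C' : ℝ, 0 ≤ C' ∧ ∀ (u v : ℕ → ℂ) (c s : ℂ),
    ‖c‖ ≤ B → c.re ≤ 0 → s ^ 2 = 1 → ‖s‖ = 1 → (∀ n, ‖u n‖ ≤ 1) → (∀ n, ‖v n‖ ≤ B) →
    (∀ n : ℕ, ‖u (n + 1) - s * ((1 + c / (n + 2)) * u n + v n / (n + 2))‖ ≤
      C / ((n + 2) * √(n + 2))) →
    (∀ n : ℕ, ‖v (n + 1) + s * v n‖ ≤ C / (n + 2)) →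
    ∀ n₀ n : ℕ, n₀ ≤ n →
      ‖s ^ n * u n - Complex.exp (c * (Real.log (n + 1) - Real.log (n₀ + 1) : ℝ)) *
        (s ^ n₀ * u n₀)‖ ≤ C' / √(n₀ + 1) := by
  -- A negative `B` or `C` makes the hypotheses contradictory, so any constant serves.
  by_cases hBC : 0 ≤ B ∧ 0 ≤ C
  swap
  · refine ⟨0, le_rfl, fun u v c s hc _ _ _ _ _ hu _ => ?_⟩
    refine absurd ⟨(norm_nonneg c).trans hc, ?_⟩ hBC
    have := (norm_nonneg _).trans (hu 0)
    by_contra h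
    push Not at h
    have h2 : C / (((0 : ℕ) + 2 : ℝ) * √((0 : ℕ) + 2 : ℝ)) < 0 := div_neg_of_neg_of_pos h (by positivity)
    linarith
  obtain ⟨hB, hC⟩ := hBC
  -- In order: the error of the recursion, `1 + c / (n + 2)` against the exponential, the sign
  -- change of `v`, and the variation of the corrector.
  set C₁ : ℝ := C + (4 * B ^ 2 * Real.exp B + 2 * B) + C + (B + 2 * B ^ 2 * Real.exp B) with hC₁
  refine ⟨2 * C₁ + B, by positivity, ?_⟩
  intro u v c s hc hcre hs2 hs hu hv hrec hosc n₀ n hn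
  -- A step multiplies `u` by about `s` but `v` by about `-s`. Hence the forcing `s * v n / (n + 2)`
  -- plus the new corrector `-s * v n / (2 (n + 2))` is `s` times the old corrector up to `O(1 /
  -- n²)`, and `W` obeys the unforced recursion.
  set W : ℕ → ℂ := fun n => s ^ n * (u n + v n / (2 * (n + 1))) with hW
  have hstep : ∀ n : ℕ, ‖W (n + 1) - Complex.exp (c * (Real.log (n + 2) - Real.log (n + 1) : ℝ)) *
      W n‖ ≤ C₁ * (1 / ((n + 2) * √(n + 2))) := by
    intro n
    obtain ⟨hρ1, hρ2⟩ := norm_one_add_div_sub_exp_le hc n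
    have hn0 : (0 : ℝ) ≤ n := Nat.cast_nonneg n
    have hρn : ‖Complex.exp (c * (Real.log (n + 2) - Real.log (n + 1) : ℝ))‖ ≤ 1 := by
      rw [Complex.norm_exp, Real.exp_le_one_iff, Complex.re_mul_ofReal]
      refine mul_nonpos_of_nonpos_of_nonneg hcre (sub_nonneg.mpr ?_)
      exact Real.log_le_log (by positivity) (by linarith)
    set ρ := Complex.exp (c * (Real.log (n + 2) - Real.log (n + 1) : ℝ)) with hρ
    have hNc : (n + 2 : ℂ) ≠ 0 := by exact_mod_cast (by positivity : (n + 2 : ℝ) ≠ 0)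
    have hNc1 : (n + 1 : ℂ) ≠ 0 := by exact_mod_cast (by positivity : (n + 1 : ℝ) ≠ 0)
    have e : W (n + 1) - ρ * W n = s ^ (n + 1) *
        ((u (n + 1) - s * ((1 + c / (n + 2)) * u n + v n / (n + 2))) +
          s * (1 + c / (n + 2) - ρ) * u n + (v (n + 1) + s * v n) / (2 * (n + 2)) +
          s * (v n / 2) * ((1 - ρ) / (n + 1) - 1 / ((n + 1) * (n + 2)))) := by
      have hsn : s ^ n = s ^ (n + 1) * s := by
        rw [pow_succ, mul_assoc, ← pow_two, hs2, mul_one]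
      simp only [hW]
      rw [hsn]
      have hN : ((n + 1 : ℕ) : ℂ) + 1 = n + 2 := by push_cast; ring
      rw [hN]
      field_simp
      ring
    have h12 : 1 / (n + 1 : ℝ) ≤ 2 / (n + 2) := by
      rw [div_le_div_iff₀ (by positivity) (by positivity)]
      linarith
    have hsq : 1 / (n + 2 : ℝ) ^ 2 ≤ 1 / ((n + 2) * √(n + 2)) := by
      rw [pow_two]
      gcongr
      rw [Real.sqrt_le_left (by positivity)]
      nlinarith
    have b2 : ‖s * (1 + c / (n + 2) - ρ) * u n‖ ≤
        (4 * B ^ 2 * Real.exp B + 2 * B) * (1 / (n + 2) ^ 2) := by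
      rw [norm_mul, norm_mul, hs, one_mul]
      calc _ ≤ (4 * B ^ 2 * Real.exp B + 2 * B) / (n + 2) ^ 2 * 1 := by
            gcongr
            exact hu n
        _ = _ := by ring
    have hn2 : ‖(n + 2 : ℂ)‖ = n + 2 := by
      have : ((n + 2 : ℕ) : ℂ) = n + 2 := by push_cast; ring
      rw [← this, Complex.norm_natCast]
      push_cast
      ring
    have hn1 : ‖(n + 1 : ℂ)‖ = n + 1 := by
      have : ((n + 1 : ℕ) : ℂ) = n + 1 := by push_cast; ring
      rw [← this, Complex.norm_natCast]
      push_cast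
      ring
    have b3 : ‖(v (n + 1) + s * v n) / (2 * (n + 2))‖ ≤ C * (1 / (n + 2) ^ 2) := by
      rw [norm_div, norm_mul, hn2, RCLike.norm_ofNat]
      calc _ ≤ C / (n + 2) / (1 * (n + 2)) := by
            gcongr
            · exact hosc n
            · norm_num
        _ = _ := by
          field_simp
    have b4 : ‖s * (v n / 2) * ((1 - ρ) / (n + 1) - 1 / ((n + 1) * (n + 2)))‖ ≤
        (B + 2 * B ^ 2 * Real.exp B) * (1 / (n + 2) ^ 2) := by
      have h5 : ‖(1 - ρ) / (n + 1) - 1 / ((n + 1) * (n + 2))‖ ≤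
          2 * (2 * B * Real.exp B + 1) * (1 / (n + 2) ^ 2) := by
        refine (norm_sub_le _ _).trans ?_
        rw [norm_div, norm_div, norm_mul, hn1, hn2, norm_one]
        calc _ ≤ 2 * B * Real.exp B / (n + 2) * (2 / (n + 2)) + 2 / (n + 2) * (1 / (n + 2)) := by
              refine add_le_add ?_ ?_
              · rw [div_eq_mul_one_div]
                gcongr
              · rw [← one_div_mul_one_div]
                gcongr
          _ = _ := by
            field_simp
      rw [norm_mul, norm_mul, hs, one_mul, norm_div, RCLike.norm_ofNat]
      calc _ ≤ B / 2 * (2 * (2 * B * Real.exp B + 1) * (1 / (n + 2) ^ 2)) := by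
            gcongr
            exact hv n
        _ = _ := by ring
    rw [e, norm_mul, norm_pow, hs, one_pow, one_mul]
    calc _ ≤ C / ((n + 2) * √(n + 2)) + (4 * B ^ 2 * Real.exp B + 2 * B) * (1 / (n + 2) ^ 2) +
          C * (1 / (n + 2) ^ 2) + (B + 2 * B ^ 2 * Real.exp B) * (1 / (n + 2) ^ 2) :=
          (norm_add_le _ _).trans (add_le_add ((norm_add_le _ _).trans (add_le_add
            ((norm_add_le _ _).trans (add_le_add (hrec n) b2)) b3)) b4)
      _ ≤ C * (1 / ((n + 2) * √(n + 2))) +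
          (4 * B ^ 2 * Real.exp B + 2 * B) * (1 / ((n + 2) * √(n + 2))) +
          C * (1 / ((n + 2) * √(n + 2))) +
          (B + 2 * B ^ 2 * Real.exp B) * (1 / ((n + 2) * √(n + 2))) := by
          rw [div_eq_mul_one_div C]
          gcongr
      _ = _ := by rw [hC₁]; ring
  -- As `c.re ≤ 0`, the exponential factors have norm at most one and the step errors add up without
  -- growth.
  have htel : ∀ n, n₀ ≤ n → ‖W n - Complex.exp (c * (Real.log (n + 1) - Real.log (n₀ + 1) : ℝ)) *
      W n₀‖ ≤ 2 * C₁ * (1 / √(n₀ + 1 : ℝ) - 1 / √(n + 1 : ℝ)) := by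
    intro n hn
    induction n, hn using Nat.le_induction with
    | base => simp
    | succ n hn ih =>
      have hρn : ‖Complex.exp (c * (Real.log (n + 2) - Real.log (n + 1) : ℝ))‖ ≤ 1 := by
        rw [Complex.norm_exp, Real.exp_le_one_iff, Complex.re_mul_ofReal]
        refine mul_nonpos_of_nonpos_of_nonneg hcre (sub_nonneg.mpr ?_)
        exact Real.log_le_log (by positivity) (by linarith)
      have hcast : ((n + 1 : ℕ) : ℝ) + 1 = n + 2 := by push_cast; ring
      rw [hcast]
      have e : W (n + 1) - Complex.exp (c * (Real.log (n + 2) - Real.log (n₀ + 1) : ℝ)) * W n₀ =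
          (W (n + 1) - Complex.exp (c * (Real.log (n + 2) - Real.log (n + 1) : ℝ)) * W n) +
          Complex.exp (c * (Real.log (n + 2) - Real.log (n + 1) : ℝ)) *
            (W n - Complex.exp (c * (Real.log (n + 1) - Real.log (n₀ + 1) : ℝ)) * W n₀) := by
        have hexp : Complex.exp (c * (Real.log (n + 2) - Real.log (n₀ + 1) : ℝ)) =
            Complex.exp (c * (Real.log (n + 2) - Real.log (n + 1) : ℝ)) *
              Complex.exp (c * (Real.log (n + 1) - Real.log (n₀ + 1) : ℝ)) := by
          rw [← Complex.exp_add, ← mul_add, ← Complex.ofReal_add, sub_add_sub_cancel]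
        rw [hexp]
        ring
      rw [e]
      have h6 := mul_le_mul_of_nonneg_left (one_div_mul_sqrt_le n) (by positivity : 0 ≤ C₁)
      calc _ ≤ C₁ * (1 / ((n + 2) * √(n + 2))) +
            1 * (2 * C₁ * (1 / √(n₀ + 1 : ℝ) - 1 / √(n + 1 : ℝ))) := by
            refine (norm_add_le _ _).trans (add_le_add (hstep n) ?_)
            rw [norm_mul]
            gcongr
        _ ≤ _ := by linarith
  have hWu : ∀ n, n₀ ≤ n → ‖s ^ n * u n - W n‖ ≤ B / 2 * (1 / √(n₀ + 1 : ℝ)) := by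
    intro n hn
    have hn0 : (n₀ : ℝ) ≤ n := by exact_mod_cast hn
    have e : s ^ n * u n - W n = -(s ^ n * (v n / (2 * (n + 1)))) := by
      simp only [hW]
      ring
    have hn1 : ‖(n + 1 : ℂ)‖ = n + 1 := by
      have : ((n + 1 : ℕ) : ℂ) = n + 1 := by push_cast; ring
      rw [← this, Complex.norm_natCast]
      push_cast
      ring
    rw [e, norm_neg, norm_mul, norm_pow, hs, one_pow, one_mul, norm_div, norm_mul, hn1,
      RCLike.norm_ofNat]
    calc ‖v n‖ / (2 * (n + 1)) ≤ B / (2 * √(n₀ + 1 : ℝ)) := by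
          gcongr
          · exact hv n
          · rw [Real.sqrt_le_left (by positivity)]
            nlinarith [(Nat.cast_nonneg n₀ : (0 : ℝ) ≤ n₀)]
      _ = _ := by
        field_simp
  have hEn : ‖Complex.exp (c * (Real.log (n + 1) - Real.log (n₀ + 1) : ℝ))‖ ≤ 1 := by
    rw [Complex.norm_exp, Real.exp_le_one_iff, Complex.re_mul_ofReal]
    refine mul_nonpos_of_nonpos_of_nonneg hcre (sub_nonneg.mpr ?_)
    have hn0 : (n₀ : ℝ) ≤ n := by exact_mod_cast hn
    exact Real.log_le_log (by positivity) (by linarith)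
  set E := Complex.exp (c * (Real.log (n + 1) - Real.log (n₀ + 1) : ℝ)) with hE
  have e : s ^ n * u n - E * (s ^ n₀ * u n₀) = (s ^ n * u n - W n) + (W n - E * W n₀) -
      E * (s ^ n₀ * u n₀ - W n₀) := by ring
  rw [e]
  have hpos : 0 ≤ 1 / √(n + 1 : ℝ) := by positivity
  calc _ ≤ B / 2 * (1 / √(n₀ + 1 : ℝ)) + 2 * C₁ * (1 / √(n₀ + 1 : ℝ) - 1 / √(n + 1 : ℝ)) +
        1 * (B / 2 * (1 / √(n₀ + 1 : ℝ))) := by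
        refine (norm_sub_le _ _).trans (add_le_add ((norm_add_le _ _).trans
          (add_le_add (hWu n hn) (htel n hn))) ?_)
        rw [norm_mul]
        gcongr
        exact hWu n₀ le_rfl
    _ ≤ B / 2 * (1 / √(n₀ + 1 : ℝ)) + 2 * C₁ * (1 / √(n₀ + 1 : ℝ)) +
        1 * (B / 2 * (1 / √(n₀ + 1 : ℝ))) := by
        gcongr
        linarith
    _ = _ := by ring

-- Power-law behaviour of the means

lemma measurable_detPoint_of (n : ℕ) :
    Measurable fun x : Fin (n + 1) → Fin (n + 1) → ℂ => detPoint (Matrix.of x) := by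
  have h1 : Continuous fun x : Fin (n + 1) → Fin (n + 1) → ℂ => (Matrix.of x).det := by
    simp only [Matrix.det_apply]
    fun_prop
  have h2 : Continuous fun x : Fin (n + 1) → Fin (n + 1) → ℂ =>
      ((Matrix.of x).submatrix Fin.succ Fin.succ).det := by
    simp only [Matrix.det_apply, Matrix.submatrix_apply, Matrix.of_apply]
    fun_prop
  simp only [detPoint, Complex.mk_eq_add_mul_I]
  fun_prop

namespace polarChar

lemma norm_drift_le {t : ℝ} (ht : |t| ≤ 1) (k : ℤ) :
    ‖drift t k‖ ≤ 2 + 2 * |(k : ℝ)| + 2 * (k : ℝ) ^ 2 := by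
  have ht2 : t ^ 2 ≤ 1 := by rwa [sq_le_one_iff_abs_le_one]
  rw [drift]
  refine (norm_sub_le _ _).trans ?_
  rw [norm_neg, norm_mul, Complex.norm_real, Complex.norm_real, Complex.norm_I, mul_one,
    Real.norm_eq_abs, Real.norm_eq_abs, abs_div, abs_of_nonneg (by positivity)]
  norm_num
  nlinarith [abs_nonneg (k : ℝ), sq_nonneg (k : ℝ)]

/-- A real parameter covers both coefficients: `x = k` for `oscPos`, `x = -k` for `oscNeg`. -/
lemma norm_osc_coeff_le {t : ℝ} (ht : |t| ≤ 1) (x : ℝ) :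
    ‖((t ^ 2 / 8 - x ^ 2 / 2 - 3 * x / 4 : ℝ) : ℂ) + (3 * t / 8 + x * t / 2 : ℝ) * Complex.I‖ ≤
      2 + 2 * |x| + 2 * x ^ 2 := by
  have ht2 : t ^ 2 ≤ 1 := by rwa [sq_le_one_iff_abs_le_one]
  refine (norm_add_le _ _).trans ?_
  rw [norm_mul, Complex.norm_real, Complex.norm_real, Complex.norm_I, mul_one,
    Real.norm_eq_abs, Real.norm_eq_abs]
  have h1 : |t ^ 2 / 8 - x ^ 2 / 2 - 3 * x / 4| ≤ 1 + x ^ 2 + |x| := by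
    rw [abs_le]
    constructor <;> nlinarith [le_abs_self x, neg_abs_le x, sq_nonneg t, sq_nonneg x]
  have h2 : |3 * t / 8 + x * t / 2| ≤ 1 + |x| := by
    have : 3 * t / 8 + x * t / 2 = t * (3 / 8 + x / 2) := by ring
    rw [this, abs_mul]
    have h3 : |3 / 8 + x / 2| ≤ 1 + |x| := by
      rw [abs_le]
      constructor <;> linarith [le_abs_self x, neg_abs_le x]
    nlinarith [abs_nonneg (3 / 8 + x / 2), abs_nonneg t]
  nlinarith [sq_nonneg x]

lemma norm_oscPos_le {t : ℝ} (ht : |t| ≤ 1) (k : ℤ) :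
    ‖oscPos t k‖ ≤ 2 + 2 * |(k : ℝ)| + 2 * (k : ℝ) ^ 2 :=
  norm_osc_coeff_le ht k

lemma norm_oscNeg_le {t : ℝ} (ht : |t| ≤ 1) (k : ℤ) :
    ‖oscNeg t k‖ ≤ 2 + 2 * |(k : ℝ)| + 2 * (k : ℝ) ^ 2 := by
  have h := norm_osc_coeff_le ht (-k : ℝ)
  rw [abs_neg, neg_sq] at h
  refine le_of_eq_of_le ?_ h
  rw [oscNeg]
  congr 4
  · ring
  · ring

end polarChar

namespace IsGUE

/-- Matrices of different orders live on unrelated probability spaces. As the mean depends on the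
law alone, the minor of `M (n + 1)` may be exchanged for `M n`, which closes the recursion. -/
lemma integral_polarChar_eq {Ω Ω' : Type*} [MeasurableSpace Ω] [MeasurableSpace Ω']
    {P : Measure Ω} {P' : Measure Ω'} [IsProbabilityMeasure P] [IsProbabilityMeasure P'] {n : ℕ}
    {M : Ω → Matrix (Fin (n + 1)) (Fin (n + 1)) ℂ} {N : Ω' → Matrix (Fin (n + 1)) (Fin (n + 1)) ℂ}
    (hM : IsGUE M P) (hN : IsGUE N P') (t : ℝ) (k : ℤ) :
    ∫ ω, polarChar t k (detPoint (M ω)) ∂P = ∫ ω, polarChar t k (detPoint (N ω)) ∂P' := by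
  have hm : Measurable fun x : Fin (n + 1) → Fin (n + 1) → ℂ =>
      polarChar t k (detPoint (Matrix.of x)) :=
    (polarChar.measurable t k).comp (measurable_detPoint_of n)
  have h1 := integral_map hM.aemeasurable hm.aestronglyMeasurable
  have h2 := integral_map hN.aemeasurable hm.aestronglyMeasurable
  rw [hM.map_eq hN, h2] at h1
  simpa using h1.symm

lemma norm_integral_polarChar_le {Ω : Type*} [MeasurableSpace Ω]
    {P : Measure Ω} [IsProbabilityMeasure P] {n : ℕ}
    (M : Ω → Matrix (Fin (n + 1)) (Fin (n + 1)) ℂ) (t : ℝ) (k : ℤ) :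
    ‖∫ ω, polarChar t k (detPoint (M ω)) ∂P‖ ≤ 1 := by
  refine (norm_integral_le_of_norm_le_const (C := 1)
    (ae_of_all _ fun _ => polarChar.norm_le_one _ _ _)).trans ?_
  simp

lemma exists_recursion_integral (k : ℤ) : ∃ C : ℝ, 0 ≤ C ∧ ∀ t : ℝ, |t| ≤ 1 →
    ∀ {Ω : ℕ → Type*} [∀ n, MeasurableSpace (Ω n)] (P : ∀ n, Measure (Ω n))
    [∀ n, IsProbabilityMeasure (P n)] (M : ∀ n, Ω n → Matrix (Fin (n + 1)) (Fin (n + 1)) ℂ),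
    (∀ n, IsGUE (M n) (P n)) → ∀ n : ℕ,
    ‖(∫ ω, polarChar t k (detPoint (M (n + 1) ω)) ∂P (n + 1)) - (-1) ^ k *
      ((1 + polarChar.drift t k / (n + 2)) * (∫ ω, polarChar t k (detPoint (M n ω)) ∂P n) +
        (polarChar.oscPos t k * (∫ ω, polarChar t (k + 1) (detPoint (M n ω)) ∂P n) +
        polarChar.oscNeg t k * (∫ ω, polarChar t (k - 1) (detPoint (M n ω)) ∂P n)) /
        (n + 2))‖ ≤ C / ((n + 2) * √(n + 2)) := by
  obtain ⟨C, hC0, hC⟩ := exists_recursion k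
  refine ⟨C, hC0, fun t ht Ω _ P _ M hM n => ?_⟩
  have h := hC t ht (P (n + 1)) n (M (n + 1)) (hM (n + 1))
  rwa [(hM (n + 1)).submatrix_succ.integral_polarChar_eq (hM n) t k,
    (hM (n + 1)).submatrix_succ.integral_polarChar_eq (hM n) t (k + 1),
    (hM (n + 1)).submatrix_succ.integral_polarChar_eq (hM n) t (k - 1)] at h

/-- This crude form serves at index `k ± 1`, to show that the oscillating terms nearly change sign
relative to index `k`. -/
lemma exists_norm_integral_succ_sub_le (k : ℤ) : ∃ C : ℝ, 0 ≤ C ∧ ∀ t : ℝ, |t| ≤ 1 →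
    ∀ {Ω : ℕ → Type*} [∀ n, MeasurableSpace (Ω n)] (P : ∀ n, Measure (Ω n))
    [∀ n, IsProbabilityMeasure (P n)] (M : ∀ n, Ω n → Matrix (Fin (n + 1)) (Fin (n + 1)) ℂ),
    (∀ n, IsGUE (M n) (P n)) → ∀ n : ℕ,
    ‖(∫ ω, polarChar t k (detPoint (M (n + 1) ω)) ∂P (n + 1)) - (-1) ^ k *
      ∫ ω, polarChar t k (detPoint (M n ω)) ∂P n‖ ≤ C / (n + 2) := by
  obtain ⟨C, hC0, hC⟩ := exists_recursion_integral k
  obtain ⟨B, hB⟩ : ∃ B, B = 2 + 2 * |(k : ℝ)| + 2 * (k : ℝ) ^ 2 := ⟨_, rfl⟩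
  have hB0 : 0 ≤ B := by rw [hB]; positivity
  refine ⟨C + (B * 1 + (B * 1 + B * 1)), by positivity, fun t ht Ω _ P _ M hM n => ?_⟩
  have h := hC t ht P M hM n
  have b0 := norm_integral_polarChar_le (P := P n) (M n) t k
  have b1 := norm_integral_polarChar_le (P := P n) (M n) t (k + 1)
  have b2 := norm_integral_polarChar_le (P := P n) (M n) t (k - 1)
  set u' := ∫ ω, polarChar t k (detPoint (M (n + 1) ω)) ∂P (n + 1)
  set u := ∫ ω, polarChar t k (detPoint (M n ω)) ∂P n
  set u₁ := ∫ ω, polarChar t (k + 1) (detPoint (M n ω)) ∂P n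
  set u₂ := ∫ ω, polarChar t (k - 1) (detPoint (M n ω)) ∂P n
  have hs : ‖(-1 : ℂ) ^ k‖ = 1 := by simp
  have hn2 : ‖(n + 2 : ℂ)‖ = n + 2 := by
    have : ((n + 2 : ℕ) : ℂ) = n + 2 := by push_cast; ring
    rw [← this, Complex.norm_natCast]
    push_cast
    ring
  have e : u' - (-1) ^ k * u = (u' - (-1) ^ k * ((1 + polarChar.drift t k / (n + 2)) * u +
      (polarChar.oscPos t k * u₁ + polarChar.oscNeg t k * u₂) / (n + 2))) +
      (-1) ^ k * ((polarChar.drift t k * u +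
        (polarChar.oscPos t k * u₁ + polarChar.oscNeg t k * u₂)) / (n + 2)) := by ring
  rw [e]
  refine (norm_add_le _ _).trans ?_
  rw [add_div C]
  refine add_le_add (h.trans ?_) ?_
  · gcongr
    refine le_mul_of_one_le_right (by positivity) ?_
    rw [Real.one_le_sqrt]
    linarith [(Nat.cast_nonneg n : (0 : ℝ) ≤ n)]
  · rw [norm_mul, hs, one_mul, norm_div, hn2]
    gcongr
    refine (norm_add_le _ _).trans (add_le_add ?_ ((norm_add_le _ _).trans (add_le_add ?_ ?_)))
    · rw [norm_mul]
      gcongr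
      exact hB ▸ polarChar.norm_drift_le ht k
    · rw [norm_mul]
      gcongr
      exact hB ▸ polarChar.norm_oscPos_le ht k
    · rw [norm_mul]
      gcongr
      exact hB ▸ polarChar.norm_oscNeg_le ht k

/-- The mean of `polarChar t k` of the normalized determinants of GUE matrices of order `n + 1`
behaves like `± (n + 1) ^ drift t k`. -/
lemma exists_norm_integral_sub_exp_mul_le (k : ℤ) : ∃ C : ℝ, 0 ≤ C ∧ ∀ t : ℝ, |t| ≤ 1 →
    ∀ {Ω : ℕ → Type*} [∀ n, MeasurableSpace (Ω n)] (P : ∀ n, Measure (Ω n))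
    [∀ n, IsProbabilityMeasure (P n)] (M : ∀ n, Ω n → Matrix (Fin (n + 1)) (Fin (n + 1)) ℂ),
    (∀ n, IsGUE (M n) (P n)) → ∀ n₀ n : ℕ, n₀ ≤ n →
    ‖((-1) ^ k) ^ n * (∫ ω, polarChar t k (detPoint (M n ω)) ∂P n) -
      Complex.exp (polarChar.drift t k * (Real.log (n + 1) - Real.log (n₀ + 1) : ℝ)) *
      (((-1) ^ k) ^ n₀ * ∫ ω, polarChar t k (detPoint (M n₀ ω)) ∂P n₀)‖ ≤ C / √(n₀ + 1) := by
  obtain ⟨C, hC0, hC⟩ := exists_recursion_integral k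
  obtain ⟨C₁, hC₁0, hC₁⟩ := exists_norm_integral_succ_sub_le (k + 1)
  obtain ⟨C₂, hC₂0, hC₂⟩ := exists_norm_integral_succ_sub_le (k - 1)
  obtain ⟨B, hB⟩ : ∃ B, B = 2 + 2 * |(k : ℝ)| + 2 * (k : ℝ) ^ 2 := ⟨_, rfl⟩
  have hB0 : 0 ≤ B := by rw [hB]; positivity
  obtain ⟨C', hC'0, hC'⟩ := exists_norm_sub_exp_mul_le (B * 1 + B * 1) (C + (B * C₁ + B * C₂))
  refine ⟨C', hC'0, fun t ht Ω _ P _ M hM => ?_⟩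
  have hs2 : ((-1 : ℂ) ^ k) ^ 2 = 1 := by
    rw [← zpow_natCast, ← zpow_mul, mul_comm, zpow_mul]
    simp
  have b₁ : ‖polarChar.oscPos t k‖ ≤ B := hB ▸ polarChar.norm_oscPos_le ht k
  have b₂ : ‖polarChar.oscNeg t k‖ ≤ B := hB ▸ polarChar.norm_oscNeg_le ht k
  refine hC' (fun n => ∫ ω, polarChar t k (detPoint (M n ω)) ∂P n)
    (fun n => polarChar.oscPos t k * (∫ ω, polarChar t (k + 1) (detPoint (M n ω)) ∂P n) +
        polarChar.oscNeg t k * (∫ ω, polarChar t (k - 1) (detPoint (M n ω)) ∂P n))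
    (polarChar.drift t k) ((-1) ^ k) ?_ ?_ hs2 (by simp)
    (fun n => norm_integral_polarChar_le _ _ _) (fun n => ?_) (fun n => ?_) (fun n => ?_)
  · refine (hB ▸ polarChar.norm_drift_le ht k : _ ≤ B).trans (by linarith)
  · simp only [polarChar.drift, Complex.sub_re, Complex.neg_re, Complex.ofReal_re,
      Complex.re_ofReal_mul, Complex.I_re]
    nlinarith [sq_nonneg t, sq_nonneg (k : ℝ)]
  · refine (norm_add_le _ _).trans (add_le_add ?_ ?_)
    · rw [norm_mul]
      gcongr
      exact norm_integral_polarChar_le _ _ _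
    · rw [norm_mul]
      gcongr
      exact norm_integral_polarChar_le _ _ _
  · refine (hC t ht P M hM n).trans ?_
    gcongr
    have : 0 ≤ B * C₁ + B * C₂ := by positivity
    linarith
  · have h₁ := hC₁ t ht P M hM n
    have h₂ := hC₂ t ht P M hM n
    -- The opposite sign at index `k ± 1` is what supplies the hypothesis `v (n + 1) ≈ -s * v n`.
    have e₁ : (-1 : ℂ) ^ (k + 1) = -(-1) ^ k := by
      rw [zpow_add₀ (by norm_num)]
      simp
    have e₂ : (-1 : ℂ) ^ (k - 1) = -(-1) ^ k := by
      rw [zpow_sub₀ (by norm_num), zpow_one, div_neg, div_one]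
    rw [e₁] at h₁
    rw [e₂] at h₂
    have e : ∀ a b s x x' y y' : ℂ, (a * x' + b * y') + s * (a * x + b * y) =
        a * (x' - -s * x) + b * (y' - -s * y) := fun a b s x x' y y' => by ring
    rw [e]
    calc _ ≤ B * (C₁ / (n + 2)) + B * (C₂ / (n + 2)) := by
          refine (norm_add_le _ _).trans (add_le_add ?_ ?_)
          · rw [norm_mul]
            gcongr
          · rw [norm_mul]
            gcongr
      _ = (B * C₁ + B * C₂) / (n + 2) := by ring
      _ ≤ _ := div_le_div_of_nonneg_right (le_add_of_nonneg_left hC0) (by positivity)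

end IsGUE

-- Limits: uniform angle, log-normal modulus

/-- An interchange of limits: the starting index `n₀` of the recursion is kept fixed while `n → ∞`,
and the error, of order `1 / √(n₀ + 1)`, is removed afterwards. -/
lemma tendsto_of_forall_eventually_norm_sub_le {E : Type*} [NormedAddCommGroup E] {f : ℕ → E}
    {g : ℕ → ℕ → E} {a : E} {δ : ℕ → ℝ} (hδ : Tendsto δ atTop (𝓝 0))
    (h : ∀ m, ∀ᶠ n in atTop, ‖f n - g m n‖ ≤ δ m) (hg : ∀ m, Tendsto (g m) atTop (𝓝 a)) :
    Tendsto f atTop (𝓝 a) := by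
  rw [Metric.tendsto_nhds]
  intro ε hε
  obtain ⟨m, hm⟩ := (hδ.eventually_lt_const (half_pos hε)).exists
  filter_upwards [h m, (Metric.tendsto_nhds.mp (hg m)) (ε / 2) (half_pos hε)] with n h1 h2
  rw [dist_eq_norm] at h2 ⊢
  calc ‖f n - a‖ = ‖(f n - g m n) + (g m n - a)‖ := by abel_nf
    _ ≤ ‖f n - g m n‖ + ‖g m n - a‖ := norm_add_le _ _
    _ < ε := by linarith

lemma tendsto_const_div_sqrt_add_one (C : ℝ) :
    Tendsto (fun n : ℕ => C / √(n + 1 : ℝ)) atTop (𝓝 0) :=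
  tendsto_const_nhds.div_atTop (Real.tendsto_sqrt_atTop.comp
    (tendsto_atTop_add_const_right _ _ tendsto_natCast_atTop_atTop))

lemma tendsto_log_natCast_add_one : Tendsto (fun n : ℕ => Real.log (n + 1 : ℝ)) atTop atTop :=
  Real.tendsto_log_atTop.comp (tendsto_atTop_add_const_right _ _ tendsto_natCast_atTop_atTop)

namespace polarChar

lemma apply_zero_index {z : ℂ} (hz : z ≠ 0) : polarChar 0 0 z = 1 := by
  simp [polarChar, hz]

lemma zpow_eq {z : ℂ} (hz : z ≠ 0) (k : ℤ) : polarChar 0 k z = polarChar 0 1 z ^ k := by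
  simp only [polarChar, hz, if_false, zero_mul, Complex.ofReal_zero, Complex.exp_zero, one_mul,
    mul_one]
  rw [zpow_mul]

lemma tendsto_zero {z : ℂ} (hz : z ≠ 0) : Tendsto (fun t => polarChar t 0 z) (𝓝 0) (𝓝 1) := by
  have h : Continuous fun t => polarChar t 0 z := by
    simp only [polarChar, hz, if_false]
    fun_prop
  simpa [apply_zero_index hz] using h.tendsto 0

/-- This rests on `z² + |z|² = 2 (Re z) z`: the value `-(z / |z|)²` is near `1` exactly when `z` is
near the imaginary axis. -/
lemma norm_add_one_le {z : ℂ} (hz : z ≠ 0) {ε : ℝ} (h : |z.re| ≤ ε * ‖z‖) :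
    ‖-polarChar 0 1 z - 1‖ ≤ 2 * ε := by
  have hn : 0 < ‖z‖ := norm_pos_iff.mpr hz
  have hnc : (‖z‖ : ℂ) ≠ 0 := by exact_mod_cast hn.ne'
  have hsq : (‖z‖ : ℂ) ^ 2 = z * (starRingEnd ℂ) z := (Complex.mul_conj' z).symm
  have e : -polarChar 0 1 z - 1 = -((2 * z.re : ℝ) * z / (‖z‖ : ℂ) ^ 2) := by
    have h2 : ((2 * z.re : ℝ) : ℂ) = z + (starRingEnd ℂ) z := (Complex.add_conj z).symm
    have hp : polarChar 0 1 z = z ^ 2 / (‖z‖ : ℂ) ^ 2 := by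
      simp only [polarChar, hz, if_false, zero_mul, Complex.ofReal_zero, Complex.exp_zero, one_mul,
        mul_one]
      rw [← div_pow]
      norm_cast
    rw [h2, hp]
    field_simp
    rw [hsq]
    ring
  rw [e, norm_neg, norm_div, norm_mul, norm_pow, Complex.norm_real, Complex.norm_real, norm_norm,
    Real.norm_eq_abs, abs_mul, abs_two, div_le_iff₀ (by positivity)]
  nlinarith

end polarChar

lemma norm_pow_sub_one_le {a : ℂ} (ha : ‖a‖ ≤ 1) (j : ℕ) : ‖a ^ j - 1‖ ≤ j * ‖a - 1‖ := by
  induction j with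
  | zero => simp
  | succ j ih =>
    have e : a ^ (j + 1) - 1 = a * (a ^ j - 1) + (a - 1) := by ring
    rw [e]
    refine (norm_add_le _ _).trans ?_
    rw [norm_mul]
    push_cast
    nlinarith [norm_nonneg (a ^ j - 1), norm_nonneg (a - 1)]

/-- The power `a ^ j` is within `j / m` of `1`, and these deviations add up to at most `m / 2`. -/
lemma le_norm_sum_pow {a : ℂ} (ha : ‖a‖ ≤ 1) {m : ℕ} (hm : 0 < m) (h : ‖a - 1‖ ≤ 1 / m) :
    (m : ℝ) / 2 ≤ ‖∑ j ∈ Finset.range m, a ^ j‖ := by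
  have hm0 : (0 : ℝ) < m := by exact_mod_cast hm
  have h1 : ‖∑ j ∈ Finset.range m, a ^ j - m‖ ≤ m / 2 := by
    have e : ∑ j ∈ Finset.range m, a ^ j - m = ∑ j ∈ Finset.range m, (a ^ j - 1) := by simp
    rw [e]
    calc _ ≤ ∑ j ∈ Finset.range m, (j : ℝ) * (1 / m) :=
          norm_sum_le_of_le _ fun j _ => (norm_pow_sub_one_le ha j).trans (by gcongr)
      _ = (∑ j ∈ Finset.range m, (j : ℝ)) * (1 / m) := by rw [Finset.sum_mul]
      _ = (m * (m - 1) / 2) * (1 / m) := by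
          congr 1
          have := Finset.sum_range_id_mul_two m
          have h3 : ((∑ j ∈ Finset.range m, j : ℕ) : ℝ) * 2 = m * ((m - 1 : ℕ) : ℝ) := by
            exact_mod_cast this
          rw [Nat.cast_sub hm] at h3
          push_cast at h3
          linarith
      _ ≤ _ := by
          field_simp
          linarith
  have h2 : (m : ℝ) ≤ ‖∑ j ∈ Finset.range m, a ^ j‖ + ‖∑ j ∈ Finset.range m, a ^ j - m‖ := by
    calc (m : ℝ) = ‖(m : ℂ)‖ := by simp
      _ = ‖∑ j ∈ Finset.range m, a ^ j - (∑ j ∈ Finset.range m, a ^ j - m)‖ := by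
        rw [sub_sub_cancel]
      _ ≤ _ := norm_sub_le _ _
  linarith

namespace polarChar

/-- This is `m` times a Fejér kernel in the doubled angle, peaked at the imaginary axis. Its
expansion in characters gives access to its mean. -/
lemma normSq_sum_eq {z : ℂ} (hz : z ≠ 0) (m : ℕ) :
    ((‖∑ j ∈ Finset.range m, (-polarChar 0 1 z) ^ j‖ ^ 2 : ℝ) : ℂ) =
      ∑ i ∈ Finset.range m, ∑ j ∈ Finset.range m, (-1) ^ (i + j) *
        polarChar 0 ((i : ℤ) - j) z := by
  have hp : ‖polarChar 0 1 z‖ = 1 := norm_eq_one _ _ hz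
  have hp0 : polarChar 0 1 z ≠ 0 := norm_ne_zero_iff.mp (by rw [hp]; norm_num)
  rw [Complex.ofReal_pow, ← Complex.mul_conj', map_sum, Finset.sum_mul_sum]
  refine Finset.sum_congr rfl fun i _ => Finset.sum_congr rfl fun j _ => ?_
  rw [map_pow, map_neg, ← Complex.inv_eq_conj hp, zpow_eq hz ((i : ℤ) - j), zpow_sub₀ hp0, zpow_natCast,
    zpow_natCast, neg_pow, neg_pow _ j, inv_pow, pow_add]
  ring

end polarChar

namespace IsGUE

variable {Ω : ℕ → Type*} [∀ n, MeasurableSpace (Ω n)] {P : ∀ n, Measure (Ω n)}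
  [∀ n, IsProbabilityMeasure (P n)] {M : ∀ n, Ω n → Matrix (Fin (n + 1)) (Fin (n + 1)) ℂ}

lemma ae_detPoint_re_ne_zero {Ω : Type*} [MeasurableSpace Ω] {P : Measure Ω}
    [IsProbabilityMeasure P] {n : ℕ}
    {M : Ω → Matrix (Fin (n + 1)) (Fin (n + 1)) ℂ} (h : IsGUE M P) :
    ∀ᵐ ω ∂P, (detPoint (M ω)).re ≠ 0 := by
  filter_upwards [h.ae_re_det_ne_zero] with ω hω
  exact div_ne_zero hω (by positivity)

lemma ae_detPoint_ne_zero {Ω : Type*} [MeasurableSpace Ω] {P : Measure Ω}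
    [IsProbabilityMeasure P] {n : ℕ}
    {M : Ω → Matrix (Fin (n + 1)) (Fin (n + 1)) ℂ} (h : IsGUE M P) :
    ∀ᵐ ω ∂P, detPoint (M ω) ≠ 0 := by
  filter_upwards [h.ae_detPoint_re_ne_zero] with ω hω h0
  exact hω (by rw [h0, Complex.zero_re])

/-- Almost sure nonvanishing matters: the limit character `polarChar 0 0` is `1` except at the
origin, where it is `0`. -/
lemma tendsto_integral_polarChar_zero {Ω : Type*} [MeasurableSpace Ω] {P : Measure Ω}
    [IsProbabilityMeasure P] {n : ℕ}
    {M : Ω → Matrix (Fin (n + 1)) (Fin (n + 1)) ℂ} (h : IsGUE M P) {t : ℕ → ℝ}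
    (ht : Tendsto t atTop (𝓝 0)) :
    Tendsto (fun m => ∫ ω, polarChar (t m) 0 (detPoint (M ω)) ∂P) atTop (𝓝 1) := by
  have := tendsto_integral_of_dominated_convergence (μ := P) (fun _ => (1 : ℝ))
    (F := fun m ω => polarChar (t m) 0 (detPoint (M ω))) (f := fun _ => (1 : ℂ))
    (fun m => (h.integrable_polarChar (t m) 0).aestronglyMeasurable) (integrable_const _)
    (fun m => ae_of_all _ fun _ => polarChar.norm_le_one _ _ _)
    (by filter_upwards [h.ae_detPoint_ne_zero] with ω hω using (polarChar.tendsto_zero hω).comp ht)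
  simpa using this

lemma integral_polarChar_zero_zero {Ω : Type*} [MeasurableSpace Ω] {P : Measure Ω}
    [IsProbabilityMeasure P] {n : ℕ}
    {M : Ω → Matrix (Fin (n + 1)) (Fin (n + 1)) ℂ} (h : IsGUE M P) :
    ∫ ω, polarChar 0 0 (detPoint (M ω)) ∂P = 1 := by
  rw [integral_congr_ae (g := fun _ => 1)]
  · simp
  · filter_upwards [h.ae_detPoint_ne_zero] with ω hω using polarChar.apply_zero_index hω

/-- The angle of the normalized determinants is asymptotically uniform. -/
lemma tendsto_integral_polarChar_of_ne_zero (hM : ∀ n, IsGUE (M n) (P n)) {k : ℤ} (hk : k ≠ 0) :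
    Tendsto (fun n => ∫ ω, polarChar 0 k (detPoint (M n ω)) ∂P n) atTop (𝓝 0) := by
  obtain ⟨C, hC0, hC⟩ := exists_norm_integral_sub_exp_mul_le k
  have hk2 : (0 : ℝ) < (k : ℝ) ^ 2 := by positivity
  have h : Tendsto (fun n => ((-1 : ℂ) ^ k) ^ n * ∫ ω, polarChar 0 k (detPoint (M n ω)) ∂P n) atTop
      (𝓝 0) := by
    refine tendsto_of_forall_eventually_norm_sub_le (tendsto_const_div_sqrt_add_one C)
      (fun n₀ => (eventually_ge_atTop n₀).mono fun n hn => hC 0 (by simp) P M hM n₀ n hn)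
      (fun n₀ => ?_)
    rw [← zero_mul (((-1 : ℂ) ^ k) ^ n₀ * ∫ ω, polarChar 0 k (detPoint (M n₀ ω)) ∂P n₀)]
    refine Tendsto.mul_const _ ?_
    rw [tendsto_zero_iff_norm_tendsto_zero]
    -- At `t = 0` the factor has modulus `((n + 1) / (n₀ + 1)) ^ (-k²)`.
    have e : ∀ n : ℕ, ‖Complex.exp (polarChar.drift 0 k *
        (Real.log (n + 1) - Real.log (n₀ + 1) : ℝ))‖ =
        Real.exp (-((k : ℝ) ^ 2 * (Real.log (n + 1) + -Real.log (n₀ + 1)))) := by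
      intro n
      rw [Complex.norm_exp, Complex.re_mul_ofReal]
      simp only [polarChar.drift, Complex.sub_re, Complex.neg_re, Complex.ofReal_re,
        Complex.re_ofReal_mul, Complex.I_re]
      congr 1
      ring
    simp only [e]
    exact Real.tendsto_exp_neg_atTop_nhds_zero.comp ((tendsto_atTop_add_const_right _ _
      tendsto_log_natCast_add_one).const_mul_atTop hk2)
  rw [tendsto_zero_iff_norm_tendsto_zero] at h ⊢
  simpa using h

/-- The modulus of the normalized determinants is asymptotically log-normal. -/
lemma tendsto_integral_polarChar_mul_exp (hM : ∀ n, IsGUE (M n) (P n)) (τ : ℝ) :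
    Tendsto (fun n : ℕ => Complex.exp ((τ / √(1 / 2 * Real.log (n + 1)) / 4 *
        Real.log (n + 1) : ℝ) * Complex.I) *
      ∫ ω, polarChar (τ / √(1 / 2 * Real.log (n + 1))) 0 (detPoint (M n ω)) ∂P n) atTop
      (𝓝 (Complex.exp (-(τ ^ 2 / 2 : ℝ)))) := by
  obtain ⟨C, hC0, hC⟩ := exists_norm_integral_sub_exp_mul_le 0
  obtain ⟨t, ht⟩ : ∃ t : ℕ → ℝ, t = fun n : ℕ => τ / √(1 / 2 * Real.log (n + 1)) := ⟨_, rfl⟩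
  have ht' : ∀ n : ℕ, τ / √(1 / 2 * Real.log (n + 1)) = t n := fun n => by rw [ht]
  have ht0 : Tendsto t atTop (𝓝 0) := by
    rw [ht]
    exact tendsto_const_nhds.div_atTop (Real.tendsto_sqrt_atTop.comp
      (tendsto_log_natCast_add_one.const_mul_atTop (by norm_num)))
  simp only [ht']
  have ht1 : ∀ᶠ n in atTop, |t n| ≤ 1 := by
    have := ht0.abs
    rw [abs_zero] at this
    exact this.eventually_le_const one_pos
  have htL : ∀ᶠ n : ℕ in atTop, t n ^ 2 / 4 * Real.log (n + 1) = τ ^ 2 / 2 := by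
    filter_upwards [tendsto_log_natCast_add_one.eventually_gt_atTop 0] with n hn
    rw [← ht', div_pow, Real.sq_sqrt (by positivity)]
    field_simp
    norm_num
  -- By `htL` the real part of `drift * log (n + 1)` is exactly `-τ² / 2`, and the phase in front
  -- cancels the imaginary part. The remaining factors involve `n` only through `t n → 0` and tend
  -- to one.
  refine tendsto_of_forall_eventually_norm_sub_le (tendsto_const_div_sqrt_add_one C)
    (g := fun n₀ n => Complex.exp (-(τ ^ 2 / 2 : ℝ)) *
      (Complex.exp (-polarChar.drift (t n) 0 * Real.log (n₀ + 1)) *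
        ∫ ω, polarChar (t n) 0 (detPoint (M n₀ ω)) ∂P n₀)) (fun n₀ => ?_) (fun n₀ => ?_)
  · filter_upwards [ht1, htL, eventually_ge_atTop n₀] with n h1 h2 h3
    have h4 : ‖Complex.exp ((t n / 4 * Real.log (n + 1) : ℝ) * Complex.I)‖ = 1 :=
      Complex.norm_exp_ofReal_mul_I _
    have h5 := hC (t n) h1 P M hM n₀ n h3
    rw [zpow_zero, one_pow, one_pow, one_mul, one_mul] at h5
    have e : Complex.exp (-(τ ^ 2 / 2 : ℝ)) * Complex.exp (-polarChar.drift (t n) 0 *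
        Real.log (n₀ + 1)) = Complex.exp ((t n / 4 * Real.log (n + 1) : ℝ) * Complex.I) *
        Complex.exp (polarChar.drift (t n) 0 * (Real.log (n + 1) - Real.log (n₀ + 1) : ℝ)) := by
      rw [← Complex.exp_add, ← Complex.exp_add, ← h2]
      congr 1
      simp only [polarChar.drift]
      push_cast
      ring
    rw [← mul_assoc, e, mul_assoc, ← mul_sub, norm_mul, h4, one_mul]
    exact h5
  · nth_rw 2 [← mul_one (Complex.exp (-(τ ^ 2 / 2 : ℝ)))]
    refine Tendsto.const_mul _ ?_
    rw [← mul_one (1 : ℂ)]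
    refine Tendsto.mul ?_ ((hM n₀).tendsto_integral_polarChar_zero ht0)
    have hc : Continuous fun x : ℝ =>
        Complex.exp (-polarChar.drift x 0 * Real.log (n₀ + 1)) := by
      unfold polarChar.drift
      fun_prop
    have := (hc.tendsto 0).comp ht0
    simpa [polarChar.drift, Function.comp_def] using this

/-- Asymptotic uniformity of the angle leaves only the `m` diagonal terms, each equal to one. -/
lemma tendsto_integral_normSq_sum (hM : ∀ n, IsGUE (M n) (P n)) (m : ℕ) :
    Tendsto (fun n => ∫ ω, ‖∑ j ∈ Finset.range m, (-polarChar 0 1 (detPoint (M n ω))) ^ j‖ ^ 2 ∂P n)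
      atTop (𝓝 m) := by
  have e : ∀ n, ((∫ ω, ‖∑ j ∈ Finset.range m, (-polarChar 0 1 (detPoint (M n ω))) ^ j‖ ^ 2 ∂P n :
      ℝ) : ℂ) = ∑ i ∈ Finset.range m, ∑ j ∈ Finset.range m, (-1) ^ (i + j) *
        ∫ ω, polarChar 0 ((i : ℤ) - j) (detPoint (M n ω)) ∂P n := by
    intro n
    have hint : ∀ i j : ℕ, Integrable (fun ω => (-1) ^ (i + j) *
        polarChar 0 ((i : ℤ) - j) (detPoint (M n ω))) (P n) :=
      fun i j => ((hM n).integrable_polarChar 0 _).const_mul _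
    rw [← integral_complex_ofReal, integral_congr_ae (g := fun ω => ∑ i ∈ Finset.range m,
      ∑ j ∈ Finset.range m, (-1) ^ (i + j) * polarChar 0 ((i : ℤ) - j) (detPoint (M n ω)))]
    · rw [integral_finsetSum _ fun i _ => integrable_finsetSum _ fun j _ => hint i j]
      refine Finset.sum_congr rfl fun i _ => ?_
      rw [integral_finsetSum _ fun j _ => hint i j]
      exact Finset.sum_congr rfl fun j _ => integral_const_mul _ _
    · filter_upwards [(hM n).ae_detPoint_ne_zero] with ω hω using polarChar.normSq_sum_eq hω m
  have h : Tendsto (fun n => ∑ i ∈ Finset.range m, ∑ j ∈ Finset.range m, (-1 : ℂ) ^ (i + j) *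
        ∫ ω, polarChar 0 ((i : ℤ) - j) (detPoint (M n ω)) ∂P n) atTop
      (𝓝 (∑ i ∈ Finset.range m, ∑ j ∈ Finset.range m, (-1) ^ (i + j) *
        if i = j then 1 else 0)) := by
    refine tendsto_finsetSum _ fun i _ => tendsto_finsetSum _ fun j _ => Tendsto.const_mul _ ?_
    split_ifs with hij
    · subst hij
      simp only [sub_self, fun n => (hM n).integral_polarChar_zero_zero]
      exact tendsto_const_nhds
    · exact tendsto_integral_polarChar_of_ne_zero hM (by omega)
  have hval : (∑ i ∈ Finset.range m, ∑ j ∈ Finset.range m, (-1 : ℂ) ^ (i + j) *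
        if i = j then 1 else 0) = ((m : ℝ) : ℂ) := by
    have : ∀ i ∈ Finset.range m, (∑ j ∈ Finset.range m, (-1 : ℂ) ^ (i + j) *
        if i = j then 1 else 0) = 1 := by
      intro i hi
      rw [Finset.sum_eq_single_of_mem i hi fun j _ hj => by simp [hj.symm]]
      simp [← two_mul]
    rw [Finset.sum_congr rfl this]
    simp
  rw [hval] at h
  simp only [← e] at h
  exact (Complex.continuous_re.tendsto _).comp h

/-- The angle of the normalized determinants is unlikely to be close to a right angle. -/
lemma exists_eventually_measureReal_le (hM : ∀ n, IsGUE (M n) (P n)) {η : ℝ} (hη : 0 < η) :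
    ∃ ε : ℝ, 0 < ε ∧ ε ≤ 1 ∧ ∀ᶠ n in atTop,
      (P n).real {ω | |(detPoint (M n ω)).re| ≤ ε * ‖detPoint (M n ω)‖} ≤ η := by
  -- Markov's inequality at level `(m / 2)²`, for a mean of at most `2 m`, gives `8 / m`. The choice
  -- `ε = 1 / (2 m)` below yields the distance `1 / m` required by `le_norm_sum_pow`.
  obtain ⟨m, hm⟩ := exists_nat_gt (max 1 (8 / η))
  have hm1 : (1 : ℝ) < m := (le_max_left _ _).trans_lt hm
  have hm0 : (0 : ℝ) < m := one_pos.trans hm1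
  have hm8 : 8 / m ≤ η := by
    have := (le_max_right 1 (8 / η)).trans_lt hm
    rw [div_lt_iff₀ hη] at this
    rw [div_le_iff₀ hm0]
    linarith
  refine ⟨1 / (2 * m), by positivity, by rw [div_le_one (by positivity)]; linarith, ?_⟩
  have h2 : (m : ℝ) < 2 * m := by linarith
  filter_upwards [(tendsto_integral_normSq_sum hM m).eventually_le_const h2] with n hn
  set f : Ω n → ℝ := fun ω => ‖∑ j ∈ Finset.range m, (-polarChar 0 1 (detPoint (M n ω))) ^ j‖ ^ 2
    with hf
  have hfm : AEStronglyMeasurable f (P n) := by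
    have h3 : AEMeasurable (fun ω => polarChar 0 1 (detPoint (M n ω))) (P n) :=
      ((hM n).integrable_polarChar 0 1).aestronglyMeasurable.aemeasurable
    have h4 : Continuous fun x : ℂ => ‖∑ j ∈ Finset.range m, (-x) ^ j‖ ^ 2 := by fun_prop
    exact (h4.measurable.comp_aemeasurable h3).aestronglyMeasurable
  have hfi : Integrable f (P n) := by
    refine (integrable_const ((m : ℝ) ^ 2)).mono' hfm (ae_of_all _ fun ω => ?_)
    rw [Real.norm_eq_abs, abs_of_nonneg (by positivity)]
    have : ‖∑ j ∈ Finset.range m, (-polarChar 0 1 (detPoint (M n ω))) ^ j‖ ≤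
        ∑ j ∈ Finset.range m, 1 := by
      refine norm_sum_le_of_le _ fun j _ => ?_
      rw [norm_pow, norm_neg]
      exact pow_le_one₀ (norm_nonneg _) (polarChar.norm_le_one _ _ _)
    exact pow_le_pow_left₀ (norm_nonneg _) (this.trans (by simp)) 2
  have hmarkov := mul_meas_ge_le_integral_of_nonneg (ae_of_all _ fun ω => by positivity) hfi
    ((m / 2 : ℝ) ^ 2)
  have hmono : (P n).real {ω | |(detPoint (M n ω)).re| ≤ 1 / (2 * m) * ‖detPoint (M n ω)‖} ≤
      (P n).real {ω | (m / 2 : ℝ) ^ 2 ≤ f ω} := by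
    refine ENNReal.toReal_mono (measure_ne_top _ _) (measure_mono_ae ?_)
    filter_upwards [(hM n).ae_detPoint_ne_zero] with ω hω hmem
    have h5 : ‖-polarChar 0 1 (detPoint (M n ω)) - 1‖ ≤ 1 / m :=
      (polarChar.norm_add_one_le hω hmem).trans (le_of_eq (by field_simp))
    have h6 := le_norm_sum_pow (a := -polarChar 0 1 (detPoint (M n ω)))
      (by rw [norm_neg]; exact polarChar.norm_le_one _ _ _) (by exact_mod_cast hm0) h5
    change (m / 2 : ℝ) ^ 2 ≤ ‖∑ j ∈ Finset.range m, (-polarChar 0 1 (detPoint (M n ω))) ^ j‖ ^ 2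
    gcongr
  refine hmono.trans ((?_ : _ ≤ 8 / (m : ℝ)).trans hm8)
  rw [le_div_iff₀ hm0]
  have h7 := hmarkov.trans hn
  have h8 : m * ((P n).real {ω | (m / 2 : ℝ) ^ 2 ≤ f ω} * m) ≤ m * 8 := by nlinarith
  exact le_of_mul_le_mul_left h8 hm0

end IsGUE

-- From the modulus to the determinant

namespace IsGUE

lemma ae_log_norm_det_eq {Ω : Type*} [MeasurableSpace Ω] {P : Measure Ω}
    [IsProbabilityMeasure P] {n : ℕ}
    {M : Ω → Matrix (Fin (n + 1)) (Fin (n + 1)) ℂ} (h : IsGUE M P) :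
    ∀ᵐ ω ∂P, Real.log ‖(M ω).det‖ - 1 / 2 * Real.log ((n + 1).factorial : ℝ) =
      Real.log |(detPoint (M ω)).re| := by
  filter_upwards [h.isHermitian, h.ae_re_det_ne_zero] with ω h1 h2
  have him : (((M ω).det.re : ℝ) : ℂ) = (M ω).det := by
    rw [← Complex.conj_eq_iff_re, starRingEnd_apply, ← Matrix.det_conjTranspose, h1.eq]
  have hf : (0 : ℝ) < ((n + 1).factorial : ℝ) := by positivity
  rw [← him, Complex.norm_real, Real.norm_eq_abs, detPoint, abs_div, abs_of_pos (Real.sqrt_pos.mpr hf),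
    Real.log_div (abs_ne_zero.mpr h2) (Real.sqrt_pos.mpr hf).ne', Real.log_sqrt hf.le]
  ring

lemma aemeasurable_log_norm_det {Ω : Type*} [MeasurableSpace Ω] {P : Measure Ω} {n : ℕ}
    {M : Ω → Matrix (Fin n) (Fin n) ℂ} (h : IsGUE M P) :
    AEMeasurable (fun ω => Real.log ‖(M ω).det‖) P := by
  have h1 : Continuous fun x : Fin n → Fin n → ℂ => (Matrix.of x).det := by
    simp only [Matrix.det_apply]
    fun_prop
  exact (Real.measurable_log.comp h1.norm.measurable).comp_aemeasurable h.aemeasurable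

/-- Away from the imaginary axis `log |Re z|` and `log ‖z‖` differ by at most `log (1 / ε)`; on the
exceptional event the difference of two numbers of norm at most one is bounded by `2`. -/
lemma norm_integral_exp_log_sub_le {Ω : Type*} [MeasurableSpace Ω] {P : Measure Ω}
    [IsProbabilityMeasure P] {n : ℕ}
    {M : Ω → Matrix (Fin (n + 1)) (Fin (n + 1)) ℂ} (h : IsGUE M P) (t : ℝ) {ε : ℝ} (hε : 0 < ε)
    (hε1 : ε ≤ 1) :
    ‖(∫ ω, Complex.exp ((t * Real.log |(detPoint (M ω)).re| : ℝ) * Complex.I) ∂P) -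
      ∫ ω, polarChar t 0 (detPoint (M ω)) ∂P‖ ≤
      |t| * Real.log (1 / ε) +
        2 * P.real {ω | |(detPoint (M ω)).re| ≤ ε * ‖detPoint (M ω)‖} := by
  set A : Set Ω := {ω | |(detPoint (M ω)).re| ≤ ε * ‖detPoint (M ω)‖} with hA
  have hZ := h.aemeasurable_detPoint
  have hAm : NullMeasurableSet A P :=
    nullMeasurableSet_le ((Complex.measurable_re.comp_aemeasurable hZ).abs)
      (hZ.norm.const_mul ε)
  have hm : AEMeasurable (fun ω =>
      Complex.exp ((t * Real.log |(detPoint (M ω)).re| : ℝ) * Complex.I)) P := by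
    have : Measurable fun z : ℂ => Complex.exp ((t * Real.log |z.re| : ℝ) * Complex.I) := by
      fun_prop
    exact this.comp_aemeasurable hZ
  have hi : Integrable (fun ω =>
      Complex.exp ((t * Real.log |(detPoint (M ω)).re| : ℝ) * Complex.I)) P :=
    (integrable_const (1 : ℝ)).mono' hm.aestronglyMeasurable
      (ae_of_all _ fun ω => (Complex.norm_exp_ofReal_mul_I _).le)
  have hlog : 0 ≤ Real.log (1 / ε) := Real.log_nonneg ((one_le_div hε).mpr hε1)
  have hind : Integrable (A.indicator fun _ => (2 : ℝ)) P :=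
    (integrable_const (2 : ℝ)).indicator₀ hAm
  rw [← integral_sub hi (h.integrable_polarChar t 0)]
  have hle : ∀ᵐ ω ∂P, ‖Complex.exp ((t * Real.log |(detPoint (M ω)).re| : ℝ) * Complex.I) -
      polarChar t 0 (detPoint (M ω))‖ ≤
      |t| * Real.log (1 / ε) + A.indicator (fun _ => (2 : ℝ)) ω := by
    filter_upwards [h.ae_detPoint_re_ne_zero, h.ae_detPoint_ne_zero] with ω h1 h2
    by_cases hω : ω ∈ A
    · rw [Set.indicator_of_mem hω]
      refine (norm_sub_le _ _).trans ?_
      rw [Complex.norm_exp_ofReal_mul_I]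
      have := polarChar.norm_le_one t 0 (detPoint (M ω))
      have := mul_nonneg (abs_nonneg t) hlog
      linarith
    · rw [Set.indicator_of_notMem hω, add_zero]
      have h3 : ε * ‖detPoint (M ω)‖ < |(detPoint (M ω)).re| := not_le.mp hω
      have h4 : 0 < ‖detPoint (M ω)‖ := norm_pos_iff.mpr h2
      have h5 : |(detPoint (M ω)).re| ≤ ‖detPoint (M ω)‖ := Complex.abs_re_le_norm _
      have h6 := Real.log_le_log (abs_pos.mpr h1) h5
      have h7 := Real.log_le_log (mul_pos hε h4) h3.le
      rw [Real.log_mul hε.ne' h4.ne'] at h7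
      rw [polarChar, if_neg h2, mul_zero, zpow_zero, mul_one]
      have e : ∀ x y : ℝ, ‖Complex.exp (x * Complex.I) - Complex.exp (y * Complex.I)‖ ≤ |x - y| := by
        intro x y
        have e1 : Complex.exp (x * Complex.I) - Complex.exp (y * Complex.I) =
            Complex.exp (y * Complex.I) * (Complex.exp (Complex.I * (x - y : ℝ)) - 1) := by
          rw [mul_sub, ← Complex.exp_add, mul_one]
          congr 2
          push_cast
          ring
        rw [e1, norm_mul, Complex.norm_exp_ofReal_mul_I, one_mul]
        exact Real.norm_exp_I_mul_ofReal_sub_one_le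
      refine (e _ _).trans ?_
      rw [← mul_sub, abs_mul]
      gcongr
      rw [one_div, Real.log_inv, abs_le]
      constructor <;> linarith
  refine (norm_integral_le_of_norm_le ((integrable_const _).add hind) hle).trans (le_of_eq ?_)
  rw [integral_add' (integrable_const _) hind, integral_indicator₀ hAm]
  simp [mul_comm]

variable {Ω : ℕ → Type*} [∀ n, MeasurableSpace (Ω n)] {P : ∀ n, Measure (Ω n)}
  [∀ n, IsProbabilityMeasure (P n)] {M : ∀ n, Ω n → Matrix (Fin (n + 1)) (Fin (n + 1)) ℂ}

lemma tendsto_integral_exp_log (hM : ∀ n, IsGUE (M n) (P n)) (τ : ℝ) :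
    Tendsto (fun n : ℕ => Complex.exp ((τ / √(1 / 2 * Real.log (n + 1)) / 4 *
        Real.log (n + 1) : ℝ) * Complex.I) *
      ∫ ω, Complex.exp ((τ / √(1 / 2 * Real.log (n + 1)) *
        Real.log |(detPoint (M n ω)).re| : ℝ) * Complex.I) ∂P n) atTop
      (𝓝 (Complex.exp (-(τ ^ 2 / 2 : ℝ)))) := by
  have ht0 : Tendsto (fun n : ℕ => τ / √(1 / 2 * Real.log (n + 1))) atTop (𝓝 0) :=
    tendsto_const_nhds.div_atTop (Real.tendsto_sqrt_atTop.comp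
      (tendsto_log_natCast_add_one.const_mul_atTop (by norm_num)))
  -- One share is for the logarithmic term, which vanishes as `ε` is fixed and the frequency tends
  -- to zero; two are for the exceptional event.
  have h0 : Tendsto (fun m : ℕ => 3 * (1 / (m + 1 : ℝ))) atTop (𝓝 0) := by
    simpa using tendsto_one_div_add_atTop_nhds_zero_nat.const_mul (3 : ℝ)
  refine tendsto_of_forall_eventually_norm_sub_le h0 (fun m => ?_)
    (fun _ => tendsto_integral_polarChar_mul_exp hM τ)
  obtain ⟨ε, hε, hε1, hev⟩ := exists_eventually_measureReal_le hM
    (by positivity : (0 : ℝ) < 1 / (m + 1))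
  have hsmall : Tendsto (fun n : ℕ => |τ / √(1 / 2 * Real.log (n + 1))| * Real.log (1 / ε)) atTop
      (𝓝 0) := by
    simpa using ht0.abs.mul_const (Real.log (1 / ε))
  filter_upwards [hev, hsmall.eventually_le_const (by positivity : (0 : ℝ) < 1 / (m + 1))]
    with n h1 h2
  rw [← mul_sub, norm_mul, Complex.norm_exp_ofReal_mul_I, one_mul]
  refine ((hM n).norm_integral_exp_log_sub_le _ hε hε1).trans ?_
  linarith

end IsGUE

theorem corollary4 {Ω : ℕ → Type*} [∀ n, MeasurableSpace (Ω n)]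
    (P : ∀ n, Measure (Ω n)) [∀ n, IsProbabilityMeasure (P n)]
    (M : ∀ n, Ω n → Matrix (Fin n) (Fin n) ℂ) (hM : ∀ n, IsGUE (M n) (P n)) :
    TendstoInDistribution
      (fun (n : ℕ) (ω : Ω n) =>
        (Real.log ‖(M n ω).det‖ - (1 / 2) * Real.log (n.factorial : ℝ) + (1 / 4) * Real.log (n : ℝ)) /
          √((1 / 2) * Real.log (n : ℝ)))
      atTop (id : ℝ → ℝ) P (gaussianReal 0 1) := by
  have hmeas : ∀ n : ℕ, AEMeasurable (fun ω : Ω n =>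
      (Real.log ‖(M n ω).det‖ - (1 / 2) * Real.log (n.factorial : ℝ) + (1 / 4) * Real.log (n : ℝ)) /
          √((1 / 2) * Real.log (n : ℝ))) (P n) := fun n =>
    (((hM n).aemeasurable_log_norm_det.sub_const _).add_const _).div_const _
  refine ⟨hmeas, aemeasurable_id, ?_⟩
  refine ProbabilityMeasure.tendsto_of_tendsto_charFun fun τ => ?_
  simp only [ProbabilityMeasure.coe_mk, Measure.map_id, charFun_gaussianReal]
  -- The preceding limits concern matrices of order `n + 1`; the shift discards order zero.
  rw [← tendsto_add_atTop_iff_nat 1]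
  have h := IsGUE.tendsto_integral_exp_log (P := fun n => P (n + 1)) (M := fun n => M (n + 1))
    (fun n => hM (n + 1)) τ
  convert h using 2 with n
  · rw [charFun_apply_real, integral_map (hmeas (n + 1)) (by fun_prop), ← integral_const_mul]
    refine integral_congr_ae ?_
    filter_upwards [(hM (n + 1)).ae_log_norm_det_eq] with ω hω
    rw [hω, ← Complex.exp_add]
    congr 1
    push_cast
    ring
  · push_cast
    ring_nf
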